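/- Let $a,b,c,n,r,s$ be integers with $n>0$, $a,b,c\ge 0$, $a+b+c>0$, and put $d=2a+b+c$. Let $\Gamma=\Gamma(a,b,c,n)$ be the following trivalent graph in $S^2=\mathbb{C}\cup\{\infty\}$. It contains $n$ upper cycles $C'_1,\dots,C'_n$ and $n$ lower cycles $C''_1,\dots,C''_n$ (indices mod $n$), bounding disjoint discs and each having $d$ vertices, and a set $A$ of $nd$ further disjoint arcs. It is invariant under the rotation $\rho_n$ of $S^2$ through $2\pi/n$ about the axis through $0$ and $\infty$, with $\rho_n(C'_i)=C'_{i+1}$ and $\rho_n(C''_i)=C''_{i+1}$; the upper cycles form a row around the axis, and so do the lower ones, with $C''_i$ below $C'_i$. For each $i$, $A$ contains $a$ parallel arcs from $C'_i$ to $C'_{i+1}$, $a$ parallel arcs from $C''_i$ to $C''_{i+1}$, $b$ parallel arcs from $C'_i$ to $C''_{i+1}$ and $c$ parallel arcs from $C'_i$ to $C''_i$. On $C'_i$ one meets clockwise the endpoints of the arcs to $C'_{i+1}$, to $C''_{i+1}$, to $C''_i$ and to $C'_{i-1}$, in this order; on $C''_i$ one meets counterclockwise the endpoints of the arcs to $C''_{i+1}$,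 to $C'_i$, to $C'_{i-1}$ and to $C''_{i-1}$, in this order. The vertices of $C'_i$ in this order are labelled $1,\dots,d$, and those of $C''_i$ are labelled $1-r,2-r,\dots,d-r$ (mod $d$). Remove the open discs bounded by the cycles and, for each $i$, glue $C'_i$ with $C''_{i-s}$ so that equally labelled vertices (and the edges between them) are identified. This gives an orientable surface $T_n$ of genus $n$, on which $\rho_n$ induces a homeomorphism, again denoted $\rho_n$; let $\mathcal{G}_n=\langle\rho_n\rangle$. Let $\mathcal{C}$ be the set of the curves $C_i=C'_i=C''_{i-s}$ of $T_n$, let $\Lambda\subset T_n$ be the union of the images of the arcs of $A$, and let $\mathcal{D}$ be the set of the cycles formed by these arcs, that is, of the connected components of $\Lambda$. The 6-tuple $(a,b,c,n,r,s)$ is called admissible if $\mathcal{D}$ has exactly $n$ elements and $T_n\setminus\Lambda$ is connected; $H(a,b,c,n,r,s)$ then denotes its Heegaard diagram, given by the labelled graph $\Gamma$ in $S^2$ or by the curves $\mathcal{C}$, $\mathcal{D}$ on $T_n$. Suppose that $(a,b,c,n,r,s)$ is admissible. (a) $\rho_n$ permutes the curves of $\mathcal{D}$ cyclically: for each $D\in\mathcal{D}$,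 $\mathcal{D}=\{\rho_n^{k-1}(D) : k=1,\dots,n\}$. Moreover $\mathcal{G}_n$ acts simply transitively on $\mathcal{D}$. (b) $(a,b,c,1,r,0)$ is admissible, and $H(a,b,c,1,r,0)$ is the quotient of $H(a,b,c,n,r,s)$ by $\mathcal{G}_n$: there are homeomorphisms $\varphi:S^2/\mathcal{G}_n\to S^2$ and $\psi:T_n/\mathcal{G}_n\to T_1$ such that $\varphi$ carries the images of the labelled oriented cycles $C'_i$, $C''_i$ and of the arcs of $\Gamma(a,b,c,n)$ to the labelled oriented cycles $C'_1$, $C''_1$ and to the corresponding arcs of $\Gamma(a,b,c,1)$, $\varphi$ carries the image of the sphere with $2n$ holes onto the sphere with two holes and there $\varphi$ and $\psi$ commute with the gluing maps, and $\psi$ carries the images of the curves of $\mathcal{C}$ and $\mathcal{D}$ to the curves of the diagram on $T_1$. -/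

import Mathlib

open Set Topology

noncomputable section

namespace Dunwoody

/-- The 6-tuples of integers `(a, b, c, n, r, s)` with `n > 0`, `a, b, c ≥ 0` and
`a + b + c > 0`. -/
structure SixTuple where
  a : ℕ
  b : ℕ
  c : ℕ
  n : ℕ
  r : ℤ
  s : ℤ
  n_pos : 0 < n
  abc_pos : 0 < a + b + c

/-- The sphere `S²`, as the one-point compactification of the plane. -/
abbrev Sphere : Type := OnePoint ℂ

/-! ### Plane geometry in the coordinate of the universal cover of the punctured plane

Everything is drawn in `ℂ`, with `n` columns per period, and is then wrapped around the origin by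
`p ↦ exp (2πip/n)`: translation by `1` becomes the rotation through `2π/n`. The upper disc of
column `i` has centre `i + (5/4)I` and radius `1/4`; the lower discs are the complex conjugates
of the upper ones. -/

/-- The centre of the upper disc of column `i`. -/
def centre (i : ℤ) : ℂ := (i : ℂ) + (5 / 4 : ℂ) * Complex.I

/-- The angles of the `d` vertices of an upper circle, in clockwise order along its lower half,
namely `-π/(d+1), -2π/(d+1), …, -dπ/(d+1)`; the value at `d` is the angle of the first vertex
after one more clockwise turn. -/
def angle (d k : ℕ) : ℝ :=
  if k < d then -(Real.pi * (k + 1) / (d + 1)) else -(Real.pi / (d + 1)) - 2 * Real.pi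

/-- The point at the fraction `t` of the `k`-th edge of the upper circle of column `i`. This edge
runs clockwise from the `k`-th vertex to the next one (vertices and edges are counted from `0`
here; `0 ≤ k < d`, `0 ≤ t ≤ 1`). -/
def upperPt (d : ℕ) (i : ℤ) (k : ℕ) (t : ℝ) : ℂ :=
  centre i + (1 / 4 : ℂ) *
    Complex.exp ((((1 - t) * angle d k + t * angle d (k + 1) : ℝ) : ℂ) * Complex.I)

/-- The same point for the lower circle, whose edges run counterclockwise. -/
def lowerPt (d : ℕ) (i : ℤ) (k : ℕ) (t : ℝ) : ℂ := (starRingEnd ℂ) (upperPt d i k t)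

/-- The `k`-th vertex of an upper circle, `0 ≤ k < d`. -/
def upperVx (d : ℕ) (i : ℤ) (k : ℕ) : ℂ := upperPt d i k 0

/-- The `k`-th vertex of a lower circle, `0 ≤ k < d`. -/
def lowerVx (d : ℕ) (i : ℤ) (k : ℕ) : ℂ := lowerPt d i k 0

/-- The path from `p` (on the lower half of an upper circle) to `q` (on the upper half of a lower
circle) that goes down vertically to height `1`, then straight to height `-1` above `q`, then
down vertically to `q`. -/
def descent (p q : ℂ) : Set ℂ :=
  segment ℝ p ⟨p.re, 1⟩ ∪ segment ℝ ⟨p.re, 1⟩ ⟨q.re, -1⟩ ∪ segment ℝ ⟨q.re, -1⟩ q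

/-- The names of the `d = 2a + b + c` arcs that belong to one column. -/
inductive ArcName (a b c : ℕ) : Type
  | upper (j : Fin a)
  | lower (j : Fin a)
  | oblique (k : Fin b)
  | vertical (k : Fin c)

namespace SixTuple

variable (σ : SixTuple)

/-- The number of vertices of each cycle. -/
def d : ℕ := 2 * σ.a + σ.b + σ.c

/-- The 6-tuple `(a, b, c, 1, r, 0)`. -/
def base : SixTuple := ⟨σ.a, σ.b, σ.c, 1, σ.r, 0, one_pos, σ.abc_pos⟩

/-- The arcs of column `i` drawn in the cover: `a` parallel arcs from the `i`-th upper circle to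
the next one, `a` parallel arcs from the `i`-th lower circle to the next one, `b` parallel arcs
from the `i`-th upper circle to the next lower circle and `c` parallel arcs from the `i`-th upper
circle to the `i`-th lower circle. -/
def coverArc (i : ℤ) : ArcName σ.a σ.b σ.c → Set ℂ
  | .upper j => segment ℝ (upperVx σ.d i j) (upperVx σ.d (i + 1) (σ.d - 1 - j))
  | .lower j => segment ℝ (lowerVx σ.d i j) (lowerVx σ.d (i + 1) (σ.d - 1 - j))
  | .oblique k => descent (upperVx σ.d i (σ.a + k)) (lowerVx σ.d (i + 1) (σ.a + σ.c + k))
  | .vertical k => descent (upperVx σ.d i (σ.a + σ.b + k)) (lowerVx σ.d i (σ.a + k))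

/-! ### The graph `Γ` on the sphere -/

/-- The map that wraps the cover around the origin of the plane. -/
def wrap (p : ℂ) : Sphere := ((Complex.exp (2 * Real.pi * Complex.I * p / σ.n) : ℂ) : OnePoint ℂ)

/-- The cycle `C'_i` (`i` is taken mod `n`). -/
def upperCycle (i : ℤ) : Set Sphere := σ.wrap '' Metric.sphere (centre i) (1 / 4)

/-- The cycle `C''_i` (`i` is taken mod `n`). -/
def lowerCycle (i : ℤ) : Set Sphere :=
  σ.wrap '' Metric.sphere ((starRingEnd ℂ) (centre i)) (1 / 4)

/-- The arc of `A` with the given name in column `i` (`i` is taken mod `n`). -/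
def arc (i : ℤ) (τ : ArcName σ.a σ.b σ.c) : Set Sphere := σ.wrap '' σ.coverArc i τ

/-- The position, counted from `0`, of the vertex with label `j` on the cycles `C'_i`: the labels
are `1, …, d` clockwise and are read mod `d`. -/
def pos (j : ℤ) : ℕ := ((j - 1) % (σ.d : ℤ)).toNat

/-- The point at the fraction `t` of the edge of `C'_i` from the vertex labelled `j` to the vertex
labelled `j + 1` (labels mod `d`). For `t = 0` this is the vertex labelled `j`. -/
def upperPoint (i j : ℤ) (t : ℝ) : Sphere := σ.wrap (upperPt σ.d i (σ.pos j) t)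

/-- The point at the fraction `t` of the edge of `C''_i` from the vertex labelled `j` to the vertex
labelled `j + 1` (labels mod `d`). For `t = 0` this is the vertex labelled `j`. The first
vertex of `C''_i` has the label `1 - r`. -/
def lowerPoint (i j : ℤ) (t : ℝ) : Sphere := σ.wrap (lowerPt σ.d i (σ.pos (j + σ.r)) t)

/-- The sphere with `2n` holes: the open discs bounded by the cycles are removed. -/
def holed : Set Sphere :=
  (⋃ i : ℤ, σ.wrap '' Metric.ball (centre i) (1 / 4) ∪
    σ.wrap '' Metric.ball ((starRingEnd ℂ) (centre i)) (1 / 4))ᶜ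

/-! ### The surface `T_n` and the curves on it -/

/-- The gluing of `C'_i` with `C''_{i-s}` that identifies equally labelled vertices (and the edges
between them). -/
def Glue (x y : σ.holed) : Prop :=
  ∃ i j : ℤ, ∃ t ∈ Icc (0 : ℝ) 1, x.1 = σ.upperPoint i j t ∧ y.1 = σ.lowerPoint (i - σ.s) j t

/-- The surface `T_n`: the quotient of the sphere with holes by the equivalence relation that the
gluing generates, with the quotient topology. -/
abbrev Surface : Type := Quot σ.Glue

/-- The gluing map from the sphere with holes to `T_n`. -/
def glueMap : σ.holed → σ.Surface := Quot.mk σ.Glue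

/-- The image in `T_n` of a subset of the sphere. -/
def onSurface (X : Set Sphere) : Set σ.Surface := σ.glueMap '' {x | x.1 ∈ X}

/-- The curve `C_i`, the common image of `C'_i` and `C''_{i-s}`. -/
def curveC (i : ℤ) : Set σ.Surface := σ.onSurface (σ.upperCycle i)

/-- The set `𝒞` of the curves `C_i`. -/
def curvesC : Set (Set σ.Surface) := range σ.curveC

/-- The space `Λ`, the union in `T_n` of all the arcs of `A`. -/
def lam : Set σ.Surface := σ.onSurface (⋃ i, ⋃ τ, σ.arc i τ)

/-- The set `𝒟` of the cycles formed by the arcs of `A` in `T_n`, i.e. of the connected components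
of `Λ`. -/
def curvesD : Set (Set σ.Surface) := {D | ∃ x ∈ σ.lam, D = connectedComponentIn σ.lam x}

/-- Admissibility: `𝒟` consists of exactly `n` cycles, and cutting along them does not disconnect
the surface. -/
def Admissible : Prop := σ.curvesD.ncard = σ.n ∧ IsConnected σ.lamᶜ

/-! ### The rotation -/

/-- The complex number `exp (2πi/n)`. -/
def zeta : ℂ := Complex.exp (2 * Real.pi * Complex.I / σ.n)

/-- The rotation `ρ_n` of the sphere through `2π/n`, with fixed points `0` and `∞`. -/
def rotSphere : Sphere ≃ₜ Sphere :=
  (Homeomorph.mulLeft₀ σ.zeta (Complex.exp_ne_zero _)).onePointCongr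

lemma rotSphere_wrap (p : ℂ) : σ.rotSphere (σ.wrap p) = σ.wrap (p + 1) := by
  change ((σ.zeta * _ : ℂ) : OnePoint ℂ) = _
  unfold wrap zeta
  rw [← Complex.exp_add]
  congr 2
  ring

lemma centre_add_one (i : ℤ) : centre (i + 1) = centre i + 1 := by
  unfold centre; push_cast; ring

lemma upperPt_add_one (d : ℕ) (i : ℤ) (k : ℕ) (t : ℝ) :
    upperPt d (i + 1) k t = upperPt d i k t + 1 := by
  unfold upperPt; rw [centre_add_one]; ring

lemma rotSphere_upperPoint (i j : ℤ) (t : ℝ) :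
    σ.rotSphere (σ.upperPoint i j t) = σ.upperPoint (i + 1) j t := by
  unfold upperPoint; rw [rotSphere_wrap, upperPt_add_one]

lemma rotSphere_lowerPoint (i j : ℤ) (t : ℝ) :
    σ.rotSphere (σ.lowerPoint i j t) = σ.lowerPoint (i + 1) j t := by
  unfold lowerPoint lowerPt; rw [rotSphere_wrap, upperPt_add_one]; simp

lemma rotSphere_mem_ball (z : ℂ) (x : Sphere) :
    σ.rotSphere x ∈ σ.wrap '' Metric.ball (z + 1) (1 / 4) ↔
      x ∈ σ.wrap '' Metric.ball z (1 / 4) := by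
  constructor
  · rintro ⟨p, hp, h⟩
    refine ⟨p - 1, ?_, ?_⟩
    · rw [Metric.mem_ball, dist_eq_norm] at hp ⊢
      rwa [show p - 1 - z = p - (z + 1) by ring]
    · apply σ.rotSphere.injective
      rw [rotSphere_wrap, ← h]
      simp
  · rintro ⟨p, hp, rfl⟩
    refine ⟨p + 1, ?_, (σ.rotSphere_wrap p).symm⟩
    rw [Metric.mem_ball, dist_eq_norm] at hp ⊢
    rwa [show p + 1 - (z + 1) = p - z by ring]

lemma rotSphere_mem_holed (x : Sphere) : x ∈ σ.holed ↔ σ.rotSphere x ∈ σ.holed := by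
  have key : ∀ i : ℤ,
      (σ.rotSphere x ∈ σ.wrap '' Metric.ball (centre (i + 1)) (1 / 4) ∪
        σ.wrap '' Metric.ball ((starRingEnd ℂ) (centre (i + 1))) (1 / 4)) ↔
      (x ∈ σ.wrap '' Metric.ball (centre i) (1 / 4) ∪
        σ.wrap '' Metric.ball ((starRingEnd ℂ) (centre i)) (1 / 4)) := by
    intro i
    rw [centre_add_one, map_add, map_one, mem_union, mem_union, rotSphere_mem_ball,
      rotSphere_mem_ball]
  unfold holed
  rw [mem_compl_iff, mem_compl_iff, not_iff_not, mem_iUnion, mem_iUnion]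
  constructor
  · rintro ⟨i, hi⟩
    exact ⟨i + 1, (key i).2 hi⟩
  · rintro ⟨i, hi⟩
    refine ⟨i - 1, (key (i - 1)).1 ?_⟩
    rwa [sub_add_cancel]

/-- The rotation of the sphere with holes. -/
def rotHoled : σ.holed ≃ₜ σ.holed := σ.rotSphere.subtype σ.rotSphere_mem_holed

lemma glue_rot (x y : σ.holed) : σ.Glue x y ↔ σ.Glue (σ.rotHoled x) (σ.rotHoled y) := by
  constructor
  · rintro ⟨i, j, t, ht, hx, hy⟩
    refine ⟨i + 1, j, t, ht, ?_, ?_⟩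
    · change σ.rotSphere x.1 = _
      rw [hx, rotSphere_upperPoint]
    · change σ.rotSphere y.1 = _
      rw [hy, rotSphere_lowerPoint]
      congr 1; ring
  · rintro ⟨i, j, t, ht, hx, hy⟩
    refine ⟨i - 1, j, t, ht, ?_, ?_⟩ <;> apply σ.rotSphere.injective
    · rw [rotSphere_upperPoint, sub_add_cancel]; exact hx
    · rw [rotSphere_lowerPoint, show i - 1 - σ.s + 1 = i - σ.s by ring]; exact hy

/-- The homeomorphism of `T_n` that the rotation `ρ_n` induces. -/
def rot : σ.Surface ≃ₜ σ.Surface where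
  toEquiv := Quot.congr σ.rotHoled.toEquiv σ.glue_rot
  continuous_toFun := continuous_quot_lift _ (continuous_quot_mk.comp σ.rotHoled.continuous)
  continuous_invFun := continuous_quot_lift _ (continuous_quot_mk.comp σ.rotHoled.symm.continuous)

/-- The cyclic group `𝒢_n` of homeomorphisms of `T_n` that `ρ_n` generates. -/
def rotGroup : Subgroup (σ.Surface ≃ₜ σ.Surface) := Subgroup.zpowers σ.rot

end SixTuple

/-- The orbit relation of the cyclic group generated by a homeomorphism `ρ`. -/
def orbitSetoid {X : Type} [TopologicalSpace X] (ρ : X ≃ₜ X) : Setoid X where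
  r x y := ∃ k : ℤ, (ρ ^ k) x = y
  iseqv :=
    { refl := fun x => ⟨0, by simp⟩
      symm := by
        rintro x y ⟨k, rfl⟩
        refine ⟨-k, ?_⟩
        change (ρ ^ (-k) * ρ ^ k) x = x
        simp
      trans := by
        rintro x y z ⟨k, rfl⟩ ⟨l, rfl⟩
        refine ⟨l + k, ?_⟩
        rw [zpow_add]
        rfl }

/-- The quotient space of `X` by the cyclic group generated by `ρ`, with the quotient topology. -/
abbrev OrbitSpace {X : Type} [TopologicalSpace X] (ρ : X ≃ₜ X) : Type := Quotient (orbitSetoid ρ)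

/-- The projection to the quotient space. -/
def orbitMap {X : Type} [TopologicalSpace X] (ρ : X ≃ₜ X) : X → OrbitSpace ρ :=
  Quotient.mk (orbitSetoid ρ)

namespace SixTuple

variable (σ : SixTuple)

/-- The Heegaard diagram `H(a, b, c, 1, r, 0)` is the quotient of `H(a, b, c, n, r, s)` by `𝒢_n`.

There are homeomorphisms `φ : S²/𝒢_n → S²` and `ψ : T_n/𝒢_n → T_1` such that
* `φ` carries the image of the graph `Γ(a, b, c, n)` to `Γ(a, b, c, 1)`: the labelled oriented
  cycles `C'_i`, `C''_i` go to `C'_1`, `C''_1`, label by label, and each arc of `A` goes to the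
  arc of the same name;
* `φ` carries the image of the sphere with `2n` holes onto the sphere with two holes, and there
  `φ` and `ψ` commute with the gluing maps;
* `ψ` carries the images of the curves of `𝒞` and of `𝒟` to the curves of `𝒞` and of `𝒟` of
  the diagram on `T_1`. -/
def BaseIsQuotient : Prop :=
  ∃ (φ : OrbitSpace σ.rotSphere ≃ₜ Sphere) (ψ : OrbitSpace σ.rot ≃ₜ σ.base.Surface),
    (∀ i j : ℤ, ∀ t ∈ Icc (0 : ℝ) 1,
      φ (orbitMap σ.rotSphere (σ.upperPoint i j t)) = σ.base.upperPoint 1 j t ∧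
      φ (orbitMap σ.rotSphere (σ.lowerPoint i j t)) = σ.base.lowerPoint 1 j t) ∧
    (∀ (i : ℤ) (τ : ArcName σ.a σ.b σ.c),
      φ '' (orbitMap σ.rotSphere '' σ.arc i τ) = σ.base.arc 1 τ) ∧
    φ '' (orbitMap σ.rotSphere '' σ.holed) = σ.base.holed ∧
    (∀ (x : σ.holed) (y : σ.base.holed), φ (orbitMap σ.rotSphere x.1) = y.1 →
      ψ (orbitMap σ.rot (σ.glueMap x)) = σ.base.glueMap y) ∧
    (fun C => ψ '' (orbitMap σ.rot '' C)) '' σ.curvesC = σ.base.curvesC ∧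
    (fun D => ψ '' (orbitMap σ.rot '' D)) '' σ.curvesD = σ.base.curvesD

end SixTuple

end Dunwoody

end

/-! In the logarithmic cover the diagrams for `n` and for `1` are the same picture, wrapped with
different periods. Hence z ↦ z^n (`powMap`) carries one to the other, and its fibres are the orbits
of the rotation. It respects the gluings and descends to `proj` from T_n to T_1, a quotient map
whose fibres are the orbits of `rot` (`proj_eq_iff`) and for which Λ is the preimage of the
corresponding set on T_1. This gives φ and ψ. The complement of Λ on T_1 is the image of a connected
set, so it is connected.

The essential point is that Λ is connected on T_1 (`isPreconnected_lam`). If it split into two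
nonempty parts, these would be disjoint cycles w₁, w₂ modulo 2 on a torus. The intersection form on
its first homology is nondegenerate of rank 2, so one of w₁, w₂, w₁ + w₂ bounds; a nonempty bounding
union of cycles separates the surface, a contradiction.

This homology argument is made explicit. A weight `w` on the arcs that crosses the circles an even
number of times is the jump of a function modulo 2 on the sphere with holes, given by the formula
`field`. Its values on the two sides of the glued circle differ by a constant, the `gap`. If the gap
vanishes, the function descends to T_1; it is locally constant off Λ and takes both values.
Following the values of `field` along a union of cycles χ shows that the gap of `w` times the
crossing number of χ with the circle is even (`gap_mul_eq_zero`), which lets `exists_null_weight`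
choose a weight with gap zero.

For general `n`, the set Λ has finitely many components and its orbit space is connected, so the
rotations permute the components transitively (`exists_zpow_image_component`). There are `n`
components and the `n`-th power of the rotation is the identity, so the `n` powers move a given
curve to `n` distinct curves: the action is cyclic and simply transitive. -/

namespace Dunwoody

/-! ### Sums along the words of arc ends around a circle -/

/-- The word `α β γ α⁻¹` of length `2a + b + c` (where `α⁻¹` is `α` read backwards). -/
def word {R : Type*} [Zero R] {a b c : ℕ} (α : Fin a → R) (β : Fin b → R) (γ : Fin c → R)
    (k : ℕ) : R :=
  if h : k < a then α ⟨k, h⟩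
  else if h : k - a < b then β ⟨k - a, h⟩
  else if h : k - a - b < c then γ ⟨k - a - b, h⟩
  else if h : 2 * a + b + c - 1 - k < a then α ⟨2 * a + b + c - 1 - k, h⟩
  else 0

section word

variable {R : Type*} {a b c : ℕ}

lemma word_first [Zero R] (α : Fin a → R) (β : Fin b → R) (γ : Fin c → R) (j : Fin a) :
    word α β γ j = α j := by
  simp [word]

lemma word_second [Zero R] (α : Fin a → R) (β : Fin b → R) (γ : Fin c → R) (k : Fin b) :
    word α β γ (a + k) = β k := by
  simp [word]

lemma word_third [Zero R] (α : Fin a → R) (β : Fin b → R) (γ : Fin c → R) (k : Fin c) :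
    word α β γ (a + b + k) = γ k := by
  have h1 : ¬ (a + b + (k : ℕ) < a) := by omega
  have h2 : ¬ (a + b + (k : ℕ) - a < b) := by omega
  have h3 : a + b + (k : ℕ) - a - b = k := by omega
  simp [word, h1, h2, h3]

lemma word_fourth [Zero R] (α : Fin a → R) (β : Fin b → R) (γ : Fin c → R) (j : Fin a) :
    word α β γ (2 * a + b + c - 1 - j) = α j := by
  have hj := j.2
  have h1 : ¬ (2 * a + b + c - 1 - (j : ℕ) < a) := by omega
  have h2 : ¬ (2 * a + b + c - 1 - (j : ℕ) - a < b) := by omega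
  have h3 : ¬ (2 * a + b + c - 1 - (j : ℕ) - a - b < c) := by omega
  have h4 : 2 * a + b + c - 1 - (2 * a + b + c - 1 - (j : ℕ)) = j := by omega
  simp [word, h1, h2, h3, h4]

lemma word_cases {d k : ℕ} (hd : d = 2 * a + b + c) (hk : k < d) :
    (∃ j : Fin a, k = j) ∨ (∃ i : Fin b, k = a + i) ∨ (∃ i : Fin c, k = a + b + i) ∨
      ∃ j : Fin a, k = 2 * a + b + c - 1 - j := by
  by_cases h1 : k < a
  · exact .inl ⟨⟨k, h1⟩, rfl⟩
  by_cases h2 : k < a + b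
  · exact .inr (.inl ⟨⟨k - a, by omega⟩, by simp only; omega⟩)
  by_cases h3 : k < a + b + c
  · exact .inr (.inr (.inl ⟨⟨k - a - b, by omega⟩, by simp only; omega⟩))
  · exact .inr (.inr (.inr ⟨⟨2 * a + b + c - 1 - k, by omega⟩, by simp only; omega⟩))

lemma word_map {S : Type*} [Zero R] [Zero S] (f : R → S) (hf : f 0 = 0) (α : Fin a → R)
    (β : Fin b → R) (γ : Fin c → R) (k : ℕ) :
    word (fun j => f (α j)) (fun j => f (β j)) (fun j => f (γ j)) k = f (word α β γ k) := by
  unfold word; split_ifs <;> simp [hf]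

lemma word_add [AddCommMonoid R] (α α' : Fin a → R) (β β' : Fin b → R) (γ γ' : Fin c → R)
    (k : ℕ) :
    word (fun j => α j + α' j) (fun j => β j + β' j) (fun j => γ j + γ' j) k =
      word α β γ k + word α' β' γ' k := by
  unfold word; split_ifs <;> simp

/-- Regroups a sum over the vertices of one circle as a sum over arcs: a horizontal arc accounts for
two vertices, every other arc for one. -/
lemma sum_word_mul [CommRing R] {d : ℕ} (hd : d = 2 * a + b + c) (α : Fin a → R) (β : Fin b → R)
    (γ : Fin c → R) (φ : ℕ → R) :
    ∑ k ∈ Finset.range d, word α β γ k * φ k =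
      ∑ j : Fin a, α j * (φ j + φ (d - 1 - j)) + ∑ k : Fin b, β k * φ (a + k) +
        ∑ k : Fin c, γ k * φ (a + b + k) := by
  have e : d = a + b + c + a := by omega
  rw [e, Finset.sum_range_add, Finset.sum_range_add, Finset.sum_range_add]
  simp only [mul_add, Finset.sum_add_distrib]
  have h4 : ∑ x ∈ Finset.range a, word α β γ (a + b + c + x) * φ (a + b + c + x) =
      ∑ j : Fin a, α j * φ (a + b + c + a - 1 - j) := by
    rw [← Finset.sum_range_reflect, Finset.sum_range]
    refine Finset.sum_congr rfl fun j _ => ?_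
    have hj := j.2
    have e1 : a + b + c + (a - 1 - (j : ℕ)) = 2 * a + b + c - 1 - j := by omega
    have e2 : a + b + c + a - 1 - (j : ℕ) = 2 * a + b + c - 1 - j := by omega
    rw [e1, e2, word_fourth]
  rw [h4, Finset.sum_range, Finset.sum_range, Finset.sum_range]
  simp only [word_first, word_second, word_third]
  ring

lemma sum_word [CommRing R] {d : ℕ} (hd : d = 2 * a + b + c) (α : Fin a → R) (β : Fin b → R)
    (γ : Fin c → R) :
    ∑ k ∈ Finset.range d, word α β γ k = 2 * ∑ j, α j + ∑ k, β k + ∑ k, γ k := by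
  have h := sum_word_mul hd α β γ (fun _ => 1)
  simp only [mul_one] at h
  rw [h, ← Finset.sum_mul]
  ring

lemma sum_word_lt [CommRing R] {d K : ℕ} (hd : d = 2 * a + b + c) (hK : K ≤ d) (α : Fin a → R)
    (β : Fin b → R) (γ : Fin c → R) :
    ∑ q ∈ Finset.range K, word α β γ q =
      ∑ j : Fin a, α j * ((if (j : ℕ) < K then 1 else 0) + if d - 1 - (j : ℕ) < K then 1 else 0) +
        ∑ k : Fin b, β k * (if a + (k : ℕ) < K then 1 else 0) +
        ∑ k : Fin c, γ k * (if a + b + (k : ℕ) < K then 1 else 0) := by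
  rw [← sum_word_mul hd α β γ (fun q => if q < K then 1 else 0)]
  simp only [mul_ite, mul_one, mul_zero]
  rw [← Finset.sum_filter]
  refine Finset.sum_congr ?_ fun _ _ => rfl
  ext q
  simp only [Finset.mem_filter, Finset.mem_range]
  omega

end word

section partialSums

variable {a b c d : ℕ}

/-- The last `j` letters mirror the first `j`, and the total is zero, so modulo 2 the partial sums
of lengths `j` and `d - j` agree. Only the letter at position `j` remains. -/
lemma sum_first (α : Fin a → ZMod 2) (β : Fin b → ZMod 2) (γ : Fin c → ZMod 2) (j : Fin a)
    (hd : d = 2 * a + b + c) (h0 : ∑ k ∈ Finset.range d, word α β γ k = 0) :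
    ∑ q ∈ Finset.range (j + 1), word α β γ q + ∑ q ∈ Finset.range (d - 1 - j + 1), word α β γ q
      = α j := by
  have hj := j.2
  have h2 : ∑ k ∈ Finset.range d, word α β γ k =
      ∑ q ∈ Finset.range (d - 1 - j + 1), word α β γ q + ∑ q ∈ Finset.range j, word α β γ q := by
    conv_lhs => rw [show d = (d - 1 - j + 1) + j by omega, Finset.sum_range_add]
    congr 1
    rw [← Finset.sum_range_reflect]
    refine Finset.sum_congr rfl fun i hi => ?_
    rw [Finset.mem_range] at hi
    have e1 : d - 1 - (j : ℕ) + 1 + (j - 1 - i) = 2 * a + b + c - 1 - i := by omega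
    rw [e1]
    exact (word_fourth α β γ ⟨i, by omega⟩).trans (word_first α β γ ⟨i, by omega⟩).symm
  rw [h0] at h2
  rw [Finset.sum_range_succ, word_first, add_right_comm, add_comm (∑ q ∈ Finset.range (j : ℕ), _),
    ← h2, zero_add]

lemma sum_second (α : Fin a → ZMod 2) (β : Fin b → ZMod 2) (γ : Fin c → ZMod 2) (k : Fin b) :
    ∑ q ∈ Finset.range (a + k + 1), word α β γ q =
      ∑ j, α j + ∑ i ∈ Finset.range (k + 1), if h : i < b then β ⟨i, h⟩ else 0 := by
  rw [add_assoc, Finset.sum_range_add, Finset.sum_range]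
  simp only [word_first]
  congr 1
  refine Finset.sum_congr rfl fun i hi => ?_
  rw [Finset.mem_range] at hi
  have : i < b := by omega
  rw [dif_pos this]
  exact word_second α β γ ⟨i, this⟩

lemma sum_third (α : Fin a → ZMod 2) (β : Fin b → ZMod 2) (γ : Fin c → ZMod 2) (k : Fin c) :
    ∑ q ∈ Finset.range (a + b + k + 1), word α β γ q =
      ∑ j, α j + ∑ j, β j + ∑ i ∈ Finset.range (k + 1), if h : i < c then γ ⟨i, h⟩ else 0 := by
  rw [add_assoc (a + b), Finset.sum_range_add, Finset.sum_range_add, Finset.sum_range,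
    Finset.sum_range]
  simp only [word_first, word_second]
  congr 1
  refine Finset.sum_congr rfl fun i hi => ?_
  rw [Finset.mem_range] at hi
  have : i < c := by omega
  rw [dif_pos this]
  exact word_third α β γ ⟨i, this⟩

end partialSums

/-! ### Values on the edges of a function that jumps across the arcs -/

namespace ArcName

variable {R : Type*} {a b c : ℕ}

/-- The values of `w` at the vertices of an upper circle. -/
def upWord [Zero R] (w : ArcName a b c → R) : ℕ → R :=
  word (fun j => w (.upper j)) (fun k => w (.oblique k)) (fun k => w (.vertical k))

/-- The values of `w` at the vertices of a lower circle. -/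
def lowWord [Zero R] (w : ArcName a b c → R) : ℕ → R :=
  word (fun j => w (.lower j)) (fun k => w (.vertical k)) (fun k => w (.oblique k))

/-- The values on the edges of an upper circle of a function on the plane that jumps by `w`
across the arcs. -/
def upVal (w : ArcName a b c → ZMod 2) (k : ℕ) : ZMod 2 :=
  ∑ j, w (.upper j) + ∑ q ∈ Finset.range (k + 1), upWord w q

/-- The values of the same function on the edges of a lower circle. -/
def lowVal (w : ArcName a b c → ZMod 2) (k : ℕ) : ZMod 2 :=
  ∑ j, w (.lower j) + ∑ k, w (.oblique k) + ∑ q ∈ Finset.range (k + 1), lowWord w q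

lemma zmod_two_add_self (x : ZMod 2) : x + x = 0 := CharTwo.add_self_eq_zero x

lemma exists_upWord_or_lowWord [Zero R] {d : ℕ} (hd : d = 2 * a + b + c) {w : ArcName a b c → R}
    (τ : ArcName a b c) : (∃ k < d, upWord w k = w τ) ∨ ∃ k < d, lowWord w k = w τ := by
  cases τ with
  | upper j => exact .inl ⟨j, by omega, word_first _ _ _ j⟩
  | lower j => exact .inr ⟨j, by omega, word_first _ _ _ j⟩
  | oblique k => exact .inl ⟨a + k, by omega, word_second _ _ _ k⟩
  | vertical k => exact .inl ⟨a + b + k, by omega, word_third _ _ _ k⟩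

section parity

variable {d : ℕ} (hd : d = 2 * a + b + c) {w : ArcName a b c → ZMod 2}
  (h0 : ∑ k ∈ Finset.range d, upWord w k = 0)
include hd h0

/-- Horizontal arcs are counted twice in the word, so they cancel modulo 2. -/
lemma sum_oblique_add_sum_vertical : ∑ k, w (.oblique k) + ∑ k, w (.vertical k) = 0 := by
  have h := sum_word hd (fun j => w (.upper j)) (fun k => w (.oblique k)) (fun k => w (.vertical k))
  change ∑ k ∈ Finset.range d, upWord w k = _ at h
  rw [h0, two_mul, zmod_two_add_self, zero_add] at h
  exact h.symm

lemma sum_lowWord : ∑ k ∈ Finset.range d, lowWord w k = 0 := by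
  have h := sum_word (d := d) (by omega) (fun j => w (.lower j)) (fun k => w (.vertical k))
    (fun k => w (.oblique k))
  change ∑ k ∈ Finset.range d, lowWord w k = _ at h
  rw [h, two_mul, zmod_two_add_self, zero_add, add_comm]
  exact sum_oblique_add_sum_vertical hd h0

/-- Edges start at their vertex and run clockwise, so the edges that begin at the two ends of a
horizontal arc lie on opposite sides of it. -/
lemma upVal_add_upVal (j : Fin a) : upVal w j + upVal w (d - 1 - j) = w (.upper j) := by
  have h := sum_first _ _ _ j hd h0
  unfold upVal upWord
  rw [← h]
  linear_combination zmod_two_add_self (∑ j, w (.upper j))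

lemma lowVal_add_lowVal (j : Fin a) : lowVal w j + lowVal w (d - 1 - j) = w (.lower j) := by
  have h := sum_first _ _ _ j (d := d) (by omega) (sum_lowWord hd h0)
  unfold lowVal lowWord
  rw [← h]
  linear_combination zmod_two_add_self (∑ j, w (.lower j)) + zmod_two_add_self (∑ j, w (.oblique j))

/-- Upper edges run clockwise and lower edges counterclockwise, so those that begin at the two ends
of a descending arc lie on the same side of it and carry the same value. -/
lemma upVal_add_lowVal_oblique (k : Fin b) : upVal w (a + k) + lowVal w (a + c + k) = 0 := by
  unfold upVal lowVal upWord lowWord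
  rw [sum_second, sum_third]
  linear_combination zmod_two_add_self (∑ j, w (.upper j)) + zmod_two_add_self (∑ j, w (.lower j)) +
    zmod_two_add_self (∑ i ∈ Finset.range (k + 1), if h : i < b then w (.oblique ⟨i, h⟩) else 0) +
    sum_oblique_add_sum_vertical hd h0

omit hd h0 in
lemma upVal_add_lowVal_vertical (k : Fin c) : upVal w (a + b + k) + lowVal w (a + k) = 0 := by
  unfold upVal lowVal upWord lowWord
  rw [sum_second, sum_third]
  linear_combination zmod_two_add_self (∑ j, w (.upper j)) + zmod_two_add_self (∑ j, w (.lower j)) +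
    zmod_two_add_self (∑ i ∈ Finset.range (k + 1), if h : i < c then w (.vertical ⟨i, h⟩) else 0) +
    zmod_two_add_self (∑ j, w (.oblique j))

end parity

end ArcName

/-! ### Labels modulo d and the gluing of the circles -/

/-- The position of the vertex labelled `j` on an upper circle. -/
def labelPos (d : ℕ) (j : ℤ) : ℕ := ((j - 1) % (d : ℤ)).toNat

lemma labelPos_lt {d : ℕ} (hd : 0 < d) (j : ℤ) : labelPos d j < d := by
  have h1 := Int.emod_nonneg (j - 1) (show (d : ℤ) ≠ 0 by omega)
  have h2 := Int.emod_lt_of_pos (j - 1) (show (0 : ℤ) < d by omega)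
  unfold labelPos; omega

lemma labelPos_natCast_succ {d k : ℕ} (hk : k < d) : labelPos d (k + 1) = k := by
  unfold labelPos
  rw [add_sub_cancel_right, Int.emod_eq_of_lt (by omega) (by omega)]
  simp

lemma labelPos_add_one {d : ℕ} (hd : 0 < d) (j : ℤ) :
    labelPos d (j + 1) = labelPos d j + 1 ∨ labelPos d (j + 1) = 0 ∧ labelPos d j = d - 1 := by
  unfold labelPos
  have h1 := Int.emod_nonneg (j - 1) (show (d : ℤ) ≠ 0 by omega)
  have h2 := Int.emod_lt_of_pos (j - 1) (show (0 : ℤ) < d by omega)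
  have h3 : (j + 1 - 1) % (d : ℤ) = ((j - 1) % d + 1) % d := by
    rw [Int.emod_add_emod]; congr 1; ring
  rw [h3]
  rcases lt_or_ge ((j - 1) % (d : ℤ) + 1) d with h | h
  · left; rw [Int.emod_eq_of_lt (by omega) h]; omega
  · right
    have : (j - 1) % (d : ℤ) + 1 = d := by omega
    rw [this, Int.emod_self]; omega

lemma labelPos_injOn {d : ℕ} (hd : 0 < d) (r : ℤ) {k l : ℕ} (hk : k < d) (hl : l < d)
    (h : labelPos d (k + 1 + r) = labelPos d (l + 1 + r)) : k = l := by
  unfold labelPos at h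
  have h1 := Int.emod_nonneg (k + 1 + r - 1) (show (d : ℤ) ≠ 0 by omega)
  have h2 := Int.emod_nonneg (l + 1 + r - 1) (show (d : ℤ) ≠ 0 by omega)
  have h3 : (k + 1 + r - 1) % (d : ℤ) = (l + 1 + r - 1) % (d : ℤ) := by omega
  have h4 : (d : ℤ) ∣ (k - l) := by
    have h5 := Int.ModEq.dvd (show (l + 1 + r - 1) ≡ (k + 1 + r - 1) [ZMOD d] from h3.symm)
    convert h5 using 1; ring
  obtain ⟨m, hm⟩ := h4
  have : m = 0 := by
    by_contra hm0
    rcases lt_or_gt_of_ne hm0 with hm1 | hm1 <;> nlinarith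
  subst this; omega

/-- A shift of the labels permutes the positions; this reindexes sums along the gluing. -/
lemma sum_labelPos {M : Type*} [AddCommMonoid M] {d : ℕ} (hd : 0 < d) (r : ℤ) (φ : ℕ → M) :
    ∑ k ∈ Finset.range d, φ (labelPos d (k + 1 + r)) = ∑ k ∈ Finset.range d, φ k := by
  have hinj : Set.InjOn (fun k : ℕ => labelPos d (k + 1 + r)) (Finset.range d) := by
    intro k hk l hl h
    simp only [Finset.coe_range, Set.mem_Iio] at hk hl
    exact labelPos_injOn hd r hk hl h
  have him : (Finset.range d).image (fun k : ℕ => labelPos d (k + 1 + r)) = Finset.range d := by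
    apply Finset.eq_of_subset_of_card_le
    · intro k hk
      obtain ⟨l, -, rfl⟩ := Finset.mem_image.1 hk
      exact Finset.mem_range.2 (labelPos_lt hd _)
    · rw [Finset.card_image_of_injOn hinj]
  conv_rhs => rw [← him, Finset.sum_image hinj]

/-! ### The gap across the glued circle and the intersection form modulo 2 -/

namespace ArcName

variable {R : Type*} {a b c d : ℕ}

/-- `w` takes equal values on the two arcs that meet in a vertex of the surface. -/
def Compatible [Zero R] (d : ℕ) (r : ℤ) (w : ArcName a b c → R) : Prop :=
  ∀ j : ℤ, upWord w (labelPos d j) = lowWord w (labelPos d (j + r))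

lemma Compatible.map {S : Type*} [Zero R] [Zero S] {r : ℤ} {w : ArcName a b c → R}
    (hw : Compatible d r w) (f : R → S) (hf : f 0 = 0) : Compatible d r (fun τ => f (w τ)) := by
  intro j
  have h := hw j
  unfold upWord lowWord at h ⊢
  rw [word_map f hf, word_map f hf, h]

/-- The rule also holds from the last edge to the first, because the total around the circle is
zero. -/
lemma upVal_step (hd0 : 0 < d) {w : ArcName a b c → ZMod 2}
    (h0 : ∑ k ∈ Finset.range d, upWord w k = 0) (j : ℤ) :
    upVal w (labelPos d (j + 1)) = upVal w (labelPos d j) + upWord w (labelPos d (j + 1)) := by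
  unfold upVal
  rcases labelPos_add_one hd0 j with h | ⟨h, h'⟩
  · rw [h, Finset.sum_range_succ _ (labelPos d j + 1), add_assoc]
  · rw [h, h', show d - 1 + 1 = d by omega, h0, zero_add, Finset.sum_range_one, add_zero]

lemma lowVal_step (hd0 : 0 < d) {w : ArcName a b c → ZMod 2}
    (h0 : ∑ k ∈ Finset.range d, lowWord w k = 0) (j : ℤ) :
    lowVal w (labelPos d (j + 1)) = lowVal w (labelPos d j) + lowWord w (labelPos d (j + 1)) := by
  unfold lowVal
  rcases labelPos_add_one hd0 j with h | ⟨h, h'⟩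
  · rw [h, Finset.sum_range_succ _ (labelPos d j + 1)]; simp only [add_assoc]
  · rw [h, h', show d - 1 + 1 = d by omega, h0, zero_add, Finset.sum_range_one, add_zero]

/-- The discrepancy between the values on both sides of the glued circles. -/
def gap (d : ℕ) (r : ℤ) (w : ArcName a b c → ZMod 2) : ZMod 2 :=
  upVal w (labelPos d 0) + lowVal w (labelPos d (0 + r))

/-- At each vertex the values on both sides of the glued circle jump by the same amount, by
compatibility, so their discrepancy is the same on every edge. -/
lemma upVal_add_lowVal (hd : d = 2 * a + b + c) (hd0 : 0 < d) {r : ℤ}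
    {w : ArcName a b c → ZMod 2} (h0 : ∑ k ∈ Finset.range d, upWord w k = 0)
    (hw : Compatible d r w) (j : ℤ) :
    upVal w (labelPos d j) + lowVal w (labelPos d (j + r)) = gap d r w := by
  have step : ∀ j : ℤ, upVal w (labelPos d (j + 1)) + lowVal w (labelPos d (j + 1 + r)) =
      upVal w (labelPos d j) + lowVal w (labelPos d (j + r)) := by
    intro j
    have e : j + 1 + r = j + r + 1 := by ring
    have hj := hw (j + 1)
    rw [e] at hj ⊢
    rw [upVal_step hd0 h0, lowVal_step hd0 (sum_lowWord hd h0), hj]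
    linear_combination zmod_two_add_self (lowWord w (labelPos d (j + r + 1)))
  induction j using Int.induction_on with
  | zero => rfl
  | succ i ih => rw [step, ih]
  | pred i ih =>
    rw [← ih, ← step (-(i : ℤ) - 1)]
    congr 3 <;> ring_nf

/-- The edge values are followed along the cycles of `χ`. They change by `gap` at each passage
through the glued circle and by `w` along each horizontal arc, and the total change is zero. The
hypothesis on `m` makes the horizontal contributions `m` times the numbers of upper and of lower
arcs of `χ`, which are equal and cancel modulo 2. -/
lemma gap_mul_eq_zero (hd : d = 2 * a + b + c) (hd0 : 0 < d) {r : ℤ}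
    {w : ArcName a b c → ZMod 2} (h0 : ∑ k ∈ Finset.range d, upWord w k = 0)
    (hw : Compatible d r w) {χ : ArcName a b c → ℤ} (hχ : Compatible d r χ) {m : ZMod 2}
    (hm : ∀ τ, (χ τ : ZMod 2) * w τ = m * χ τ) :
    gap d r w * ((∑ k ∈ Finset.range d, upWord χ k : ℤ) : ZMod 2) = 0 := by
  have reindex : ∀ {R : Type} [AddCommMonoid R] (φ ψ : ℕ → R),
      (∀ j, φ (labelPos d j) = ψ (labelPos d (j + r))) →
      ∑ k ∈ Finset.range d, φ k = ∑ k ∈ Finset.range d, ψ k := by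
    intro R _ φ ψ h
    rw [← sum_labelPos hd0 r ψ]
    refine Finset.sum_congr rfl fun k hk => ?_
    rw [← h, labelPos_natCast_succ (Finset.mem_range.1 hk)]
  -- The gluing gives this equality with a factor 2, which can be cancelled over ℤ but not over
  -- `ZMod 2`; therefore `χ` has integer values.
  have hUL : ∑ j, χ (.upper j) = ∑ j, χ (.lower j) := by
    have h := reindex _ _ hχ
    unfold upWord lowWord at h
    rw [sum_word hd, sum_word (by omega)] at h
    linarith
  set χ' : ArcName a b c → ZMod 2 := fun τ => (χ τ : ZMod 2)
  have hχ' : Compatible d r χ' := hχ.map (fun x : ℤ => (x : ZMod 2)) (by simp)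
  have hcast : ((∑ k ∈ Finset.range d, upWord χ k : ℤ) : ZMod 2) =
      ∑ k ∈ Finset.range d, upWord χ' k := by
    rw [Int.cast_sum]
    exact Finset.sum_congr rfl fun k _ =>
      (word_map (fun x : ℤ => (x : ZMod 2)) (by simp) _ _ _ k).symm
  have hlow : ∑ k ∈ Finset.range d, upWord χ' k * (upVal w k + gap d r w) =
      ∑ k ∈ Finset.range d, lowWord χ' k * lowVal w k := by
    apply reindex
    intro j
    rw [hχ' j, ← upVal_add_lowVal hd hd0 h0 hw j, ← add_assoc, zmod_two_add_self, zero_add]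
  have h1 := sum_word_mul hd (fun j => χ' (.upper j)) (fun k => χ' (.oblique k))
    (fun k => χ' (.vertical k)) (upVal w)
  have h2 := sum_word_mul (d := d) (by omega) (fun j => χ' (.lower j)) (fun k => χ' (.vertical k))
    (fun k => χ' (.oblique k)) (lowVal w)
  simp only [upVal_add_upVal hd h0, lowVal_add_lowVal hd h0] at h1 h2
  have eO : ∑ k : Fin b, χ' (.oblique k) * upVal w (a + k) =
      ∑ k : Fin b, χ' (.oblique k) * lowVal w (a + c + k) :=
    Finset.sum_congr rfl fun k _ => by
      rw [CharTwo.add_eq_zero.1 (upVal_add_lowVal_oblique hd h0 k)]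
  have eV : ∑ k : Fin c, χ' (.vertical k) * upVal w (a + b + k) =
      ∑ k : Fin c, χ' (.vertical k) * lowVal w (a + k) :=
    Finset.sum_congr rfl fun k _ => by
      rw [CharTwo.add_eq_zero.1 (upVal_add_lowVal_vertical k)]
  have eUL : ∑ j, χ' (.upper j) * w (.upper j) = ∑ j, χ' (.lower j) * w (.lower j) := by
    simp only [χ', hm, ← Finset.mul_sum]
    rw [← Int.cast_sum, ← Int.cast_sum, hUL]
  change ∑ k ∈ Finset.range d, upWord χ' k * upVal w k = _ at h1
  change ∑ k ∈ Finset.range d, lowWord χ' k * lowVal w k = _ at h2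
  simp only [mul_add, Finset.sum_add_distrib] at hlow
  rw [h1, h2, ← Finset.sum_mul, eO, eV, eUL] at hlow
  rw [hcast]
  linear_combination hlow

lemma gap_add (d : ℕ) (r : ℤ) (w w' : ArcName a b c → ZMod 2) :
    gap d r (fun τ => w τ + w' τ) = gap d r w + gap d r w' := by
  unfold gap upVal lowVal upWord lowWord
  simp only [word_add, Finset.sum_add_distrib]
  ring

/-- If the arcs fall into two nonempty classes, each a union of cycles on the surface, then the
sum modulo 2 of some of the classes bounds. -/
theorem exists_null_weight (hd : d = 2 * a + b + c) (hd0 : 0 < d) {r : ℤ}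
    {χ : ArcName a b c → ℤ} (h01 : ∀ τ, χ τ = 0 ∨ χ τ = 1) (hz : ∃ τ, χ τ = 0) (ho : ∃ τ, χ τ = 1)
    (hχ : Compatible d r χ) :
    ∃ w : ArcName a b c → ZMod 2, (∃ τ, w τ ≠ 0) ∧ ∑ k ∈ Finset.range d, upWord w k = 0 ∧
      Compatible d r w ∧ ∀ j, upVal w (labelPos d j) = lowVal w (labelPos d (j + r)) := by
  classical
  obtain ⟨τ₀, hτ₀⟩ := hz
  obtain ⟨τ₁, hτ₁⟩ := ho
  have suff : ∀ w : ArcName a b c → ZMod 2, (∃ τ, w τ ≠ 0) →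
      ∑ k ∈ Finset.range d, upWord w k = 0 → Compatible d r w → gap d r w = 0 →
      ∃ w : ArcName a b c → ZMod 2, (∃ τ, w τ ≠ 0) ∧ ∑ k ∈ Finset.range d, upWord w k = 0 ∧
        Compatible d r w ∧ ∀ j, upVal w (labelPos d j) = lowVal w (labelPos d (j + r)) :=
    fun w h1 h2 h3 h4 => ⟨w, h1, h2, h3, fun j => by
      rw [← CharTwo.add_eq_zero, upVal_add_lowVal hd hd0 h2 h3, h4]⟩
  have hone : Compatible d r (fun _ : ArcName a b c => (1 : ℤ)) := by
    have key : ∀ {b c : ℕ} (_ : d = 2 * a + b + c) {k : ℕ}, k < d →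
        word (fun _ : Fin a => (1 : ℤ)) (fun _ : Fin b => 1) (fun _ : Fin c => 1) k = 1 := by
      intro b c hd k hk
      rcases word_cases hd hk with ⟨j, rfl⟩ | ⟨j, rfl⟩ | ⟨j, rfl⟩ | ⟨j, rfl⟩
      · rw [word_first]
      · rw [word_second]
      · rw [word_third]
      · rw [word_fourth]
    intro j
    unfold upWord lowWord
    rw [key hd (labelPos_lt hd0 _), key (by omega) (labelPos_lt hd0 _)]
  have hχc : Compatible d r (fun τ => 1 - χ τ) := by
    intro j
    have h1 := hone j
    have h2 := (hχ.map (fun x : ℤ => -x) (by simp)) j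
    have e1 : ∀ k, upWord (fun τ => 1 - χ τ) k =
        upWord (fun _ : ArcName a b c => (1 : ℤ)) k + upWord (fun τ => - χ τ) k := fun k => by
      unfold upWord; rw [← word_add]; rfl
    have e2 : ∀ k, lowWord (fun τ => 1 - χ τ) k =
        lowWord (fun _ : ArcName a b c => (1 : ℤ)) k + lowWord (fun τ => - χ τ) k := fun k => by
      unfold lowWord; rw [← word_add]; rfl
    rw [e1, e2, h1, h2]
  set w₁ : ArcName a b c → ZMod 2 := fun τ => (χ τ : ZMod 2)
  set w₂ : ArcName a b c → ZMod 2 := fun τ => ((1 - χ τ : ℤ) : ZMod 2)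
  have c₁ : Compatible d r w₁ := hχ.map (fun x : ℤ => (x : ZMod 2)) (by simp)
  have c₂ : Compatible d r w₂ := hχc.map (fun x : ℤ => (x : ZMod 2)) (by simp)
  have c₃ : Compatible d r (fun τ => w₁ τ + w₂ τ) := by
    intro j
    have e1 : ∀ k, upWord (fun τ => w₁ τ + w₂ τ) k = upWord w₁ k + upWord w₂ k := fun k =>
      word_add _ _ _ _ _ _ k
    have e2 : ∀ k, lowWord (fun τ => w₁ τ + w₂ τ) k = lowWord w₁ k + lowWord w₂ k := fun k =>
      word_add _ _ _ _ _ _ k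
    rw [e1, e2, c₁ j, c₂ j]
  have n₁ : ∃ τ, w₁ τ ≠ 0 := ⟨τ₁, by simp [w₁, hτ₁]⟩
  have n₂ : ∃ τ, w₂ τ ≠ 0 := ⟨τ₀, by simp [w₂, hτ₀]⟩
  have n₃ : ∃ τ, w₁ τ + w₂ τ ≠ 0 := ⟨τ₀, by simp [w₁, w₂, hτ₀]⟩
  have s₁ : ((∑ k ∈ Finset.range d, upWord χ k : ℤ) : ZMod 2) =
      ∑ k ∈ Finset.range d, upWord w₁ k := by
    rw [Int.cast_sum]
    exact Finset.sum_congr rfl fun k _ =>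
      (word_map (fun x : ℤ => (x : ZMod 2)) (by simp) _ _ _ k).symm
  have s₂ : ((∑ k ∈ Finset.range d, upWord (fun τ => 1 - χ τ) k : ℤ) : ZMod 2) =
      ∑ k ∈ Finset.range d, upWord w₂ k := by
    rw [Int.cast_sum]
    exact Finset.sum_congr rfl fun k _ =>
      (word_map (fun x : ℤ => (x : ZMod 2)) (by simp) _ _ _ k).symm
  have s₃ : ∑ k ∈ Finset.range d, upWord (fun τ => w₁ τ + w₂ τ) k =
      ∑ k ∈ Finset.range d, upWord w₁ k + ∑ k ∈ Finset.range d, upWord w₂ k := by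
    rw [← Finset.sum_add_distrib]
    exact Finset.sum_congr rfl fun k _ => word_add _ _ _ _ _ _ k
  have dich : ∀ x : ZMod 2, x = 0 ∨ x = 1 := by decide
  rcases dich (∑ k ∈ Finset.range d, upWord w₁ k) with e₁ | e₁ <;>
    rcases dich (∑ k ∈ Finset.range d, upWord w₂ k) with e₂ | e₂
  · rcases dich (gap d r w₁) with g₁ | g₁
    · exact suff w₁ n₁ e₁ c₁ g₁
    rcases dich (gap d r w₂) with g₂ | g₂
    · exact suff w₂ n₂ e₂ c₂ g₂
    -- Both parities vanish and both gaps are 1; the gap is additive, so the sum of the two weights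
    -- has gap 0.
    refine suff _ n₃ (by rw [s₃, e₁, e₂, add_zero]) c₃ ?_
    rw [gap_add, g₁, g₂, zmod_two_add_self]
  · refine suff w₁ n₁ e₁ c₁ ?_
    -- The complementary class is disjoint from `w₁`, whence `m = 0`, and it crosses the circle an
    -- odd number of times, which forces the gap of `w₁` to vanish.
    have h := gap_mul_eq_zero hd hd0 e₁ c₁ hχc (m := 0) (fun τ => by
      rcases h01 τ with h | h <;> simp [w₁, h])
    rwa [s₂, e₂, mul_one] at h
  · refine suff w₂ n₂ e₂ c₂ ?_
    have h := gap_mul_eq_zero hd hd0 e₂ c₂ hχ (m := 0) (fun τ => by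
      rcases h01 τ with h | h <;> simp [w₂, h])
    rwa [s₁, e₁, mul_one] at h
  · have e₃ : ∑ k ∈ Finset.range d, upWord (fun τ => w₁ τ + w₂ τ) k = 0 := by
      rw [s₃, e₁, e₂, zmod_two_add_self]
    refine suff _ n₃ e₃ c₃ ?_
    -- Here the weight is identically 1, whence `m = 1`, and `χ` crosses the circle an odd number of
    -- times.
    have h := gap_mul_eq_zero hd hd0 e₃ c₃ hχ (m := 1) (fun τ => by
      rcases h01 τ with h | h <;> simp [w₁, w₂, h])
    rwa [s₁, e₁, mul_one] at h

end ArcName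

noncomputable section

open Metric

/-! ### Coordinates of the vertices -/

/-- The horizontal distance of the `k`-th vertex of a circle from the centre. -/
def vx (d k : ℕ) : ℝ := Real.cos (Real.pi * (k + 1) / (d + 1)) / 4

/-- The height of the `k`-th vertex of an upper circle. -/
def vy (d k : ℕ) : ℝ := 5 / 4 - Real.sin (Real.pi * (k + 1) / (d + 1)) / 4

lemma vertexAngle_mem {d k : ℕ} (hk : k < d) :
    Real.pi * (k + 1) / (d + 1) ∈ Ioo 0 Real.pi := by
  have hpi := Real.pi_pos
  refine ⟨by positivity, ?_⟩
  rw [div_lt_iff₀ (by positivity)]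
  have : (k : ℝ) + 1 < d + 1 := by exact_mod_cast Nat.add_lt_add_right hk 1
  nlinarith

lemma vertexAngle_lt {d k l : ℕ} (hkl : k < l) :
    Real.pi * (k + 1) / (d + 1) < Real.pi * (l + 1) / (d + 1) := by
  have hpi := Real.pi_pos
  have : (k : ℝ) < l := by exact_mod_cast hkl
  gcongr

lemma vx_lt_vx {d k l : ℕ} (hkl : k < l) (hl : l < d) : vx d l < vx d k := by
  have h1 := vertexAngle_mem (hkl.trans hl)
  have h2 := vertexAngle_mem hl
  have := Real.strictAntiOn_cos ⟨h1.1.le, h1.2.le⟩ ⟨h2.1.le, h2.2.le⟩ (vertexAngle_lt (d := d) hkl)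
  unfold vx; linarith

lemma vertexAngle_reflect {d k : ℕ} (hk : k < d) :
    Real.pi * ((d - 1 - k : ℕ) + 1) / (d + 1) = Real.pi - Real.pi * (k + 1) / (d + 1) := by
  have : ((d - 1 - k : ℕ) : ℝ) = d - 1 - k := by
    rw [Nat.cast_sub (by omega), Nat.cast_sub (by omega)]; simp
  rw [this]; field_simp; ring

lemma vx_reflect {d k : ℕ} (hk : k < d) : vx d (d - 1 - k) = - vx d k := by
  unfold vx; rw [vertexAngle_reflect hk, Real.cos_pi_sub]; ring

lemma vy_reflect {d k : ℕ} (hk : k < d) : vy d (d - 1 - k) = vy d k := by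
  unfold vy; rw [vertexAngle_reflect hk, Real.sin_pi_sub]

lemma vx_pos {d k : ℕ} (hk : 2 * k + 1 < d) : 0 < vx d k := by
  have h := vx_lt_vx (d := d) (show k < d - 1 - k by omega) (by omega)
  rw [vx_reflect (by omega)] at h
  linarith

lemma vx_sq_add (d k : ℕ) : vx d k ^ 2 + (5 / 4 - vy d k) ^ 2 = 1 / 16 := by
  unfold vx vy
  linear_combination (Real.sin_sq_add_cos_sq (Real.pi * (k + 1) / (d + 1))) / 16

lemma vy_lt {d k : ℕ} (hk : k < d) : vy d k < 5 / 4 := by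
  have h := vertexAngle_mem hk
  have := Real.sin_pos_of_pos_of_lt_pi h.1 h.2
  unfold vy; linarith

lemma one_le_vy (d k : ℕ) : 1 ≤ vy d k := by
  have := Real.sin_le_one (Real.pi * (k + 1) / (d + 1))
  unfold vy; linarith

lemma abs_vx_lt {d k : ℕ} (hk : k < d) : |vx d k| < 1 / 4 := by
  rw [abs_lt]
  have h1 := vx_sq_add d k
  have h2 := vy_lt hk
  constructor <;> nlinarith

lemma centre_re (i : ℤ) : (centre i).re = i := by simp [centre]

lemma centre_im (i : ℤ) : (centre i).im = 5 / 4 := by simp [centre]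

lemma upperPt_eq (d : ℕ) (i : ℤ) (k : ℕ) (t : ℝ) :
    upperPt d i k t = ⟨i + Real.cos ((1 - t) * angle d k + t * angle d (k + 1)) / 4,
      5 / 4 + Real.sin ((1 - t) * angle d k + t * angle d (k + 1)) / 4⟩ := by
  unfold upperPt
  generalize (1 - t) * angle d k + t * angle d (k + 1) = θ
  rw [Complex.exp_mul_I, ← Complex.ofReal_cos, ← Complex.ofReal_sin,
    show (1 / 4 : ℂ) = ((1 / 4 : ℝ) : ℂ) by push_cast; rfl]
  apply Complex.ext
  · simp [centre_re, -one_div, -Complex.ofReal_div, -Complex.ofReal_cos, -Complex.ofReal_sin]; ring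
  · simp [centre_im, -one_div, -Complex.ofReal_div, -Complex.ofReal_cos, -Complex.ofReal_sin]; ring

lemma upperVx_eq {d k : ℕ} (hk : k < d) (i : ℤ) : upperVx d i k = ⟨i + vx d k, vy d k⟩ := by
  unfold upperVx
  rw [upperPt_eq]
  simp only [sub_zero, one_mul, zero_mul, add_zero, angle, if_pos hk, Real.cos_neg, Real.sin_neg,
    vx, vy]
  congr 1; ring

lemma lowerVx_eq {d k : ℕ} (hk : k < d) (i : ℤ) : lowerVx d i k = ⟨i + vx d k, - vy d k⟩ := by
  have h := upperVx_eq hk i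
  unfold upperVx at h
  unfold lowerVx lowerPt
  rw [h]; rfl

/-- A point on the circle of a column, in the coordinates relative to its centre. -/
lemma upperPt_circle (d : ℕ) (i : ℤ) (k : ℕ) (t : ℝ) :
    ((upperPt d i k t).re - i) ^ 2 + ((upperPt d i k t).im - 5 / 4) ^ 2 = 1 / 16 := by
  rw [upperPt_eq]
  linear_combination (Real.sin_sq_add_cos_sq ((1 - t) * angle d k + t * angle d (k + 1))) / 16

lemma mem_ball_centre {p : ℂ} {i : ℤ} :
    p ∈ ball (centre i) (1 / 4) ↔ (p.re - i) ^ 2 + (p.im - 5 / 4) ^ 2 < 1 / 16 := by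
  rw [mem_ball, Complex.dist_eq, Complex.norm_def, Real.sqrt_lt' (by norm_num),
    Complex.normSq_apply, Complex.sub_re, Complex.sub_im, centre_re, centre_im]
  norm_num [pow_two]

lemma mem_ball_conj_centre {p : ℂ} {i : ℤ} :
    p ∈ ball ((starRingEnd ℂ) (centre i)) (1 / 4) ↔
      (p.re - i) ^ 2 + (-p.im - 5 / 4) ^ 2 < 1 / 16 := by
  rw [mem_ball, Complex.dist_eq, Complex.norm_def, Real.sqrt_lt' (by norm_num),
    Complex.normSq_apply, Complex.sub_re, Complex.sub_im, Complex.conj_re, Complex.conj_im, centre_re, centre_im]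
  have : (-p.im - 5 / 4) ^ 2 = (p.im - -(5 / 4)) * (p.im - -(5 / 4)) := by ring
  rw [this]
  norm_num [pow_two]

/-- The open discs bounded by the circles in the cover. -/
def discs : Set ℂ :=
  ⋃ i : ℤ, ball (centre i) (1 / 4) ∪ ball ((starRingEnd ℂ) (centre i)) (1 / 4)

lemma mem_discs {p : ℂ} : p ∈ discs ↔ ∃ i : ℤ, (p.re - i) ^ 2 + (p.im - 5 / 4) ^ 2 < 1 / 16 ∨
    (p.re - i) ^ 2 + (-p.im - 5 / 4) ^ 2 < 1 / 16 := by
  simp only [discs, mem_iUnion, mem_union, mem_ball_centre, mem_ball_conj_centre]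

lemma conj_mem_discs {p : ℂ} : (starRingEnd ℂ) p ∈ discs ↔ p ∈ discs := by
  simp only [mem_discs, Complex.conj_re, Complex.conj_im, neg_neg]
  exact exists_congr fun _ => or_comm

lemma notMem_discs_of_abs_im_le {p : ℂ} (h : |p.im| ≤ 1) : p ∉ discs := by
  rw [mem_discs]
  rw [abs_le] at h
  rintro ⟨i, hi | hi⟩ <;> nlinarith [sq_nonneg (p.re - i)]

/-- Distinct integers are at distance at least 1. This disposes of the discs in the other columns.
-/
lemma half_le_of_abs_sub_le {x u : ℝ} {i m : ℤ} (h : |x - i| ≤ u) (hu : u ≤ 1 / 2) :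
    u ≤ |x - m| ∨ m = i := by
  by_cases hm : m = i
  · exact .inr hm
  left
  have h1 : (1 : ℝ) ≤ |(m : ℝ) - i| := by
    have := Int.one_le_abs (sub_ne_zero.2 hm)
    exact_mod_cast this
  have h2 : |(m : ℝ) - i| ≤ |x - m| + |x - i| := by
    rw [abs_sub_comm x m]
    exact abs_sub_le _ _ _
  linarith

lemma upperPt_notMem_discs (d : ℕ) (i : ℤ) (k : ℕ) (t : ℝ) : upperPt d i k t ∉ discs := by
  have h := upperPt_circle d i k t
  rw [mem_discs]
  set p := upperPt d i k t
  have hx : |p.re - i| ≤ 1 / 4 := abs_le.2 (by constructor <;> nlinarith [sq_nonneg (p.im - 5 / 4)])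
  have hy : 1 ≤ p.im := by nlinarith [sq_nonneg (p.re - i)]
  rintro ⟨m, hm | hm⟩
  · rcases half_le_of_abs_sub_le (m := m) hx (by norm_num) with h1 | rfl
    · have := sq_le_sq' (by linarith [abs_nonneg (p.re - m)]) h1
      rw [sq_abs] at this
      nlinarith [sq_nonneg (p.im - 5 / 4)]
    · linarith
  · nlinarith [sq_nonneg (p.re - m)]

/-! ### Strands

A strand is the graph over the vertical axis of an arc from an upper to a lower circle, prolonged
inside the two discs to the vertical lines through their centres. -/

/-- It is `1` below height `5/4` and `0` above height `11/8`. -/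
def fade (y : ℝ) : ℝ := max 0 (min 1 (11 - 8 * y))

/-- It is `1` above height `1` and `0` below height `-1`. -/
def mix (y : ℝ) : ℝ := max 0 (min 1 ((1 + y) / 2))

/-- The strand from the upper circle of column `m` to the lower circle of column `m'`; the ends of
the arc have the abscissas `u` and `u'` relative to the centres. -/
def strand (m m' : ℤ) (u u' y : ℝ) : ℝ :=
  (m + u * fade y) * mix y + (m' + u' * fade (-y)) * (1 - mix y)

lemma continuous_strand (m m' : ℤ) (u u' : ℝ) : Continuous (strand m m' u u') := by
  unfold strand fade mix; fun_prop

lemma fade_of_le {y : ℝ} (hy : y ≤ 5 / 4) : fade y = 1 := by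
  unfold fade; rw [min_eq_left (by linarith), max_eq_right (by norm_num)]

lemma fade_of_ge {y : ℝ} (hy : 11 / 8 ≤ y) : fade y = 0 := by
  unfold fade; rw [min_eq_right (by linarith), max_eq_left (by linarith)]

lemma fade_of_mem {y : ℝ} (h1 : 5 / 4 ≤ y) (h2 : y ≤ 11 / 8) : fade y = 11 - 8 * y := by
  unfold fade; rw [min_eq_right (by linarith), max_eq_right (by linarith)]

lemma mix_of_ge {y : ℝ} (hy : 1 ≤ y) : mix y = 1 := by
  unfold mix; rw [min_eq_left (by linarith), max_eq_right (by norm_num)]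

lemma mix_of_mem {y : ℝ} (h1 : -1 ≤ y) (h2 : y ≤ 1) : mix y = (1 + y) / 2 := by
  unfold mix; rw [min_eq_right (by linarith), max_eq_right (by linarith)]

lemma mix_of_le {y : ℝ} (hy : y ≤ -1) : mix y = 0 := by
  unfold mix; rw [min_eq_right (by linarith), max_eq_left (by linarith)]

lemma mix_neg (y : ℝ) : mix (-y) = 1 - mix y := by
  rcases le_total y (-1) with h | h
  · rw [mix_of_le h, mix_of_ge (by linarith)]; norm_num
  rcases le_total y 1 with h' | h'
  · rw [mix_of_mem h h', mix_of_mem (by linarith) (by linarith)]; ring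
  · rw [mix_of_ge h', mix_of_le (by linarith)]; norm_num

lemma strand_neg (m m' : ℤ) (u u' y : ℝ) : strand m m' u u' (-y) = strand m' m u' u y := by
  unfold strand; rw [mix_neg, neg_neg]; ring

lemma strand_add (m m' l : ℤ) (u u' y : ℝ) :
    strand (m + l) (m' + l) u u' y = strand m m' u u' y + l := by
  unfold strand; push_cast; ring

lemma strand_of_one_le (m m' : ℤ) (u u' : ℝ) {y : ℝ} (hy : 1 ≤ y) :
    strand m m' u u' y = m + u * fade y := by
  unfold strand; rw [mix_of_ge hy]; ring

lemma strand_of_mem_upper (m m' : ℤ) (u u' : ℝ) {y : ℝ} (hy : 1 ≤ y) (hy' : y ≤ 5 / 4) :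
    strand m m' u u' y = m + u := by
  rw [strand_of_one_le _ _ _ _ hy, fade_of_le hy', mul_one]

lemma strand_of_ge (m m' : ℤ) (u u' : ℝ) {y : ℝ} (hy : 11 / 8 ≤ y) :
    strand m m' u u' y = m := by
  rw [strand_of_one_le _ _ _ _ (by linarith), fade_of_ge hy]; ring

lemma strand_of_mem_middle (m m' : ℤ) (u u' : ℝ) {y : ℝ} (hy : -1 ≤ y) (hy' : y ≤ 1) :
    strand m m' u u' y = (m + u) * ((1 + y) / 2) + (m' + u') * ((1 - y) / 2) := by
  unfold strand
  rw [mix_of_mem hy hy', fade_of_le (by linarith), fade_of_le (by linarith)]; ring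

/-- Above the centre the prolonged strand stays in the disc until it has reached the centre line. -/
lemma fade_sq_lt {u y : ℝ} (hu : |u| < 1 / 4) (hy : 5 / 4 ≤ y) (hy' : y ≤ 11 / 8) :
    (u * fade y) ^ 2 + (y - 5 / 4) ^ 2 < 1 / 16 := by
  rw [fade_of_mem hy hy']
  have h2 : u ^ 2 < 1 / 16 := by
    have := sq_lt_sq' (by linarith [abs_nonneg u]) hu
    rw [sq_abs] at this; linarith
  obtain ⟨e, rfl⟩ : ∃ e, y = 5 / 4 + e := ⟨y - 5 / 4, by ring⟩
  have he : 0 ≤ e := by linarith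
  have he' : e ≤ 1 / 8 := by linarith
  have e1 : 11 - 8 * (5 / 4 + e) = 1 - 8 * e := by ring
  rw [e1, mul_pow, add_sub_cancel_left]
  rcases he.eq_or_lt with rfl | he0
  · simpa using h2
  · have : u ^ 2 * (1 - 8 * e) ^ 2 ≤ 1 / 16 * (1 - 8 * e) ^ 2 :=
      mul_le_mul_of_nonneg_right h2.le (sq_nonneg _)
    nlinarith

lemma mem_segment_vertical {x y₁ y₂ : ℝ} {p : ℂ} :
    p ∈ segment ℝ (⟨x, y₁⟩ : ℂ) ⟨x, y₂⟩ ↔ p.re = x ∧ p.im ∈ uIcc y₁ y₂ := by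
  rw [← segment_eq_uIcc]
  constructor
  · rintro ⟨s, t, hs, ht, hst, rfl⟩
    refine ⟨by simp; rw [← add_mul, hst, one_mul], s, t, hs, ht, hst, by simp⟩
  · rintro ⟨hx, s, t, hs, ht, hst, h⟩
    refine ⟨s, t, hs, ht, hst, Complex.ext ?_ ?_⟩
    · simp; rw [← add_mul, hst, one_mul, hx]
    · simpa using h

lemma mem_segment_horizontal {y x₁ x₂ : ℝ} {p : ℂ} :
    p ∈ segment ℝ (⟨x₁, y⟩ : ℂ) ⟨x₂, y⟩ ↔ p.im = y ∧ p.re ∈ uIcc x₁ x₂ := by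
  rw [← segment_eq_uIcc]
  constructor
  · rintro ⟨s, t, hs, ht, hst, rfl⟩
    refine ⟨by simp; rw [← add_mul, hst, one_mul], s, t, hs, ht, hst, by simp⟩
  · rintro ⟨hx, s, t, hs, ht, hst, h⟩
    refine ⟨s, t, hs, ht, hst, Complex.ext ?_ ?_⟩
    · simpa using h
    · simp; rw [← add_mul, hst, one_mul, hx]

lemma mem_segment_middle {x x' : ℝ} {p : ℂ} :
    p ∈ segment ℝ (⟨x, 1⟩ : ℂ) ⟨x', -1⟩ ↔
      -1 ≤ p.im ∧ p.im ≤ 1 ∧ p.re = x * ((1 + p.im) / 2) + x' * ((1 - p.im) / 2) := by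
  constructor
  · rintro ⟨s, t, hs, ht, hst, rfl⟩
    obtain rfl : t = 1 - s := by linarith
    simp only [Complex.add_re, Complex.add_im, Complex.real_smul, Complex.re_ofReal_mul,
      Complex.im_ofReal_mul]
    refine ⟨by linarith, by linarith, by ring⟩
  · rintro ⟨h1, h2, h⟩
    refine ⟨(1 + p.im) / 2, (1 - p.im) / 2, by linarith, by linarith, by ring, Complex.ext ?_ ?_⟩
    · simp [h]; ring
    · simp; ring

/-- Outside of the discs, the strand is the arc. -/
lemma mem_descent_iff {d q q' : ℕ} (hq : q < d) (hq' : q' < d) (m m' : ℤ) {p : ℂ} :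
    p ∈ descent (upperVx d m q) (lowerVx d m' q') ↔
      p.re = strand m m' (vx d q) (vx d q') p.im ∧ p.im ≤ vy d q ∧ -vy d q' ≤ p.im := by
  have hy := vy_lt hq
  have hy' := vy_lt hq'
  have o := one_le_vy d q
  have o' := one_le_vy d q'
  rw [descent, upperVx_eq hq, lowerVx_eq hq', mem_union, mem_union, mem_segment_vertical,
    mem_segment_vertical, mem_segment_middle, uIcc_of_ge o, uIcc_of_ge (by linarith), mem_Icc,
    mem_Icc]
  constructor
  · rintro ((⟨h1, h2, h3⟩ | ⟨h1, h2, h3⟩) | ⟨h1, h2, h3⟩)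
    · exact ⟨by rw [strand_of_mem_upper _ _ _ _ h2 (by linarith), h1], h3, by linarith⟩
    · exact ⟨by rw [strand_of_mem_middle _ _ _ _ h1 h2, h3], by linarith, by linarith⟩
    · refine ⟨?_, by linarith, by linarith⟩
      rw [← neg_neg p.im, strand_neg, strand_of_mem_upper _ _ _ _ (by linarith) (by linarith), h1]
  · rintro ⟨h1, h2, h3⟩
    rcases le_total 1 p.im with h4 | h4
    · rw [strand_of_mem_upper _ _ _ _ h4 (by linarith)] at h1
      exact .inl (.inl ⟨h1, h4, h2⟩)
    rcases le_total (-1) p.im with h5 | h5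
    · rw [strand_of_mem_middle _ _ _ _ h5 h4] at h1
      exact .inl (.inr ⟨h5, h4, h1⟩)
    · rw [← neg_neg p.im, strand_neg, strand_of_mem_upper _ _ _ _ (by linarith) (by linarith)] at h1
      exact .inr ⟨h1, h3, h5⟩

/-- The part of a strand that was added to the arc is hidden in the disc: it is vertical up to the
height of the centre and then moves to the centre line while it is still inside. -/
lemma strand_mem_discs_of_lt {d q : ℕ} (hq : q < d) {m m' : ℤ} {u' : ℝ} {p : ℂ}
    (hp : p.re = strand m m' (vx d q) u' p.im) (h : vy d q < p.im) (h' : p.im ≤ 11 / 8) :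
    p ∈ discs := by
  have o := one_le_vy d q
  rw [mem_discs]
  refine ⟨m, .inl ?_⟩
  rw [hp, strand_of_one_le _ _ _ _ (by linarith), add_sub_cancel_left]
  rcases le_total p.im (5 / 4) with h1 | h1
  · rw [fade_of_le h1, mul_one]
    nlinarith [vx_sq_add d q]
  · exact fade_sq_lt (abs_vx_lt hq) h1 h'

lemma mem_descent_of_strand {d q q' : ℕ} (hq : q < d) (hq' : q' < d) {m m' : ℤ} {p : ℂ}
    (hp : p.re = strand m m' (vx d q) (vx d q') p.im) (h : |p.im| ≤ 11 / 8) (hd : p ∉ discs) :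
    p ∈ descent (upperVx d m q) (lowerVx d m' q') := by
  rw [abs_le] at h
  rw [mem_descent_iff hq hq']
  refine ⟨hp, ?_, ?_⟩
  · by_contra h1
    exact hd (strand_mem_discs_of_lt hq hp (not_le.1 h1) h.2)
  · by_contra h1
    rw [← conj_mem_discs] at hd
    refine hd (strand_mem_discs_of_lt (m := m') (m' := m) (u' := vx d q) hq' ?_ ?_ ?_)
    · rw [Complex.conj_re, Complex.conj_im, strand_neg, hp]
    · rw [Complex.conj_im]; linarith
    · rw [Complex.conj_im]; linarith

lemma vertical_notMem_discs {d q : ℕ} (hq : q < d) {m : ℤ} {p : ℂ} (hx : p.re = m + vx d q)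
    (h1 : 1 ≤ p.im) (h2 : p.im ≤ vy d q) : p ∉ discs := by
  have hv := abs_vx_lt hq
  have hy := vy_lt hq
  rw [mem_discs]
  rintro ⟨i, hi | hi⟩
  · have hi2 : |vx d q| ≤ |p.re - i| := by
      rcases half_le_of_abs_sub_le (x := p.re) (u := |vx d q|) (i := m) (m := i) (by
        rw [hx, add_sub_cancel_left]) (by linarith) with h | rfl
      · exact h
      · rw [hx, add_sub_cancel_left]
    have := sq_le_sq.2 hi2
    nlinarith [vx_sq_add d q]
  · nlinarith [sq_nonneg (p.re - i)]

lemma descent_notMem_discs {d q q' : ℕ} (hq : q < d) (hq' : q' < d) {m m' : ℤ} {p : ℂ}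
    (hp : p ∈ descent (upperVx d m q) (lowerVx d m' q')) : p ∉ discs := by
  rw [mem_descent_iff hq hq'] at hp
  obtain ⟨h1, h2, h3⟩ := hp
  have hy := vy_lt hq
  have hy' := vy_lt hq'
  rcases le_total 1 p.im with h4 | h4
  · rw [strand_of_mem_upper _ _ _ _ h4 (by linarith)] at h1
    exact vertical_notMem_discs hq h1 h4 h2
  rcases le_total (-1) p.im with h5 | h5
  · exact notMem_discs_of_abs_im_le (abs_le.2 ⟨h5, h4⟩)
  · rw [← neg_neg p.im, strand_neg, strand_of_mem_upper _ _ _ _ (by linarith) (by linarith)] at h1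
    rw [← conj_mem_discs]
    exact vertical_notMem_discs hq' (m := m') (by simpa using h1) (by simp; linarith)
      (by simp; linarith)

/-! ### Horizontal arcs -/

lemma mem_horizontal_iff {d j : ℕ} (h0 : 2 * j + 1 < d) (i : ℤ) {p : ℂ} :
    p ∈ segment ℝ (upperVx d i j) (upperVx d (i + 1) (d - 1 - j)) ↔
      p.im = vy d j ∧ i + vx d j ≤ p.re ∧ p.re ≤ i + 1 - vx d j := by
  have hj : j < d := by omega
  have hv := abs_lt.1 (abs_vx_lt hj)
  rw [upperVx_eq hj, upperVx_eq (by omega), vx_reflect hj, vy_reflect hj, mem_segment_horizontal,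
    uIcc_of_le (by push_cast; linarith), mem_Icc]
  push_cast
  rfl

lemma mem_lower_horizontal_iff {d j : ℕ} (h0 : 2 * j + 1 < d) (i : ℤ) {p : ℂ} :
    p ∈ segment ℝ (lowerVx d i j) (lowerVx d (i + 1) (d - 1 - j)) ↔
      p.im = -vy d j ∧ i + vx d j ≤ p.re ∧ p.re ≤ i + 1 - vx d j := by
  have hj : j < d := by omega
  have hv := abs_lt.1 (abs_vx_lt hj)
  rw [lowerVx_eq hj, lowerVx_eq (by omega), vx_reflect hj, vy_reflect hj, mem_segment_horizontal,
    uIcc_of_le (by push_cast; linarith), mem_Icc]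
  push_cast
  rfl

lemma horizontal_notMem_discs {d j : ℕ} {i : ℤ} {p : ℂ} (h0 : 2 * j + 1 < d)
    (hp : p.im = vy d j ∧ i + vx d j ≤ p.re ∧ p.re ≤ i + 1 - vx d j) : p ∉ discs := by
  obtain ⟨h1, h2, h3⟩ := hp
  have hpos := vx_pos h0
  have hsq := vx_sq_add d j
  have o := one_le_vy d j
  rw [mem_discs]
  rintro ⟨m, hm | hm⟩
  · have : vx d j ^ 2 ≤ (p.re - m) ^ 2 := by
      rcases le_or_gt m i with h | h
      · have : (m : ℝ) ≤ i := by exact_mod_cast h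
        nlinarith
      · have : (i : ℝ) + 1 ≤ m := by exact_mod_cast h
        nlinarith
    rw [h1] at hm
    linarith [show (5 / 4 - vy d j) ^ 2 = (vy d j - 5 / 4) ^ 2 by ring]
  · nlinarith [sq_nonneg (p.re - m)]


open Filter

/-- The line at this height meets each disc in the chord between the vertices `j` and `d - 1 - j`;
what is left are the horizontal arcs. -/
lemma horizontal_of_notMem_discs {d j : ℕ} {p : ℂ} (h0 : 2 * j + 1 < d) (hp : p.im = vy d j)
    (hd : p ∉ discs) : ∃ i : ℤ, i + vx d j ≤ p.re ∧ p.re ≤ i + 1 - vx d j := by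
  have hpos := vx_pos h0
  have hsq := vx_sq_add d j
  have hle := Int.floor_le p.re
  have hlt := Int.lt_floor_add_one p.re
  have hn : ∀ m : ℤ, vx d j ^ 2 ≤ (p.re - m) ^ 2 := by
    intro m
    by_contra h
    refine hd (mem_discs.2 ⟨m, .inl ?_⟩)
    rw [hp]
    linarith [show (5 / 4 - vy d j) ^ 2 = (vy d j - 5 / 4) ^ 2 by ring]
  refine ⟨⌊p.re⌋, ?_, ?_⟩
  · have := abs_le_of_sq_le_sq' (hn ⌊p.re⌋) (by linarith)
    linarith
  · have h := hn (⌊p.re⌋ + 1)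
    rw [← neg_sq (p.re - _)] at h
    push_cast at h
    have := abs_le_of_sq_le_sq' h (by linarith)
    linarith

/-! ### The function that jumps across the arcs -/

section field

variable {a b c : ℕ}

/-- A function on the plane that jumps by `1` across the arcs named `τ`. -/
def crossing (d : ℕ) (p : ℂ) : ArcName a b c → ℤ
  | .upper j => if vy d j < p.im then 1 else 0
  | .lower j => if p.im < -vy d j then 1 else 0
  | .oblique k => ⌊p.re - strand 0 1 (vx d (a + k)) (vx d (a + c + k)) p.im⌋
  | .vertical k => ⌊p.re - strand 0 0 (vx d (a + b + k)) (vx d (a + k)) p.im⌋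

/-- The point `p` lies on one of the prolonged arcs named `τ`. -/
def OnLine (d : ℕ) (p : ℂ) : ArcName a b c → Prop
  | .upper j => p.im = vy d j
  | .lower j => p.im = -vy d j
  | .oblique k => |p.im| ≤ 11 / 8 ∧
      ∃ m : ℤ, p.re = strand m (m + 1) (vx d (a + k)) (vx d (a + c + k)) p.im
  | .vertical k => |p.im| ≤ 11 / 8 ∧
      ∃ m : ℤ, p.re = strand m m (vx d (a + b + k)) (vx d (a + k)) p.im

/-- The function modulo `2` that jumps by `w` across the arcs. -/
def field (d : ℕ) (w : ArcName a b c → ZMod 2) (p : ℂ) : ZMod 2 :=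
  ∑ k, w (.oblique k) * crossing d p (.oblique k : ArcName a b c) +
    ∑ k, w (.vertical k) * crossing d p (.vertical k : ArcName a b c) +
    ∑ j, w (.upper j) * crossing d p (.upper j : ArcName a b c) +
    ∑ j, w (.lower j) * crossing d p (.lower j : ArcName a b c)

lemma floor_sub_eventuallyEq {X : Type*} [TopologicalSpace X] {f : X → ℝ} {x : X}
    (hf : ContinuousAt f x) (h : ∀ m : ℤ, f x ≠ m) :
    ∀ᶠ y in 𝓝 x, (∀ m : ℤ, f y ≠ m) ∧ ⌊f y⌋ = ⌊f x⌋ := by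
  have h1 : f x ∈ Ioo (⌊f x⌋ : ℝ) (⌊f x⌋ + 1) :=
    ⟨lt_of_le_of_ne (Int.floor_le _) (h _).symm, Int.lt_floor_add_one _⟩
  filter_upwards [hf.eventually (isOpen_Ioo.mem_nhds h1)] with y hy
  refine ⟨fun m hm => ?_, Int.floor_eq_iff.2 ⟨hy.1.le, hy.2⟩⟩
  rw [hm] at hy
  have h2 : ⌊f x⌋ < m := by exact_mod_cast hy.1
  have h3 : m < ⌊f x⌋ + 1 := by exact_mod_cast hy.2
  omega

/-- The translates of a strand are the level sets, at the integers, of one continuous function, and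
the floor of that function is locally constant off them. -/
lemma strand_eventually (m m' : ℤ) (u u' : ℝ) {p : ℂ}
    (h : ∀ l : ℤ, p.re ≠ strand (m + l) (m' + l) u u' p.im) :
    ∀ᶠ q in 𝓝 p, (∀ l : ℤ, q.re ≠ strand (m + l) (m' + l) u u' q.im) ∧
      ⌊q.re - strand m m' u u' q.im⌋ = ⌊p.re - strand m m' u u' p.im⌋ := by
  have hf : Continuous fun q : ℂ => q.re - strand m m' u u' q.im :=
    Complex.continuous_re.sub ((continuous_strand m m' u u').comp Complex.continuous_im)
  have key : ∀ q : ℂ, (∀ l : ℤ, q.re ≠ strand (m + l) (m' + l) u u' q.im) ↔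
      ∀ l : ℤ, q.re - strand m m' u u' q.im ≠ l := fun q => by
    simp only [strand_add, ne_eq, sub_eq_iff_eq_add']
  simp only [key] at h ⊢
  exact floor_sub_eventuallyEq hf.continuousAt h

lemma crossing_eventually {d : ℕ} {p : ℂ} {τ : ArcName a b c} (hp : ¬ OnLine d p τ)
    (him : |p.im| ≤ 11 / 8) :
    ∀ᶠ q in 𝓝 p, ¬ OnLine d q τ ∧ crossing d q τ = crossing d p τ := by
  cases τ with
  | upper j =>
    rcases lt_or_gt_of_ne hp with h | h
    · filter_upwards [Complex.continuous_im.continuousAt.eventually (gt_mem_nhds h)] with q hq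
      simp [OnLine, crossing, hq.ne, hq.not_gt, h.not_gt]
    · filter_upwards [Complex.continuous_im.continuousAt.eventually (lt_mem_nhds h)] with q hq
      simp [OnLine, crossing, hq.ne', hq, h]
  | lower j =>
    rcases lt_or_gt_of_ne hp with h | h
    · filter_upwards [Complex.continuous_im.continuousAt.eventually (gt_mem_nhds h)] with q hq
      simp [OnLine, crossing, hq.ne, hq, h]
    · filter_upwards [Complex.continuous_im.continuousAt.eventually (lt_mem_nhds h)] with q hq
      simp [OnLine, crossing, hq.ne', hq.not_gt, h.not_gt]
  | oblique k =>
    simp only [OnLine, not_and, not_exists] at hp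
    have h := strand_eventually 0 1 (vx d (a + k)) (vx d (a + c + k)) (p := p) (fun l => by
      rw [zero_add, add_comm]; exact hp him l)
    filter_upwards [h] with q hq
    refine ⟨?_, hq.2⟩
    rintro ⟨-, m, hm⟩
    refine hq.1 m ?_
    rwa [zero_add, add_comm]
  | vertical k =>
    simp only [OnLine, not_and, not_exists] at hp
    have h := strand_eventually 0 0 (vx d (a + b + k)) (vx d (a + k)) (p := p) (fun l => by
      rw [zero_add]; exact hp him l)
    filter_upwards [h] with q hq
    refine ⟨?_, hq.2⟩
    rintro ⟨-, m, hm⟩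
    refine hq.1 m ?_
    rwa [zero_add]

variable {d : ℕ} {α δ : Fin a → ZMod 2} {β : Fin b → ZMod 2} {γ : Fin c → ZMod 2}

lemma sum_second_add_sum_third (hd : d = 2 * a + b + c)
    (h0 : ∑ q ∈ Finset.range d, word α β γ q = 0) : ∑ k, β k + ∑ k, γ k = 0 := by
  rw [sum_word hd, two_mul, ArcName.zmod_two_add_self, zero_add] at h0
  exact h0

/-- The value of the field at points above the centres of the upper circles. -/
lemma sum_crossing_top (hd : d = 2 * a + b + c) (h0 : ∑ q ∈ Finset.range d, word α β γ q = 0)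
    (mβ mβ' mγ mγ' : ℤ) (uβ' : Fin b → ℝ) (uγ' : Fin c → ℝ) {p : ℂ} (hp : 5 / 4 < p.im) (z : ℤ)
    (hz : ∀ q < d, ∀ (m m' : ℤ) (u' : ℝ), ⌊p.re - strand m m' (vx d q) u' p.im⌋ = z - m) :
    ∑ k, β k * (⌊p.re - strand mβ mβ' (vx d (a + k)) (uβ' k) p.im⌋ : ZMod 2) +
      ∑ k, γ k * (⌊p.re - strand mγ mγ' (vx d (a + b + k)) (uγ' k) p.im⌋ : ZMod 2) +
      ∑ j, α j * ((if vy d j < p.im then 1 else 0 : ℤ) : ZMod 2) +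
      ∑ j, δ j * ((if p.im < -vy d j then 1 else 0 : ℤ) : ZMod 2) =
    ∑ j, α j + mβ * ∑ k, β k + mγ * ∑ k, γ k := by
  have hα : ∀ j : Fin a, vy d j < p.im := fun j => (vy_lt (by omega)).trans hp
  have hδ : ∀ j : Fin a, ¬ p.im < - vy d j := fun j => by linarith [one_le_vy d j]
  have hβ : ∀ k : Fin b, a + (k : ℕ) < d := fun k => by omega
  have hγ : ∀ k : Fin c, a + b + (k : ℕ) < d := fun k => by omega
  simp only [hα, hδ, hz _ (hβ _), hz _ (hγ _), if_true, if_false, ← Finset.sum_mul]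
  push_cast
  -- The common part `z` of the floors is multiplied by the total weight of the descending arcs,
  -- which is zero; signs are irrelevant modulo 2.
  linear_combination (z : ZMod 2) * sum_second_add_sum_third hd h0 -
    ArcName.zmod_two_add_self (mβ * ∑ k, β k) - ArcName.zmod_two_add_self (mγ * ∑ k, γ k)

lemma floor_sub_strand {i m m' : ℤ} {u u' : ℝ} {p : ℂ} (hp : |p.re - i| ≤ 1 / 4) (hu : |u| < 1 / 4)
    (h1 : 1 ≤ p.im) (h2 : p.im ≤ 5 / 4) :
    ⌊p.re - strand m m' u u' p.im⌋ = i - m - if p.re - i < u then 1 else 0 := by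
  rw [strand_of_mem_upper _ _ _ _ h1 h2, Int.floor_eq_iff]
  rw [abs_le] at hp
  rw [abs_lt] at hu
  split_ifs with h <;> push_cast <;> constructor <;> linarith

/-- The value of the field on the edges of an upper circle below the centre. -/
lemma sum_crossing_circle (hd : d = 2 * a + b + c) (h0 : ∑ q ∈ Finset.range d, word α β γ q = 0)
    (mβ mβ' mγ mγ' : ℤ) (uβ' : Fin b → ℝ) (uγ' : Fin c → ℝ) {p : ℂ} {i : ℤ}
    (hp : (p.re - i) ^ 2 + (p.im - 5 / 4) ^ 2 = 1 / 16) (him : p.im ≤ 5 / 4) {K : ℕ} (hK : K ≤ d)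
    (hlt : ∀ q < K, p.re - i < vx d q) (hge : ∀ q < d, K ≤ q → vx d q < p.re - i) :
    ∑ k, β k * (⌊p.re - strand mβ mβ' (vx d (a + k)) (uβ' k) p.im⌋ : ZMod 2) +
      ∑ k, γ k * (⌊p.re - strand mγ mγ' (vx d (a + b + k)) (uγ' k) p.im⌋ : ZMod 2) +
      ∑ j, α j * ((if vy d j < p.im then 1 else 0 : ℤ) : ZMod 2) +
      ∑ j, δ j * ((if p.im < -vy d j then 1 else 0 : ℤ) : ZMod 2) =
    ∑ j, α j + mβ * ∑ k, β k + mγ * ∑ k, γ k + ∑ q ∈ Finset.range K, word α β γ q := by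
  have hx : |p.re - i| ≤ 1 / 4 := abs_le.2 (by constructor <;> nlinarith [sq_nonneg (p.im - 5 / 4)])
  have hy : 1 ≤ p.im := by nlinarith [sq_nonneg (p.re - i)]
  have hδ : ∀ j : Fin a, ¬ p.im < - vy d j := fun j => by linarith [one_le_vy d j]
  have hβ : ∀ k : Fin b, a + (k : ℕ) < d := fun k => by omega
  have hγ : ∀ k : Fin c, a + b + (k : ℕ) < d := fun k => by omega
  have hiff : ∀ q < d, p.re - i < vx d q ↔ q < K := fun q hq => by
    refine ⟨fun h => ?_, hlt q⟩
    by_contra h'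
    exact absurd (hge q hq (not_lt.1 h')) h.not_gt
  -- The vertices `j` and `d - 1 - j` have the same height. The point is above it exactly when its
  -- abscissa is not between theirs, that is, when both or neither belong to the `K` vertices on its
  -- right.
  have hα : ∀ j : Fin a, ((if vy d j < p.im then 1 else 0 : ℤ) : ZMod 2) =
      1 + ((if (j : ℕ) < K then 1 else 0) + if d - 1 - (j : ℕ) < K then 1 else 0) := by
    intro j
    have hj := j.2
    have hsq := vx_sq_add d j
    have hv := vy_lt (show (j : ℕ) < d by omega)
    have key : vy d j < p.im ↔ vx d j ^ 2 < (p.re - i) ^ 2 := by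
      constructor <;> intro h <;> nlinarith
    by_cases hw : 2 * (j : ℕ) + 1 < d
    · have hpos := vx_pos hw
      have r := vx_reflect (show (j : ℕ) < d by omega)
      rcases lt_or_ge (d - 1 - (j : ℕ)) K with h1 | h1
      · have h2 : (j : ℕ) < K := by omega
        have h3 := hlt _ h1
        rw [r] at h3
        have : vy d j < p.im := key.2 (by nlinarith)
        rw [if_pos this, if_pos h1, if_pos h2]; decide
      · have h3 := hge _ (by omega) h1
        rw [r] at h3
        rcases lt_or_ge (j : ℕ) K with h2 | h2
        · have h4 := hlt _ h2
          have : ¬ vy d j < p.im := fun h => by have := key.1 h; nlinarith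
          rw [if_neg this, if_neg h1.not_gt, if_pos h2]; decide
        · have h4 := hge _ (by omega) h2
          have : vy d j < p.im := key.2 (by nlinarith)
          rw [if_pos this, if_neg h1.not_gt, if_neg h2.not_gt]; decide
    · omega
  rw [sum_word_lt hd hK]
  simp only [hα, hδ, floor_sub_strand hx (abs_vx_lt (hβ _)) hy him,
    floor_sub_strand hx (abs_vx_lt (hγ _)) hy him, hiff _ (hβ _), hiff _ (hγ _), if_false]
  push_cast
  simp only [mul_sub, mul_add, Finset.sum_sub_distrib, Finset.sum_add_distrib, ← Finset.sum_mul]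
  linear_combination (i : ZMod 2) * sum_second_add_sum_third hd h0 -
    ArcName.zmod_two_add_self (mβ * ∑ k, β k) - ArcName.zmod_two_add_self (mγ * ∑ k, γ k) -
    ArcName.zmod_two_add_self (∑ k : Fin b, β k * (if a + (k : ℕ) < K then 1 else 0)) -
    ArcName.zmod_two_add_self (∑ k : Fin c, γ k * (if a + b + (k : ℕ) < K then 1 else 0))

/-- The position of the inner points of the edges of an upper circle. -/
lemma upperPt_edge {k : ℕ} (hk : k < d) {t : ℝ} (ht : t ∈ Ioo (0 : ℝ) 1) (i : ℤ) :
    (5 / 4 < (upperPt d i k t).im ∧ k + 1 = d) ∨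
    (upperPt d i k t).im ≤ 5 / 4 ∧ ∃ K ≤ d, (K = k + 1 ∨ K = 0 ∧ k + 1 = d) ∧
      (∀ q < K, (upperPt d i k t).re - i < vx d q) ∧
      ∀ q < d, K ≤ q → vx d q < (upperPt d i k t).re - i := by
  obtain ⟨ht0, ht1⟩ := ht
  have hpi := Real.pi_pos
  have hA : ∀ q < d, Real.pi * (q + 1) / (d + 1) ∈ Ioo 0 Real.pi := fun q hq => vertexAngle_mem hq
  have hmono : ∀ q l : ℕ, q ≤ l → Real.pi * (q + 1) / (d + 1) ≤ Real.pi * (l + 1) / (d + 1) := by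
    intro q l h
    rcases h.eq_or_lt with rfl | h
    · exact le_rfl
    · exact (vertexAngle_lt h).le
  have hcos : ∀ {x y : ℝ}, 0 ≤ x → x < y → y ≤ Real.pi → Real.cos y < Real.cos x :=
    fun h1 h2 h3 => Real.strictAntiOn_cos ⟨h1, (h2.le.trans h3)⟩ ⟨h1.trans h2.le, h3⟩ h2
  rw [upperPt_eq]
  simp only [add_sub_cancel_left]
  obtain ⟨φ, hφ⟩ : ∃ φ, (1 - t) * angle d k + t * angle d (k + 1) = -φ := ⟨_, (neg_neg _).symm⟩
  rw [hφ, Real.cos_neg, Real.sin_neg]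
  by_cases hkd : k + 1 < d
  · simp only [angle, if_pos hk, if_pos hkd] at hφ
    have hlt := vertexAngle_lt (d := d) (Nat.lt_succ_self k)
    simp only [Nat.succ_eq_add_one] at hlt
    have h1 : Real.pi * (k + 1) / (d + 1) < φ := by nlinarith
    have h2 : φ < Real.pi * ((k + 1 : ℕ) + 1) / (d + 1) := by nlinarith
    have h3 := hA k hk
    have h4 := hA (k + 1) hkd
    right
    have := Real.sin_pos_of_pos_of_lt_pi (h3.1.trans h1) (h2.trans h4.2)
    refine ⟨by linarith, k + 1, hkd.le, .inl rfl, fun q hq => ?_, fun q hq hq' => ?_⟩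
    · have := hcos (hA q (by omega)).1.le ((hmono q k (by omega)).trans_lt h1) (h2.trans h4.2).le
      unfold vx; linarith
    · have := hcos (h3.1.trans h1).le (h2.trans_le (hmono (k + 1) q hq')) (hA q hq).2.le
      unfold vx; linarith
  · have hkd' : k + 1 = d := by omega
    simp only [angle, if_pos hk, hkd', lt_irrefl, if_false] at hφ
    have h3 := hA k hk
    have h0 := hA 0 (by omega)
    have e0 : Real.pi * ((0 : ℕ) + 1) / (d + 1) = Real.pi / (d + 1) := by simp
    rw [e0] at h0
    have h1 : Real.pi * (k + 1) / (d + 1) < φ := by nlinarith [h3.2, h0.1]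
    have h2 : φ < Real.pi / (d + 1) + 2 * Real.pi := by nlinarith [h3.2, h0.1]
    -- The last edge goes round the top. It starts on the lower half with all `d` vertices on its
    -- right, passes over the upper half, and returns to the lower half with no vertex on its right,
    -- so `K = 0`.
    rcases le_or_gt φ Real.pi with h5 | h5
    · right
      have := Real.sin_nonneg_of_nonneg_of_le_pi (h3.1.trans h1).le h5
      refine ⟨by linarith, k + 1, hk, .inl rfl, fun q hq => ?_, fun q hq hq' => by omega⟩
      have := hcos (hA q (by omega)).1.le ((hmono q k (by omega)).trans_lt h1) h5
      unfold vx; linarith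
    · rcases lt_or_ge φ (2 * Real.pi) with h6 | h6
      · left
        have := Real.sin_pos_of_pos_of_lt_pi (x := φ - Real.pi) (by linarith) (by linarith)
        rw [Real.sin_sub_pi] at this
        exact ⟨by linarith, hkd'⟩
      · right
        have e1 : Real.sin φ = Real.sin (φ - 2 * Real.pi) := (Real.sin_sub_two_pi φ).symm
        have e2 : Real.cos φ = Real.cos (φ - 2 * Real.pi) := (Real.cos_sub_two_pi φ).symm
        have := Real.sin_nonneg_of_nonneg_of_le_pi (x := φ - 2 * Real.pi) (by linarith)
          (by linarith [h0.2])
        rw [e1, e2]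
        refine ⟨by linarith, 0, by omega, .inr ⟨rfl, hkd'⟩, fun q hq => by omega, fun q hq _ => ?_⟩
        have h7 := hmono 0 q (by omega)
        rw [e0] at h7
        have := hcos (x := φ - 2 * Real.pi) (by linarith)
          (lt_of_lt_of_le (by linarith) h7) (hA q hq).2.le
        unfold vx; linarith

lemma upperPt_ne_strand {k : ℕ} (hk : k < d) {t : ℝ} (ht : t ∈ Ioo (0 : ℝ) 1) (i : ℤ) {q : ℕ}
    (hq : q < d) (m m' : ℤ) (u' : ℝ) (h : |(upperPt d i k t).im| ≤ 11 / 8) :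
    (upperPt d i k t).re ≠ strand m m' (vx d q) u' (upperPt d i k t).im := by
  intro he
  have hc := upperPt_circle d i k t
  have hnd := upperPt_notMem_discs d i k t
  rcases upperPt_edge hk ht i with ⟨h1, -⟩ | ⟨h1, K, -, -, hlt, hge⟩
  · exact hnd (strand_mem_discs_of_lt hq he ((vy_lt hq).trans h1) (abs_le.1 h).2)
  · set p := upperPt d i k t
    have hy : 1 ≤ p.im := by nlinarith [sq_nonneg (p.re - i)]
    have hx : |p.re - i| ≤ 1 / 4 :=
      abs_le.2 (by constructor <;> nlinarith [sq_nonneg (p.im - 5 / 4)])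
    rw [strand_of_mem_upper _ _ _ _ hy h1] at he
    have hu := abs_vx_lt hq
    have hm : m = i := by
      rcases half_le_of_abs_sub_le (m := m) hx (by norm_num) with h | h
      · rw [he, add_sub_cancel_left] at h; linarith
      · exact h
    subst hm
    rcases lt_or_ge q K with h2 | h2
    · have := hlt q h2; linarith
    · have := hge q hq h2; linarith

lemma upperPt_im_ne {k : ℕ} (hk : k < d) {t : ℝ} (ht : t ∈ Ioo (0 : ℝ) 1) (i : ℤ) {q : ℕ}
    (hq : q < d) : (upperPt d i k t).im ≠ vy d q := by
  intro he
  have hv := vy_lt hq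
  have hc := upperPt_circle d i k t
  rcases upperPt_edge hk ht i with ⟨h1, -⟩ | ⟨h1, K, -, -, hlt, hge⟩
  · linarith
  have hne : ∀ q < d, (upperPt d i k t).re - i ≠ vx d q := fun q hq h => by
    rcases lt_or_ge q K with h2 | h2
    · have := hlt q h2; linarith
    · have := hge q hq h2; linarith
  have : ((upperPt d i k t).re - i) ^ 2 = vx d q ^ 2 := by
    rw [he] at hc; linear_combination hc - vx_sq_add d q
  rcases sq_eq_sq_iff_eq_or_eq_neg.1 this with h2 | h2
  · exact hne q hq h2
  · exact hne (d - 1 - q) (by omega) (by rw [vx_reflect hq, h2])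

lemma upperPt_one_le_im (i : ℤ) (k : ℕ) (t : ℝ) : 1 ≤ (upperPt d i k t).im := by
  have := upperPt_circle d i k t
  nlinarith [sq_nonneg ((upperPt d i k t).re - i)]

lemma upperPt_not_onLine (hd : d = 2 * a + b + c) {k : ℕ} (hk : k < d) {t : ℝ}
    (ht : t ∈ Ioo (0 : ℝ) 1) (i : ℤ) (τ : ArcName a b c) : ¬ OnLine d (upperPt d i k t) τ := by
  cases τ with
  | upper j => exact upperPt_im_ne hk ht i (by omega)
  | lower j =>
    have := upperPt_one_le_im (d := d) i k t
    have := one_le_vy d j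
    simp only [OnLine]; intro h; linarith
  | oblique l => rintro ⟨h, m, hm⟩; exact upperPt_ne_strand hk ht i (by omega) _ _ _ h hm
  | vertical l => rintro ⟨h, m, hm⟩; exact upperPt_ne_strand hk ht i (by omega) _ _ _ h hm

lemma lowerPt_not_onLine (hd : d = 2 * a + b + c) {k : ℕ} (hk : k < d) {t : ℝ}
    (ht : t ∈ Ioo (0 : ℝ) 1) (i : ℤ) (τ : ArcName a b c) : ¬ OnLine d (lowerPt d i k t) τ := by
  unfold lowerPt
  cases τ with
  | upper j =>
    have := upperPt_one_le_im (d := d) i k t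
    have := one_le_vy d j
    simp only [OnLine, Complex.conj_im]; intro h; linarith
  | lower j =>
    simp only [OnLine, Complex.conj_im, neg_inj]
    exact upperPt_im_ne hk ht i (by omega)
  | oblique l =>
    simp only [OnLine, Complex.conj_im, Complex.conj_re, abs_neg, strand_neg]
    rintro ⟨h, m, hm⟩
    exact upperPt_ne_strand hk ht i (by omega) _ _ _ h hm
  | vertical l =>
    simp only [OnLine, Complex.conj_im, Complex.conj_re, abs_neg, strand_neg]
    rintro ⟨h, m, hm⟩
    exact upperPt_ne_strand hk ht i (by omega) _ _ _ h hm

/-- The value of the field on the edges of an upper circle. -/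
lemma sum_crossing_upperPt (hd : d = 2 * a + b + c)
    (h0 : ∑ q ∈ Finset.range d, word α β γ q = 0)
    (mβ mβ' mγ mγ' : ℤ) (uβ' : Fin b → ℝ) (uγ' : Fin c → ℝ) {p : ℂ} {i : ℤ} {k : ℕ} (hk : k < d)
    {t : ℝ} (ht : t ∈ Ioo (0 : ℝ) 1) (hp : p = upperPt d i k t) :
    ∑ k, β k * (⌊p.re - strand mβ mβ' (vx d (a + k)) (uβ' k) p.im⌋ : ZMod 2) +
      ∑ k, γ k * (⌊p.re - strand mγ mγ' (vx d (a + b + k)) (uγ' k) p.im⌋ : ZMod 2) +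
      ∑ j, α j * ((if vy d j < p.im then 1 else 0 : ℤ) : ZMod 2) +
      ∑ j, δ j * ((if p.im < -vy d j then 1 else 0 : ℤ) : ZMod 2) =
    ∑ j, α j + mβ * ∑ k, β k + mγ * ∑ k, γ k + ∑ q ∈ Finset.range (k + 1), word α β γ q := by
  have hc := upperPt_circle d i k t
  rcases upperPt_edge hk ht i with ⟨h1, hkd⟩ | ⟨h1, K, hKd, hK, hlt, hge⟩
  · rw [hkd, h0, add_zero]
    rw [← hp] at hc h1
    have hx : |p.re - i| ≤ 1 / 4 :=
      abs_le.2 (by constructor <;> nlinarith [sq_nonneg (p.im - 5 / 4)])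
    obtain ⟨hx1, hx2⟩ := abs_le.1 hx
    -- On the upper half of the circle, each strand of this column is nearer to the centre line than
    -- the point, or on that line, so all the floors are determined by the side of the line on which
    -- the point lies.
    refine sum_crossing_top hd h0 _ _ _ _ _ _ h1 (if 0 ≤ p.re - i then i else i - 1) ?_
    intro q hq m m' u'
    rw [strand_of_one_le _ _ _ _ (by linarith)]
    have hu : |vx d q * fade p.im| < |p.re - i| ∨ fade p.im = 0 := by
      rcases le_total p.im (11 / 8) with h | h
      · left
        have := fade_sq_lt (abs_vx_lt hq) h1.le h
        exact sq_lt_sq.1 (by linarith)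
      · exact .inr (fade_of_ge h)
    rcases hu with hu | hu
    · split_ifs with h <;> rw [Int.floor_eq_iff]
      · rw [abs_of_nonneg h] at hu
        obtain ⟨u1, u2⟩ := abs_lt.1 hu
        push_cast; constructor <;> linarith
      · rw [abs_of_neg (not_le.1 h)] at hu
        obtain ⟨u1, u2⟩ := abs_lt.1 hu
        push_cast; constructor <;> linarith
    · rw [hu, mul_zero, add_zero]
      split_ifs with h <;> rw [Int.floor_eq_iff] <;> push_cast <;> constructor <;> linarith
  · have h := sum_crossing_circle (δ := δ) hd h0 mβ mβ' mγ mγ' uβ' uγ' hc h1 hKd hlt hge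
    rw [← hp] at h
    rw [h]
    rcases hK with rfl | ⟨rfl, hkd⟩
    · rfl
    · rw [hkd, h0, Finset.sum_range_zero]

variable {w : ArcName a b c → ZMod 2}

lemma field_upperPt (hd : d = 2 * a + b + c) (h0 : ∑ q ∈ Finset.range d, ArcName.upWord w q = 0)
    {k : ℕ} (hk : k < d) {t : ℝ} (ht : t ∈ Ioo (0 : ℝ) 1) (i : ℤ) :
    field d w (upperPt d i k t) = ArcName.upVal w k := by
  have h := sum_crossing_upperPt (α := fun j => w (.upper j)) (δ := fun j => w (.lower j))
    (β := fun k => w (.oblique k)) (γ := fun k => w (.vertical k)) hd h0 0 1 0 0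
    (fun k => vx d (a + c + k)) (fun k => vx d (a + k)) (i := i) hk ht rfl
  refine h.trans ?_
  simp [ArcName.upVal, ArcName.upWord]

/-- Conjugation exchanges upper and lower circles, so the computations for upper circles also apply
to lower ones. The oblique strands then start in column 1 instead of 0, which produces the summand
`∑ w (.oblique k)` in `lowVal`. -/
lemma field_conj (p : ℂ) : field d w ((starRingEnd ℂ) p) =
    ∑ k, w (.vertical k) * (⌊p.re - strand 0 0 (vx d (a + k)) (vx d (a + b + k)) p.im⌋ : ZMod 2) +
      ∑ k, w (.oblique k) *
        (⌊p.re - strand 1 0 (vx d (a + c + k)) (vx d (a + k)) p.im⌋ : ZMod 2) +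
      ∑ j, w (.lower j) * ((if vy d j < p.im then 1 else 0 : ℤ) : ZMod 2) +
      ∑ j, w (.upper j) * ((if p.im < -vy d j then 1 else 0 : ℤ) : ZMod 2) := by
  simp only [field, crossing, Complex.conj_re, Complex.conj_im, strand_neg, neg_lt_neg_iff,
    lt_neg (a := vy d _)]
  ring

lemma field_lowerPt (hd : d = 2 * a + b + c) (h0 : ∑ q ∈ Finset.range d, ArcName.upWord w q = 0)
    {k : ℕ} (hk : k < d) {t : ℝ} (ht : t ∈ Ioo (0 : ℝ) 1) (i : ℤ) :
    field d w (lowerPt d i k t) = ArcName.lowVal w k := by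
  have h := sum_crossing_upperPt (α := fun j => w (.lower j)) (δ := fun j => w (.upper j))
    (β := fun k => w (.vertical k)) (γ := fun k => w (.oblique k)) (d := d) (by omega)
    (ArcName.sum_lowWord hd h0) 0 0 1 0
    (fun k => vx d (a + b + k)) (fun k => vx d (a + k)) (i := i) hk ht rfl
  unfold lowerPt
  rw [field_conj]
  refine h.trans ?_
  simp [ArcName.lowVal, ArcName.lowWord]

/-- At this height the strands of a column have merged into one vertical line, and their total jump
is zero. This is why `OnLine` can disregard them beyond height `11 / 8`, and why the field extends
over the pole of the sphere. -/
lemma field_of_lt_im (hd : d = 2 * a + b + c) (h0 : ∑ q ∈ Finset.range d, ArcName.upWord w q = 0)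
    {p : ℂ} (hp : 11 / 8 < p.im) : field d w p = ∑ j, w (.upper j) := by
  have h := sum_crossing_top (α := fun j => w (.upper j)) (δ := fun j => w (.lower j))
    (β := fun k => w (.oblique k)) (γ := fun k => w (.vertical k)) hd h0 0 1 0 0
    (fun k => vx d (a + c + k)) (fun k => vx d (a + k)) (p := p) (by linarith) ⌊p.re⌋ (by
      intro q _ m m' u'
      rw [strand_of_ge _ _ _ _ hp.le, Int.floor_sub_intCast])
  refine h.trans ?_
  simp

lemma field_of_im_lt (hd : d = 2 * a + b + c) (h0 : ∑ q ∈ Finset.range d, ArcName.upWord w q = 0)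
    {p : ℂ} (hp : p.im < -(11 / 8)) :
    field d w p = ∑ j, w (.lower j) + ∑ k, w (.oblique k) := by
  have hp' : 11 / 8 < ((starRingEnd ℂ) p).im := by rw [Complex.conj_im]; linarith
  have h := sum_crossing_top (α := fun j => w (.lower j)) (δ := fun j => w (.upper j))
    (β := fun k => w (.vertical k)) (γ := fun k => w (.oblique k)) (d := d) (by omega)
    (ArcName.sum_lowWord hd h0) 0 0 1 0
    (fun k => vx d (a + b + k)) (fun k => vx d (a + k)) (p := (starRingEnd ℂ) p) (by linarith)
    ⌊p.re⌋ (by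
      intro q _ m m' u'
      rw [strand_of_ge _ _ _ _ hp'.le, Int.floor_sub_intCast, Complex.conj_re])
  rw [← Complex.conj_conj p, field_conj]
  refine h.trans ?_
  simp

lemma not_onLine_of_lt_abs_im (hd : d = 2 * a + b + c) {p : ℂ} (hp : 11 / 8 < |p.im|)
    (τ : ArcName a b c) : ¬ OnLine d p τ := by
  cases τ with
  | upper j =>
    intro h
    have h1 := one_le_vy d j
    have h2 := vy_lt (d := d) (k := j) (by omega)
    rw [OnLine] at h
    rw [h, abs_of_pos (by linarith)] at hp
    linarith
  | lower j =>
    intro h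
    have h1 := one_le_vy d j
    have h2 := vy_lt (d := d) (k := j) (by omega)
    rw [OnLine] at h
    rw [h, abs_neg, abs_of_pos (by linarith)] at hp
    linarith
  | oblique k => exact fun h => absurd h.1 (not_le.2 hp)
  | vertical k => exact fun h => absurd h.1 (not_le.2 hp)

/-- Off the prolonged arcs, the field is locally constant. -/
lemma field_eventually (hd : d = 2 * a + b + c)
    (h0 : ∑ q ∈ Finset.range d, ArcName.upWord w q = 0) {p : ℂ}
    (hp : ∀ τ : ArcName a b c, ¬ OnLine d p τ) :
    ∀ᶠ q in 𝓝 p, (∀ τ : ArcName a b c, ¬ OnLine d q τ) ∧ field d w q = field d w p := by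
  rcases le_or_gt |p.im| (11 / 8) with h | h
  · have hU := eventually_all.2 fun j => crossing_eventually (hp (.upper j)) h
    have hL := eventually_all.2 fun j => crossing_eventually (hp (.lower j)) h
    have hO := eventually_all.2 fun k => crossing_eventually (hp (.oblique k)) h
    have hV := eventually_all.2 fun k => crossing_eventually (hp (.vertical k)) h
    filter_upwards [hU, hL, hO, hV] with q h1 h2 h3 h4
    refine ⟨fun τ => ?_, by simp only [field, h1, h2, h3, h4]⟩
    cases τ with
    | upper j => exact (h1 j).1
    | lower j => exact (h2 j).1
    | oblique k => exact (h3 k).1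
    | vertical k => exact (h4 k).1
  · rcases lt_abs.1 h with h' | h'
    · filter_upwards [Complex.continuous_im.continuousAt.eventually (lt_mem_nhds h')] with q hq
      exact ⟨not_onLine_of_lt_abs_im hd (hq.trans_le (le_abs_self _)),
        by rw [field_of_lt_im hd h0 hq, field_of_lt_im hd h0 h']⟩
    · have h'' : p.im < -(11 / 8) := by linarith
      filter_upwards [Complex.continuous_im.continuousAt.eventually (gt_mem_nhds h'')] with q hq
      refine ⟨not_onLine_of_lt_abs_im hd (lt_of_lt_of_le ?_ (neg_le_abs _)),
        by rw [field_of_im_lt hd h0 hq, field_of_im_lt hd h0 h'']⟩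
      linarith

lemma onLine_add_int {p : ℂ} {l : ℤ} {τ : ArcName a b c} :
    OnLine d (p + l) τ ↔ OnLine d p τ := by
  have key : ∀ (f : ℤ → ℝ → ℝ), (∀ m l y, f (m + l) y = f m y + l) →
      ((∃ m, (p + l).re = f m p.im) ↔ ∃ m, p.re = f m p.im) := by
    intro f hf
    constructor
    · rintro ⟨m, hm⟩
      refine ⟨m - l, ?_⟩
      have := hf (m - l) l p.im
      rw [sub_add_cancel] at this
      rw [Complex.add_re, Complex.intCast_re] at hm
      linarith
    · rintro ⟨m, hm⟩
      exact ⟨m + l, by rw [hf, Complex.add_re, Complex.intCast_re, hm]⟩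
  cases τ with
  | upper j => simp [OnLine]
  | lower j => simp [OnLine]
  | oblique k =>
    simp only [OnLine, Complex.add_im, Complex.intCast_im, add_zero]
    rw [key (fun m y => strand m (m + 1) (vx d (a + k)) (vx d (a + c + k)) y) (fun m l y => by
      rw [← strand_add]; congr 1; ring)]
  | vertical k =>
    simp only [OnLine, Complex.add_im, Complex.intCast_im, add_zero]
    rw [key (fun m y => strand m m (vx d (a + b + k)) (vx d (a + k)) y) (fun m l y => by
      rw [← strand_add])]

/-- A translation by `l` adds `l` to every floor, hence `l` times the total weight of the descending
arcs, which is zero. So the field is defined on the sphere. -/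
lemma field_add_int (hd : d = 2 * a + b + c)
    (h0 : ∑ q ∈ Finset.range d, ArcName.upWord w q = 0) (p : ℂ) (l : ℤ) :
    field d w (p + l) = field d w p := by
  simp only [field, crossing, Complex.add_re, Complex.add_im, Complex.intCast_re,
    Complex.intCast_im, add_zero, add_sub_right_comm _ (l : ℝ), Int.floor_add_intCast]
  push_cast
  simp only [mul_add, Finset.sum_add_distrib, ← Finset.sum_mul]
  linear_combination (l : ZMod 2) * ArcName.sum_oblique_add_sum_vertical hd h0

end field

/-! ### Arcs and prolonged arcs -/

namespace SixTuple

variable (σ : SixTuple)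

lemma d_eq : σ.d = 2 * σ.a + σ.b + σ.c := rfl

lemma d_pos : 0 < σ.d := by have := σ.abc_pos; rw [d_eq]; omega

end SixTuple

namespace SixTuple

variable {σ : SixTuple}

lemma two_mul_add_one_lt (j : Fin σ.a) : 2 * (j : ℕ) + 1 < σ.d := by
  have := σ.d_eq; omega

lemma onLine_of_mem_coverArc {i : ℤ} {τ : ArcName σ.a σ.b σ.c} {p : ℂ} (hp : p ∈ σ.coverArc i τ) :
    OnLine σ.d p τ := by
  have hd := σ.d_eq
  have him : ∀ {q q' : ℕ}, q < σ.d → q' < σ.d → p.im ≤ vy σ.d q → -vy σ.d q' ≤ p.im →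
      |p.im| ≤ 11 / 8 := fun hq hq' h h' => by
    have := vy_lt hq
    have := vy_lt hq'
    exact abs_le.2 ⟨by linarith, by linarith⟩
  cases τ with
  | upper j => exact ((mem_horizontal_iff (two_mul_add_one_lt j) i).1 hp).1
  | lower j => exact ((mem_lower_horizontal_iff (two_mul_add_one_lt j) i).1 hp).1
  | oblique k =>
    obtain ⟨h1, h2, h3⟩ := (mem_descent_iff (by omega) (by omega) _ _).1 hp
    exact ⟨him (by omega) (by omega) h2 h3, i, h1⟩
  | vertical k =>
    obtain ⟨h1, h2, h3⟩ := (mem_descent_iff (by omega) (by omega) _ _).1 hp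
    exact ⟨him (by omega) (by omega) h2 h3, i, h1⟩

/-- The prolongations lie inside the removed discs, so on the sphere with holes the field jumps only
across true arcs. -/
lemma mem_coverArc_of_onLine {τ : ArcName σ.a σ.b σ.c} {p : ℂ} (hp : OnLine σ.d p τ)
    (hnd : p ∉ discs) : ∃ i, p ∈ σ.coverArc i τ := by
  have hd := σ.d_eq
  cases τ with
  | upper j =>
    obtain ⟨i, hi⟩ := horizontal_of_notMem_discs (two_mul_add_one_lt j) hp hnd
    exact ⟨i, (mem_horizontal_iff (two_mul_add_one_lt j) i).2 ⟨hp, hi⟩⟩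
  | lower j =>
    obtain ⟨i, hi⟩ := horizontal_of_notMem_discs (p := (starRingEnd ℂ) p) (two_mul_add_one_lt j)
      (by rw [Complex.conj_im, hp, neg_neg]) (by rwa [conj_mem_discs])
    exact ⟨i, (mem_lower_horizontal_iff (two_mul_add_one_lt j) i).2 ⟨hp, hi⟩⟩
  | oblique k =>
    obtain ⟨h, m, hm⟩ := hp
    exact ⟨m, mem_descent_of_strand (by omega) (by omega) hm h hnd⟩
  | vertical k =>
    obtain ⟨h, m, hm⟩ := hp
    exact ⟨m, mem_descent_of_strand (by omega) (by omega) hm h hnd⟩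

lemma coverArc_notMem_discs {i : ℤ} {τ : ArcName σ.a σ.b σ.c} {p : ℂ} (hp : p ∈ σ.coverArc i τ) :
    p ∉ discs := by
  have hd := σ.d_eq
  cases τ with
  | upper j =>
    exact horizontal_notMem_discs (two_mul_add_one_lt j)
      ((mem_horizontal_iff (two_mul_add_one_lt j) i).1 hp)
  | lower j =>
    obtain ⟨h1, h2⟩ := (mem_lower_horizontal_iff (two_mul_add_one_lt j) i).1 hp
    rw [← conj_mem_discs]
    exact horizontal_notMem_discs (two_mul_add_one_lt j)
      ⟨by rw [Complex.conj_im, h1, neg_neg], h2⟩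
  | oblique k => exact descent_notMem_discs (by omega) (by omega) hp
  | vertical k => exact descent_notMem_discs (by omega) (by omega) hp

lemma isPreconnected_descent (p q : ℂ) : IsPreconnected (descent p q) := by
  refine IsPreconnected.union' ?_ ?_ (convex_segment _ _).isPreconnected
  · exact ⟨_, .inr (right_mem_segment ℝ _ _), left_mem_segment ℝ _ _⟩
  · exact IsPreconnected.union _ (right_mem_segment ℝ _ _) (left_mem_segment ℝ _ _)
      (convex_segment _ _).isPreconnected (convex_segment _ _).isPreconnected

lemma left_mem_descent (p q : ℂ) : p ∈ descent p q := .inl (.inl (left_mem_segment ℝ _ _))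

lemma right_mem_descent (p q : ℂ) : q ∈ descent p q := .inr (right_mem_segment ℝ _ _)

lemma isPreconnected_coverArc (i : ℤ) (τ : ArcName σ.a σ.b σ.c) :
    IsPreconnected (σ.coverArc i τ) := by
  cases τ with
  | upper j => exact (convex_segment _ _).isPreconnected
  | lower j => exact (convex_segment _ _).isPreconnected
  | oblique k => exact isPreconnected_descent _ _
  | vertical k => exact isPreconnected_descent _ _

lemma coverArc_nonempty (i : ℤ) (τ : ArcName σ.a σ.b σ.c) : (σ.coverArc i τ).Nonempty := by
  cases τ with
  | upper j => exact ⟨_, left_mem_segment ℝ _ _⟩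
  | lower j => exact ⟨_, left_mem_segment ℝ _ _⟩
  | oblique k => exact ⟨_, left_mem_descent _ _⟩
  | vertical k => exact ⟨_, left_mem_descent _ _⟩

/-- Every vertex of an upper circle is an end of an arc. -/
lemma exists_upperVx_mem (i : ℤ) {k : ℕ} (hk : k < σ.d) :
    ∃ (i' : ℤ) (τ : ArcName σ.a σ.b σ.c), upperVx σ.d i k ∈ σ.coverArc i' τ ∧
      ∀ w : ArcName σ.a σ.b σ.c → ℤ, ArcName.upWord w k = w τ := by
  rcases word_cases σ.d_eq hk with ⟨j, rfl⟩ | ⟨j, rfl⟩ | ⟨j, rfl⟩ | ⟨j, rfl⟩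
  · exact ⟨i, .upper j, left_mem_segment ℝ _ _, fun w => word_first _ _ _ j⟩
  · exact ⟨i, .oblique j, left_mem_descent _ _, fun w => word_second _ _ _ j⟩
  · exact ⟨i, .vertical j, left_mem_descent _ _, fun w => word_third _ _ _ j⟩
  · refine ⟨i - 1, .upper j, ?_, fun w => word_fourth _ _ _ j⟩
    have h := right_mem_segment ℝ (upperVx σ.d (i - 1) j)
      (upperVx σ.d (i - 1 + 1) (σ.d - 1 - j))
    rw [sub_add_cancel] at h
    simp only [coverArc, sub_add_cancel]
    exact h

/-- Every vertex of a lower circle is an end of an arc. -/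
lemma exists_lowerVx_mem (i : ℤ) {k : ℕ} (hk : k < σ.d) :
    ∃ (i' : ℤ) (τ : ArcName σ.a σ.b σ.c), lowerVx σ.d i k ∈ σ.coverArc i' τ ∧
      ∀ w : ArcName σ.a σ.b σ.c → ℤ, ArcName.lowWord w k = w τ := by
  have hd := σ.d_eq
  have e : σ.d = 2 * σ.a + σ.c + σ.b := by omega
  rcases word_cases e hk with ⟨j, rfl⟩ | ⟨j, rfl⟩ | ⟨j, rfl⟩ | ⟨j, rfl⟩
  · exact ⟨i, .lower j, left_mem_segment ℝ _ _, fun w => word_first _ _ _ j⟩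
  · exact ⟨i, .vertical j, right_mem_descent _ _, fun w => word_second _ _ _ j⟩
  · refine ⟨i - 1, .oblique j, ?_, fun w => word_third _ _ _ j⟩
    simp only [coverArc, sub_add_cancel]
    exact right_mem_descent _ _
  · refine ⟨i - 1, .lower j, ?_, fun w => word_fourth _ _ _ j⟩
    simp only [coverArc, sub_add_cancel, ← e]
    exact right_mem_segment ℝ _ _

lemma upperPt_one (d : ℕ) (i : ℤ) (k : ℕ) (hk : k < d) :
    upperPt d i k 1 = upperVx d i (if k + 1 < d then k + 1 else 0) := by
  unfold upperVx
  rw [upperPt_eq, upperPt_eq]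
  split_ifs with h
  · simp
  · have h0 : 0 < d := by omega
    simp [angle, h, h0, Real.cos_sub_two_pi, Real.sin_sub_two_pi]

lemma upperPt_end {d : ℕ} (i : ℤ) {k : ℕ} (hk : k < d) {t : ℝ} (ht : t ∈ Icc (0 : ℝ) 1)
    (ht' : t ∉ Ioo (0 : ℝ) 1) : ∃ l < d, upperPt d i k t = upperVx d i l := by
  rcases ht.1.eq_or_lt with rfl | h0
  · exact ⟨k, hk, rfl⟩
  rcases ht.2.eq_or_lt with rfl | h1
  · exact ⟨_, by split_ifs <;> omega, upperPt_one d i k hk⟩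
  · exact absurd ⟨h0, h1⟩ ht'

/-! ### Wrapping the cover around the sphere -/

lemma n_ne_zero (σ : SixTuple) : (σ.n : ℂ) ≠ 0 := Nat.cast_ne_zero.2 σ.n_pos.ne'

lemma wrap_eq_wrap_iff {p q : ℂ} : σ.wrap p = σ.wrap q ↔ ∃ k : ℤ, p = q + (σ.n * k : ℤ) := by
  have hn := σ.n_ne_zero
  unfold wrap
  rw [OnePoint.coe_eq_coe, Complex.exp_eq_exp_iff_exists_int]
  refine exists_congr fun k => ?_
  have : (2 * Real.pi * Complex.I : ℂ) ≠ 0 := Complex.two_pi_I_ne_zero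
  have e : 2 * Real.pi * Complex.I * p / σ.n = 2 * Real.pi * Complex.I * q / σ.n +
      k * (2 * Real.pi * Complex.I) ↔
      2 * Real.pi * Complex.I * p = 2 * Real.pi * Complex.I * (q + σ.n * k) := by
    field_simp
  rw [e, mul_right_inj' this]
  push_cast
  rfl

lemma wrap_ne_zero (p : ℂ) : σ.wrap p ≠ ((0 : ℂ) : Sphere) := by
  unfold wrap
  rw [ne_eq, OnePoint.coe_eq_coe]
  exact Complex.exp_ne_zero _

lemma wrap_ne_infty (p : ℂ) : σ.wrap p ≠ OnePoint.infty := OnePoint.coe_ne_infty _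

lemma exists_wrap_eq {z : ℂ} (hz : z ≠ 0) : ∃ p, σ.wrap p = (z : Sphere) := by
  refine ⟨σ.n * Complex.log z / (2 * Real.pi * Complex.I), ?_⟩
  have hn := σ.n_ne_zero
  have : (2 * Real.pi * Complex.I : ℂ) ≠ 0 := Complex.two_pi_I_ne_zero
  unfold wrap
  rw [mul_div_cancel₀ _ this, mul_div_cancel_left₀ _ hn, Complex.exp_log hz]

lemma sphere_cases (σ : SixTuple) (x : Sphere) :
    x = OnePoint.infty ∨ x = ((0 : ℂ) : Sphere) ∨ ∃ p, σ.wrap p = x := by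
  induction x using OnePoint.rec with
  | infty => exact .inl rfl
  | coe z =>
    right
    by_cases hz : z = 0
    · exact .inl (by rw [hz])
    · exact .inr (exists_wrap_eq hz)

lemma continuous_wrap : Continuous σ.wrap := by
  unfold wrap
  exact OnePoint.continuous_coe.comp (by fun_prop)

lemma isOpenMap_wrap : IsOpenMap σ.wrap := by
  have hn := σ.n_ne_zero
  have hc : (2 * Real.pi * Complex.I / σ.n : ℂ) ≠ 0 := div_ne_zero Complex.two_pi_I_ne_zero hn
  have e : σ.wrap = (fun z : ℂ => (z : Sphere)) ∘ Complex.exp ∘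
      (Homeomorph.mulLeft₀ (2 * Real.pi * Complex.I / σ.n : ℂ) hc) := by
    funext p
    simp only [wrap, Function.comp_apply, Homeomorph.coe_mulLeft₀]
    congr 2
    ring
  rw [e]
  refine OnePoint.isOpenEmbedding_coe.isOpenMap.comp (IsOpenMap.comp ?_ (Homeomorph.isOpenMap _))
  exact isOpenMap_iff_nhds_le.2 fun z =>
    ((Complex.hasStrictDerivAt_exp z).map_nhds_eq (Complex.exp_ne_zero z)).ge

lemma add_int_mem_discs {p : ℂ} {l : ℤ} : p + l ∈ discs ↔ p ∈ discs := by
  simp only [mem_discs, Complex.add_re, Complex.add_im, Complex.intCast_re, Complex.intCast_im,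
    add_zero]
  constructor
  · rintro ⟨i, hi⟩
    refine ⟨i - l, ?_⟩
    push_cast
    rwa [← sub_add, sub_add_eq_add_sub]
  · rintro ⟨i, hi⟩
    refine ⟨i + l, ?_⟩
    push_cast
    rwa [add_sub_add_right_eq_sub]

lemma holed_eq : σ.holed = (σ.wrap '' discs)ᶜ := by
  unfold holed discs
  simp only [image_iUnion, image_union]

lemma wrap_mem_holed {p : ℂ} : σ.wrap p ∈ σ.holed ↔ p ∉ discs := by
  rw [holed_eq, mem_compl_iff, not_iff_not]
  refine ⟨?_, fun h => ⟨p, h, rfl⟩⟩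
  rintro ⟨q, hq, h⟩
  obtain ⟨k, rfl⟩ := wrap_eq_wrap_iff.1 h
  exact add_int_mem_discs.1 hq

lemma zero_mem_holed : ((0 : ℂ) : Sphere) ∈ σ.holed := by
  rw [holed_eq]
  rintro ⟨q, -, h⟩
  exact wrap_ne_zero q h

lemma infty_mem_holed : (OnePoint.infty : Sphere) ∈ σ.holed := by
  rw [holed_eq]
  rintro ⟨q, -, h⟩
  exact wrap_ne_infty q h

lemma arc_subset_holed (i : ℤ) (τ : ArcName σ.a σ.b σ.c) : σ.arc i τ ⊆ σ.holed := by
  rintro _ ⟨p, hp, rfl⟩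
  exact wrap_mem_holed.2 (coverArc_notMem_discs hp)

lemma upperPoint_mem_holed (i j : ℤ) (t : ℝ) : σ.upperPoint i j t ∈ σ.holed :=
  wrap_mem_holed.2 (upperPt_notMem_discs _ _ _ _)

lemma lowerPoint_mem_holed (i j : ℤ) (t : ℝ) : σ.lowerPoint i j t ∈ σ.holed :=
  wrap_mem_holed.2 (by
    unfold lowerPt; rw [conj_mem_discs]; exact upperPt_notMem_discs _ _ _ _)

lemma pos_lt (j : ℤ) : σ.pos j < σ.d := labelPos_lt σ.d_pos j

lemma isConnected_onSurface_arc (i : ℤ) (τ : ArcName σ.a σ.b σ.c) :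
    IsConnected (σ.onSurface (σ.arc i τ)) := by
  have h1 : IsConnected (σ.arc i τ) :=
    IsConnected.image ⟨coverArc_nonempty i τ, isPreconnected_coverArc i τ⟩ _
      continuous_wrap.continuousOn
  have h2 : IsConnected {x : σ.holed | x.1 ∈ σ.arc i τ} := by
    obtain ⟨x, hx⟩ := h1.nonempty
    refine ⟨⟨⟨x, arc_subset_holed i τ hx⟩, hx⟩, IsInducing.subtypeVal.isPreconnected_image.1 ?_⟩
    convert h1.isPreconnected
    ext x
    constructor
    · rintro ⟨y, hy, rfl⟩; exact hy
    · intro hx; exact ⟨⟨x, arc_subset_holed i τ hx⟩, hx, rfl⟩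
  exact h2.image _ continuous_quot_mk.continuousOn

lemma onSurface_arc_subset_lam (i : ℤ) (τ : ArcName σ.a σ.b σ.c) :
    σ.onSurface (σ.arc i τ) ⊆ σ.lam :=
  image_mono fun _ hx => mem_iUnion.2 ⟨i, mem_iUnion.2 ⟨τ, hx⟩⟩

lemma mem_lam_iff {q : σ.Surface} : q ∈ σ.lam ↔ ∃ i τ, q ∈ σ.onSurface (σ.arc i τ) := by
  simp only [lam, onSurface, mem_image, mem_ofPred_eq, mem_iUnion]
  constructor
  · rintro ⟨x, ⟨i, τ, h⟩, rfl⟩; exact ⟨i, τ, x, h, rfl⟩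
  · rintro ⟨i, τ, x, h, rfl⟩; exact ⟨x, ⟨i, τ, h⟩, rfl⟩

/-! ### The regions cut out by a null homologous sum of cycles, for `n = 1` -/

section region

variable (hn : σ.n = 1)

/-- The set of the points of the sphere off the prolonged arcs where the field is `ε`. -/
def region (w : ArcName σ.a σ.b σ.c → ZMod 2) (ε : ZMod 2) : Set Sphere :=
  σ.wrap '' {p | (∀ τ : ArcName σ.a σ.b σ.c, ¬ OnLine σ.d p τ) ∧ field σ.d w p = ε} ∪
    ({x | x = ((0 : ℂ) : Sphere) ∧ ∑ j, w (.upper j) = ε} ∪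
      {x | x = OnePoint.infty ∧ ∑ j, w (.lower j) + ∑ k, w (.oblique k) = ε})

variable {w : ArcName σ.a σ.b σ.c → ZMod 2} {ε : ZMod 2}
  (h0 : ∑ q ∈ Finset.range σ.d, ArcName.upWord w q = 0)

lemma zero_mem_region :
    ((0 : ℂ) : Sphere) ∈ region w ε ↔ ∑ j, w (.upper j) = ε := by
  refine ⟨?_, fun h => .inr (.inl ⟨rfl, h⟩)⟩
  rintro (⟨p, -, hp⟩ | ⟨-, h⟩ | ⟨h, -⟩)
  · exact absurd hp (wrap_ne_zero p)
  · exact h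
  · exact absurd h (OnePoint.coe_ne_infty _)

lemma infty_mem_region : (OnePoint.infty : Sphere) ∈ region w ε ↔
    ∑ j, w (.lower j) + ∑ k, w (.oblique k) = ε := by
  refine ⟨?_, fun h => .inr (.inr ⟨rfl, h⟩)⟩
  rintro (⟨p, -, hp⟩ | ⟨h, -⟩ | ⟨-, h⟩)
  · exact absurd hp (wrap_ne_infty p)
  · exact absurd h (OnePoint.infty_ne_coe _)
  · exact h

include h0 in
lemma wrap_mem_region {p : ℂ} : σ.wrap p ∈ region w ε ↔
    (∀ τ : ArcName σ.a σ.b σ.c, ¬ OnLine σ.d p τ) ∧ field σ.d w p = ε := by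
  refine ⟨?_, fun h => .inl ⟨p, h, rfl⟩⟩
  rintro (⟨q, hq, h⟩ | ⟨h, -⟩ | ⟨h, -⟩)
  · obtain ⟨k, rfl⟩ := wrap_eq_wrap_iff.1 h
    obtain ⟨h1, h2⟩ := hq
    rw [field_add_int σ.d_eq h0] at h2
    exact ⟨fun τ hτ => h1 τ (onLine_add_int.2 hτ), h2⟩
  · exact absurd h (wrap_ne_zero p)
  · exact absurd h (wrap_ne_infty p)

include hn in
lemma norm_wrap_lift {p : ℂ} {z : ℂ} (h : σ.wrap p = (z : Sphere)) :
    ‖z‖ = Real.exp (-(2 * Real.pi * p.im)) := by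
  unfold wrap at h
  rw [OnePoint.coe_eq_coe] at h
  rw [← h, Complex.norm_exp, hn]
  congr 1
  simp

include hn h0 in
lemma isOpen_region : IsOpen (region w ε) := by
  have hpi := Real.pi_pos
  rw [isOpen_iff_mem_nhds]
  rintro x (⟨p, ⟨hp, hf⟩, rfl⟩ | ⟨rfl, h⟩ | ⟨rfl, h⟩)
  · have := (isOpenMap_wrap (σ := σ)).image_mem_nhds (field_eventually σ.d_eq h0 hp)
    refine mem_of_superset this ?_
    rintro _ ⟨q, ⟨hq, hq'⟩, rfl⟩
    exact .inl ⟨q, ⟨hq, hq'.trans hf⟩, rfl⟩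
  -- Heights above `11 / 8` correspond to the punctured ball of this radius, and the field is
  -- constant there. The point at infinity is treated in the same way with heights below `-11 / 8`.
  · have hball : ball (0 : ℂ) (Real.exp (-(2 * Real.pi * (11 / 8)))) ∈ 𝓝 (0 : ℂ) :=
      ball_mem_nhds _ (Real.exp_pos _)
    refine mem_of_superset (OnePoint.isOpenEmbedding_coe.isOpenMap.image_mem_nhds hball) ?_
    rintro _ ⟨z, hz, rfl⟩
    by_cases hz0 : z = 0
    · rw [hz0]; exact zero_mem_region.2 h
    obtain ⟨q, hq⟩ := exists_wrap_eq (σ := σ) hz0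
    rw [mem_ball_zero_iff, norm_wrap_lift hn hq, Real.exp_lt_exp] at hz
    have hq' : 11 / 8 < q.im := by nlinarith
    change (z : Sphere) ∈ _
    rw [← hq]
    exact .inl ⟨q, ⟨not_onLine_of_lt_abs_im σ.d_eq (hq'.trans_le (le_abs_self _)),
      by rw [field_of_lt_im σ.d_eq h0 hq', h]⟩, rfl⟩
  · have hopen : IsOpen ((fun z : ℂ => (z : Sphere)) ''
        closedBall (0 : ℂ) (Real.exp (2 * Real.pi * (11 / 8))))ᶜ :=
      OnePoint.isOpen_compl_image_coe.2 ⟨isClosed_closedBall, isCompact_closedBall _ _⟩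
    refine mem_of_superset (hopen.mem_nhds OnePoint.infty_notMem_image_coe) ?_
    intro x hx
    induction x using OnePoint.rec with
    | infty => exact infty_mem_region.2 h
    | coe z =>
      have hz : ¬ ‖z‖ ≤ Real.exp (2 * Real.pi * (11 / 8)) := fun hz =>
        hx ⟨z, mem_closedBall_zero_iff.2 hz, rfl⟩
      have hz0 : z ≠ 0 := by
        rintro rfl
        exact hz (by rw [norm_zero]; positivity)
      obtain ⟨q, hq⟩ := exists_wrap_eq (σ := σ) hz0
      rw [norm_wrap_lift hn hq, Real.exp_le_exp] at hz
      have hq' : q.im < -(11 / 8) := by nlinarith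
      rw [← hq]
      exact .inl ⟨q, ⟨not_onLine_of_lt_abs_im σ.d_eq
        (lt_of_lt_of_le (by linarith) (neg_le_abs _)),
        by rw [field_of_im_lt σ.d_eq h0 hq', h]⟩, rfl⟩

include h0 in
lemma region_unique {ε' : ZMod 2} {x : Sphere} (h : x ∈ region w ε) (h' : x ∈ region w ε') :
    ε = ε' := by
  rcases σ.sphere_cases x with rfl | rfl | ⟨p, rfl⟩
  · rw [infty_mem_region] at h h'; exact h.symm.trans h'
  · rw [zero_mem_region] at h h'; exact h.symm.trans h'
  · rw [wrap_mem_region h0] at h h'; exact h.2.symm.trans h'.2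

lemma wrap_add_int (hn : σ.n = 1) (p : ℂ) (l : ℤ) : σ.wrap (p + l) = σ.wrap p :=
  wrap_eq_wrap_iff.2 ⟨l, by rw [hn]; simp⟩

include h0 in
lemma mem_region_of_notMem_arc {x : Sphere} (hx : x ∈ σ.holed) (hx' : ∀ i τ, x ∉ σ.arc i τ) :
    ∃ ε, x ∈ region w ε := by
  rcases σ.sphere_cases x with rfl | rfl | ⟨p, rfl⟩
  · exact ⟨_, infty_mem_region.2 rfl⟩
  · exact ⟨_, zero_mem_region.2 rfl⟩
  · refine ⟨_, (wrap_mem_region h0).2 ⟨fun τ hτ => ?_, rfl⟩⟩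
    obtain ⟨i, hi⟩ := mem_coverArc_of_onLine hτ (wrap_mem_holed.1 hx)
    exact hx' i τ ⟨p, hi, rfl⟩

include h0 in
lemma notMem_region_of_mem_arc {x : Sphere} {i : ℤ} {τ : ArcName σ.a σ.b σ.c}
    (hx : x ∈ σ.arc i τ) : x ∉ region w ε := by
  obtain ⟨p, hp, rfl⟩ := hx
  exact fun h => ((wrap_mem_region h0).1 h).1 τ (onLine_of_mem_coverArc hp)

variable (hval : ∀ j, ArcName.upVal w (labelPos σ.d j) = ArcName.lowVal w (labelPos σ.d (j + σ.r)))

include h0 in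
lemma upperPt_mem_region (i : ℤ) {k : ℕ} (hk : k < σ.d) {t : ℝ} (ht : t ∈ Ioo (0 : ℝ) 1) :
    σ.wrap (upperPt σ.d i k t) ∈ region w ε ↔ ArcName.upVal w k = ε := by
  rw [wrap_mem_region h0, field_upperPt σ.d_eq h0 hk ht]
  exact and_iff_right (upperPt_not_onLine σ.d_eq hk ht i)

include h0 in
lemma lowerPt_mem_region (i : ℤ) {k : ℕ} (hk : k < σ.d) {t : ℝ} (ht : t ∈ Ioo (0 : ℝ) 1) :
    σ.wrap (lowerPt σ.d i k t) ∈ region w ε ↔ ArcName.lowVal w k = ε := by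
  rw [wrap_mem_region h0, field_lowerPt σ.d_eq h0 hk ht]
  exact and_iff_right (lowerPt_not_onLine σ.d_eq hk ht i)

include h0 hval in
-- Inside an edge the values on the two sides agree because the gap is zero. The ends of an edge are
-- vertices, so they lie on arcs and belong to no region.
lemma glue_mem_region {x y : σ.holed} (h : σ.Glue x y) :
    x.1 ∈ region w ε ↔ y.1 ∈ region w ε := by
  obtain ⟨i, j, t, ht, hx, hy⟩ := h
  rw [hx, hy]
  unfold upperPoint lowerPoint
  by_cases ht' : t ∈ Ioo (0 : ℝ) 1
  · rw [upperPt_mem_region h0 _ (pos_lt _) ht', lowerPt_mem_region h0 _ (pos_lt _) ht']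
    exact Eq.congr_left (hval j)
  · refine iff_of_false ?_ ?_
    · obtain ⟨l, hl, h⟩ := upperPt_end i (σ.pos_lt j) ht ht'
      obtain ⟨i', τ, hm, -⟩ := exists_upperVx_mem i hl
      rw [h]
      exact notMem_region_of_mem_arc h0 ⟨_, hm, rfl⟩
    · obtain ⟨l, hl, h⟩ := upperPt_end (i - σ.s) (σ.pos_lt (j + σ.r)) ht ht'
      obtain ⟨i', τ, hm, -⟩ := exists_lowerVx_mem (i - σ.s) hl
      rw [lowerPt, h]
      exact notMem_region_of_mem_arc h0 ⟨_, hm, rfl⟩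

include hn h0 hval in
/-- A nonzero sum of cycles that bounds disconnects the surface. -/
lemma not_isPreconnected_compl_lam (hw : ∃ k < σ.d, ArcName.upWord w k ≠ 0) :
    ¬ IsPreconnected σ.lamᶜ := by
  intro hpc
  have hlift : ∀ ε x y, σ.Glue x y → (x.1 ∈ region w ε) = (y.1 ∈ region w ε) := fun ε x y h =>
    propext (glue_mem_region h0 hval h)
  set S : ZMod 2 → Set σ.Surface := fun ε => {q | Quot.lift (fun x => x.1 ∈ region w ε) (hlift ε) q}
  have hS : ∀ ε x, σ.glueMap x ∈ S ε ↔ x.1 ∈ region w ε := fun _ _ => Iff.rfl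
  have hSo : ∀ ε, IsOpen (S ε) := fun ε =>
    isOpen_coinduced.2 ((isOpen_region hn h0).preimage continuous_subtype_val)
  have hSlam : ∀ ε, S ε ⊆ σ.lamᶜ := by
    intro ε q hq hq'
    obtain ⟨i, τ, x, hx, rfl⟩ := mem_lam_iff.1 hq'
    exact notMem_region_of_mem_arc h0 hx ((hS ε x).1 hq)
  have hedge : ∀ k < σ.d, (S (ArcName.upVal w k)).Nonempty := fun k hk =>
    ⟨σ.glueMap ⟨σ.wrap (upperPt σ.d 0 k (1 / 2)), wrap_mem_holed.2 (upperPt_notMem_discs _ _ _ _)⟩,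
      (hS _ _).2 ((upperPt_mem_region h0 0 hk (by norm_num)).2 rfl)⟩
  obtain ⟨k, hk, hwk⟩ := hw
  -- The edges before and after the vertex `k` have values that differ by the nonzero weight there.
  obtain ⟨l, hl, hkl⟩ : ∃ l < σ.d, ArcName.upVal w k ≠ ArcName.upVal w l := by
    have hstep := ArcName.upVal_step σ.d_pos h0 k
    rw [labelPos_natCast_succ hk] at hstep
    exact ⟨_, labelPos_lt σ.d_pos k, fun h => hwk (by rw [h] at hstep; simpa using hstep)⟩
  have hcover : σ.lamᶜ ⊆ S (ArcName.upVal w k) ∪ S (ArcName.upVal w l) := by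
    intro q hq
    obtain ⟨x, rfl⟩ := Quot.exists_rep q
    obtain ⟨ε, hε⟩ := mem_region_of_notMem_arc h0 x.2 (fun i τ hx =>
      hq (mem_lam_iff.2 ⟨i, τ, x, hx, rfl⟩))
    have : ∀ x y z : ZMod 2, x ≠ y → z = x ∨ z = y := by decide
    rcases this _ _ ε hkl with rfl | rfl
    · exact .inl hε
    · exact .inr hε
  obtain ⟨q, -, h1, h2⟩ := hpc _ _ (hSo _) (hSo _) hcover
    ((hedge k hk).mono fun q hq => ⟨hSlam _ hq, hq⟩)
    ((hedge l hl).mono fun q hq => ⟨hSlam _ hq, hq⟩)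
  obtain ⟨x, rfl⟩ := Quot.exists_rep q
  exact hkl (region_unique h0 ((hS _ x).1 h1) ((hS _ x).1 h2))

end region

/-! ### Connectedness of Λ for n = 1 -/

lemma add_int_mem_coverArc {i l : ℤ} {τ : ArcName σ.a σ.b σ.c} {p : ℂ} :
    p + l ∈ σ.coverArc (i + l) τ ↔ p ∈ σ.coverArc i τ := by
  have hd := σ.d_eq
  cases τ with
  | upper j =>
    refine (mem_horizontal_iff (two_mul_add_one_lt j) _).trans
      (Iff.trans ?_ (mem_horizontal_iff (two_mul_add_one_lt j) i).symm)
    simp only [Complex.add_re, Complex.add_im, Complex.intCast_re, Complex.intCast_im, add_zero]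
    refine and_congr_right' (and_congr ?_ ?_) <;> push_cast <;> constructor <;> intro h <;> linarith
  | lower j =>
    refine (mem_lower_horizontal_iff (two_mul_add_one_lt j) _).trans
      (Iff.trans ?_ (mem_lower_horizontal_iff (two_mul_add_one_lt j) i).symm)
    simp only [Complex.add_re, Complex.add_im, Complex.intCast_re, Complex.intCast_im, add_zero]
    refine and_congr_right' (and_congr ?_ ?_) <;> push_cast <;> constructor <;> intro h <;> linarith
  | oblique k =>
    refine (mem_descent_iff (by omega) (by omega) _ _).trans
      (Iff.trans ?_ (mem_descent_iff (by omega) (by omega) _ _).symm)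
    rw [add_right_comm i l 1, strand_add]
    simp only [Complex.add_re, Complex.add_im, Complex.intCast_re, Complex.intCast_im, add_zero,
      add_left_inj]
  | vertical k =>
    refine (mem_descent_iff (by omega) (by omega) _ _).trans
      (Iff.trans ?_ (mem_descent_iff (by omega) (by omega) _ _).symm)
    rw [strand_add]
    simp only [Complex.add_re, Complex.add_im, Complex.intCast_re, Complex.intCast_im, add_zero,
      add_left_inj]

lemma arc_eq_arc (hn : σ.n = 1) (i i' : ℤ) (τ : ArcName σ.a σ.b σ.c) :
    σ.arc i τ = σ.arc i' τ := by
  have key : ∀ i i', σ.arc i τ ⊆ σ.arc i' τ := by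
    rintro i i' _ ⟨p, hp, rfl⟩
    refine ⟨p + (i' - i : ℤ), ?_, wrap_add_int hn _ _⟩
    have h := (add_int_mem_coverArc (l := i' - i)).2 hp
    rwa [add_sub_cancel] at h
  exact (key i i').antisymm (key i' i)

/-- For `n = 1`, if the arcs do not disconnect the surface, then they form a single cycle. -/
theorem isPreconnected_lam (hn : σ.n = 1) (h : IsPreconnected σ.lamᶜ) : IsPreconnected σ.lam := by
  classical
  rw [isPreconnected_iff_subset_of_disjoint]
  intro u v hu hv huv hdisj
  by_contra hnot
  rw [not_or] at hnot
  have harc : ∀ i τ, σ.onSurface (σ.arc i τ) ⊆ u ∨ σ.onSurface (σ.arc i τ) ⊆ v := fun i τ =>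
    isPreconnected_iff_subset_of_disjoint.1 (isConnected_onSurface_arc i τ).isPreconnected u v hu hv
      ((onSurface_arc_subset_lam i τ).trans huv)
      (subset_empty_iff.1
        ((inter_subset_inter_left _ (onSurface_arc_subset_lam i τ)).trans hdisj.le))
  -- An arc is connected, so it lies entirely in `u` or in `v`; since `n = 1`, column 0 already
  -- contains every arc.
  set χ : ArcName σ.a σ.b σ.c → ℤ := fun τ => if σ.onSurface (σ.arc 0 τ) ⊆ u then 1 else 0
  have hχ : ∀ {i τ q}, q ∈ σ.onSurface (σ.arc i τ) → χ τ = if q ∈ u then 1 else 0 := by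
    intro i τ q hq
    have hq' := hq
    rw [arc_eq_arc hn i 0] at hq'
    by_cases h1 : σ.onSurface (σ.arc 0 τ) ⊆ u
    · simp only [χ, if_pos h1, if_pos (h1 hq')]
    · have h2 : q ∉ u := fun h3 => by
        have : q ∈ σ.lam ∩ (u ∩ v) :=
          ⟨onSurface_arc_subset_lam i τ hq, h3, ((harc 0 τ).resolve_left h1) hq'⟩
        rwa [hdisj] at this
      simp only [χ, if_neg h1, if_neg h2]
  have h01 : ∀ τ, χ τ = 0 ∨ χ τ = 1 := fun τ => by
    simp only [χ]; split_ifs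
    · exact .inr rfl
    · exact .inl rfl
  have hz : ∃ τ, χ τ = 0 := by
    obtain ⟨q, hq, hqu⟩ := not_subset.1 hnot.1
    obtain ⟨i, τ, hτ⟩ := mem_lam_iff.1 hq
    exact ⟨τ, by rw [hχ hτ, if_neg hqu]⟩
  have ho : ∃ τ, χ τ = 1 := by
    obtain ⟨q, hq, hqv⟩ := not_subset.1 hnot.2
    obtain ⟨i, τ, hτ⟩ := mem_lam_iff.1 hq
    exact ⟨τ, by rw [hχ hτ, if_pos ((huv hq).resolve_right hqv)]⟩
  have hcomp : ArcName.Compatible σ.d σ.r χ := by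
    intro j
    obtain ⟨i₁, τ₁, hm₁, hw₁⟩ := exists_upperVx_mem (σ := σ) 0 (σ.pos_lt j)
    obtain ⟨i₂, τ₂, hm₂, hw₂⟩ := exists_lowerVx_mem (σ := σ) (0 - σ.s) (σ.pos_lt (j + σ.r))
    change ArcName.upWord χ (σ.pos j) = ArcName.lowWord χ (σ.pos (j + σ.r))
    rw [hw₁, hw₂]
    -- The two arcs share this point of the surface, so they belong to the same class.
    have hg : σ.glueMap ⟨σ.upperPoint 0 j 0, upperPoint_mem_holed _ _ _⟩ =
        σ.glueMap ⟨σ.lowerPoint (0 - σ.s) j 0, lowerPoint_mem_holed _ _ _⟩ :=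
      Quot.sound ⟨0, j, 0, by norm_num, rfl, rfl⟩
    rw [hχ (i := i₁) ⟨⟨σ.upperPoint 0 j 0, upperPoint_mem_holed _ _ _⟩, ⟨_, hm₁, rfl⟩, rfl⟩,
      hχ (i := i₂) ⟨⟨σ.lowerPoint (0 - σ.s) j 0, lowerPoint_mem_holed _ _ _⟩, ⟨_, hm₂, rfl⟩, rfl⟩,
      hg]
  obtain ⟨w, ⟨τ, hτ⟩, h0, hw, hval⟩ := ArcName.exists_null_weight σ.d_eq σ.d_pos h01 hz ho hcomp
  refine not_isPreconnected_compl_lam hn h0 hval ?_ h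
  rcases ArcName.exists_upWord_or_lowWord σ.d_eq (w := w) τ with ⟨k, hk, e⟩ | ⟨k, hk, e⟩
  · exact ⟨k, hk, by rwa [e]⟩
  -- A lower horizontal arc has no end on an upper circle; compatibility transfers its nonzero
  -- weight to the upper vertex glued to its end.
  · have h1 := hw (k + 1 - σ.r)
    rw [sub_add_cancel, labelPos_natCast_succ hk, e] at h1
    exact ⟨_, labelPos_lt σ.d_pos _, by rwa [h1]⟩

end SixTuple

/-! ### Orbit spaces of cyclic groups of homeomorphisms -/

/-- Transports the powers of the rotation between the cover, the sphere, the sphere with holes and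
the surface; with a one-point source it handles fixed points. -/
lemma zpow_semiconj {X Y : Type*} [TopologicalSpace X] [TopologicalSpace Y] (f : X ≃ₜ X)
    (g : Y ≃ₜ Y) (h : X → Y) (hsem : ∀ x, g (h x) = h (f x)) (k : ℤ) (x : X) :
    (g ^ k) (h x) = h ((f ^ k) x) := by
  have hinv : ∀ x, g⁻¹ (h x) = h (f⁻¹ x) := by
    intro x
    apply g.injective
    rw [hsem]
    change g (g.symm _) = h (f (f.symm _))
    rw [g.apply_symm_apply, f.apply_symm_apply]
  induction k using Int.induction_on generalizing x with
  | zero => rfl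
  | succ k ih =>
    rw [zpow_add_one, zpow_add_one]
    change (g ^ (k : ℤ)) (g (h x)) = h ((f ^ (k : ℤ)) (f x))
    rw [hsem, ih]
  | pred k ih =>
    rw [zpow_sub_one, zpow_sub_one]
    change (g ^ (-(k : ℤ))) (g⁻¹ (h x)) = h ((f ^ (-(k : ℤ))) (f⁻¹ x))
    rw [hinv, ih]

lemma zpow_apply_of_fixed {X : Type*} [TopologicalSpace X] (f : X ≃ₜ X) {x : X} (hx : f x = x)
    (k : ℤ) : (f ^ k) x = x :=
  zpow_semiconj (Homeomorph.refl Unit) f (fun _ => x) (fun _ => hx) k ()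

section orbit

variable {X Y : Type} [TopologicalSpace X] [TopologicalSpace Y] {ρ : X ≃ₜ X} {π : X → Y}

/-- A quotient map whose fibres are the orbits of `ρ` identifies the orbit space. -/
lemma exists_orbitHomeomorph (hq : IsQuotientMap π)
    (hf : ∀ x y, π x = π y ↔ ∃ k : ℤ, (ρ ^ k) x = y) :
    ∃ φ : OrbitSpace ρ ≃ₜ Y, ∀ x, φ (orbitMap ρ x) = π x := by
  set f : OrbitSpace ρ → Y := Quotient.lift π fun x y h => (hf x y).2 h
  have hcomp : f ∘ orbitMap ρ = π := rfl
  have hfq : IsQuotientMap f :=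
    IsQuotientMap.of_comp_isQuotientMap (f := orbitMap ρ) isQuotientMap_quotient_mk' hq
  have hinj : Function.Injective f := by
    intro x y
    induction x using Quotient.inductionOn
    induction y using Quotient.inductionOn
    exact fun h => Quotient.sound ((hf _ _).1 h)
  exact ⟨(isHomeomorph_iff_isQuotientMap_injective.2 ⟨hfq, hinj⟩).homeomorph f, fun x => rfl⟩

/-- The saturation of an open set is the union of its translates. -/
lemma isOpenMap_of_fibres (hq : IsQuotientMap π)
    (hf : ∀ x y, π x = π y ↔ ∃ k : ℤ, (ρ ^ k) x = y) : IsOpenMap π := by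
  intro U hU
  rw [← hq.isOpen_preimage]
  have : π ⁻¹' (π '' U) = ⋃ k : ℤ, (ρ ^ k) '' U := by
    ext y
    simp only [mem_preimage, mem_image, mem_iUnion, hf]
    constructor
    · rintro ⟨x, hx, k, h⟩; exact ⟨k, x, hx, h⟩
    · rintro ⟨k, x, hx, h⟩; exact ⟨x, hx, k, h⟩
  rw [this]
  exact isOpen_iUnion fun k => (ρ ^ k).isOpenMap _ hU

lemma image_connectedComponentIn_of_image_eq {F : Set X} (f : X ≃ₜ X) (hF : f '' F = F) {x : X}
    (hx : x ∈ F) : f '' connectedComponentIn F x = connectedComponentIn F (f x) := by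
  have := f.image_connectedComponentIn hx
  rwa [hF] at this

/-- A set between a preconnected set and its closure is preconnected, so components are relatively
closed. -/
lemma closure_connectedComponentIn_inter {F : Set X} {x : X} (hx : x ∈ F) :
    closure (connectedComponentIn F x) ∩ F = connectedComponentIn F x := by
  refine Subset.antisymm ?_ fun y hy => ⟨subset_closure hy, connectedComponentIn_subset F x hy⟩
  have h : IsPreconnected (closure (connectedComponentIn F x) ∩ F) :=
    isPreconnected_connectedComponentIn.subset_closure
      (fun y hy => ⟨subset_closure hy, connectedComponentIn_subset F x hy⟩) inter_subset_left
  exact h.subset_connectedComponentIn ⟨subset_closure (mem_connectedComponentIn hx), hx⟩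
    inter_subset_right

/-- If a set has finitely many components and its orbit space is connected, then the group
permutes the components transitively. -/
lemma exists_zpow_image_component (hq : IsQuotientMap π)
    (hf : ∀ x y, π x = π y ↔ ∃ k : ℤ, (ρ ^ k) x = y) {F : Set X} {F' : Set Y}
    (hF : π ⁻¹' F' = F) (hF' : IsPreconnected F')
    (hfin : {D | ∃ x ∈ F, D = connectedComponentIn F x}.Finite) {x y : X} (hx : x ∈ F)
    (hy : y ∈ F) : ∃ k : ℤ, (ρ ^ k) '' connectedComponentIn F x = connectedComponentIn F y := by
  have hinv : ∀ k : ℤ, (ρ ^ k) '' F = F := by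
    intro k
    have hmem : ∀ z, (ρ ^ k) z ∈ F ↔ z ∈ F := fun z => by
      rw [← hF, mem_preimage, mem_preimage, ← (hf z _).2 ⟨k, rfl⟩]
    ext z
    constructor
    · rintro ⟨u, hu, rfl⟩; exact (hmem u).2 hu
    · intro hz
      exact ⟨(ρ ^ k).symm z, (hmem _).1 (by simpa using hz), by simp⟩
  set 𝒟 := {D | ∃ x ∈ F, D = connectedComponentIn F x}
  set 𝒟₁ := {D | ∃ k : ℤ, D = (ρ ^ k) '' connectedComponentIn F x}
  have h1 : ∀ z ∈ F, ∀ k : ℤ, connectedComponentIn F ((ρ ^ k) z) ∈ 𝒟₁ ↔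
      connectedComponentIn F z ∈ 𝒟₁ := by
    intro z hz k
    rw [← image_connectedComponentIn_of_image_eq _ (hinv k) hz]
    constructor
    · rintro ⟨l, hl⟩
      refine ⟨-k + l, ?_⟩
      rw [zpow_add]
      change _ = ((ρ ^ (-k)) ∘ (ρ ^ l)) '' _
      rw [image_comp, ← hl, ← image_comp]
      change _ = ((ρ ^ (-k) * ρ ^ k : X ≃ₜ X) : X → X) '' _
      rw [← zpow_add, neg_add_cancel, zpow_zero]
      exact (image_id _).symm
    · rintro ⟨l, hl⟩
      refine ⟨k + l, ?_⟩
      rw [hl, zpow_add, ← image_comp]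
      rfl
  set C := ⋃ D ∈ 𝒟 ∩ 𝒟₁, closure D
  set C' := ⋃ D ∈ 𝒟 \ 𝒟₁, closure D
  -- Finiteness of the set of components is needed here: it makes both unions closed, so the
  -- components in the orbit and the others are separated within `F`.
  have hC : IsClosed C := (hfin.inter_of_left _).isClosed_biUnion fun _ _ => isClosed_closure
  have hC' : IsClosed C' := hfin.sdiff.isClosed_biUnion fun _ _ => isClosed_closure
  have hcomp : ∀ z ∈ F, ∀ D ∈ 𝒟, z ∈ closure D → D = connectedComponentIn F z := by
    rintro z hz D ⟨u, hu, rfl⟩ hzD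
    have : z ∈ connectedComponentIn F u := by
      rw [← closure_connectedComponentIn_inter hu]; exact ⟨hzD, hz⟩
    exact connectedComponentIn_eq this
  have hmC : ∀ z ∈ F, z ∈ C ↔ connectedComponentIn F z ∈ 𝒟₁ := by
    intro z hz
    simp only [C, mem_iUnion, mem_inter_iff, exists_prop]
    constructor
    · rintro ⟨D, ⟨hD, hD1⟩, hzD⟩
      rwa [← hcomp z hz D hD hzD]
    · intro h
      exact ⟨_, ⟨⟨z, hz, rfl⟩, h⟩, subset_closure (mem_connectedComponentIn hz)⟩
  have hmC' : ∀ z ∈ F, z ∈ C' ↔ connectedComponentIn F z ∉ 𝒟₁ := by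
    intro z hz
    simp only [C', mem_iUnion, Set.mem_sdiff, exists_prop]
    constructor
    · rintro ⟨D, ⟨hD, hD1⟩, hzD⟩
      rwa [← hcomp z hz D hD hzD]
    · intro h
      exact ⟨_, ⟨⟨z, hz, rfl⟩, h⟩, subset_closure (mem_connectedComponentIn hz)⟩
  have hopen := isOpenMap_of_fibres hq hf
  have hlift : ∀ z' ∈ F', ∃ z ∈ F, π z = z' := fun z' hz' => by
    obtain ⟨z, rfl⟩ := hq.surjective z'
    exact ⟨z, by rw [← hF]; exact hz', rfl⟩
  have hproj : ∀ z ∈ F, π z ∈ F' := fun z hz => by rw [← hF] at hz; exact hz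
  by_contra hno
  have hy1 : connectedComponentIn F y ∉ 𝒟₁ := by
    rintro ⟨k, hk⟩
    exact hno ⟨k, hk.symm⟩
  have hx1 : connectedComponentIn F x ∈ 𝒟₁ := ⟨0, by rw [zpow_zero]; exact (image_id _).symm⟩
  -- If the component of `y` is not in the orbit, these two open sets cover `F'` and both meet it. A
  -- common point has preimages `z₁`, `z₂` in one orbit whose components are of different kinds.
  obtain ⟨z', hz', ⟨z₁, hz₁, e₁⟩, ⟨z₂, hz₂, e₂⟩⟩ := hF' (π '' Cᶜ) (π '' C'ᶜ)
    (hopen _ hC.isOpen_compl) (hopen _ hC'.isOpen_compl) (by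
      intro z' hz'
      obtain ⟨z, hz, rfl⟩ := hlift z' hz'
      by_cases h : connectedComponentIn F z ∈ 𝒟₁
      · exact .inr ⟨z, fun h' => (hmC' z hz).1 h' h, rfl⟩
      · exact .inl ⟨z, fun h' => h ((hmC z hz).1 h'), rfl⟩)
    ⟨π y, hproj y hy, y, fun h => hy1 ((hmC y hy).1 h), rfl⟩
    ⟨π x, hproj x hx, x, fun h => (hmC' x hx).1 h hx1, rfl⟩
  have hz₁F : z₁ ∈ F := by rw [← hF, mem_preimage, e₁]; exact hz'
  have hz₂F : z₂ ∈ F := by rw [← hF, mem_preimage, e₂]; exact hz'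
  obtain ⟨k, rfl⟩ := (hf z₁ z₂).1 (e₁.trans e₂.symm)
  refine hz₁ ((hmC _ hz₁F).2 ((h1 z₁ hz₁F k).1 ?_))
  by_contra h
  exact hz₂ ((hmC' _ hz₂F).2 h)

end orbit

namespace SixTuple

variable (σ : SixTuple)

/-! ### The quotient of the sphere -/

/-- The map `z ↦ z ^ n` of the sphere. -/
def powMap : Sphere → Sphere := OnePoint.map fun z : ℂ => z ^ σ.n

lemma powMap_infty : σ.powMap OnePoint.infty = OnePoint.infty := rfl

lemma powMap_zero : σ.powMap ((0 : ℂ) : Sphere) = ((0 : ℂ) : Sphere) := by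
  unfold powMap
  rw [OnePoint.map_some, zero_pow σ.n_pos.ne']

lemma powMap_wrap (p : ℂ) : σ.powMap (σ.wrap p) = σ.base.wrap p := by
  have hn := σ.n_ne_zero
  unfold powMap wrap
  rw [OnePoint.map_some, ← Complex.exp_nat_mul, mul_div_cancel₀ _ hn]
  simp [base]

lemma continuous_powMap : Continuous σ.powMap := by
  refine OnePoint.continuous_map (by fun_prop) ?_
  rw [coclosedCompact_eq_cocompact, ← Metric.cobounded_eq_cocompact]
  exact tendsto_pow_cobounded_cobounded σ.n_pos.ne'

lemma surjective_powMap : Function.Surjective σ.powMap := by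
  intro x
  rcases σ.base.sphere_cases x with rfl | rfl | ⟨p, rfl⟩
  · exact ⟨_, σ.powMap_infty⟩
  · exact ⟨_, σ.powMap_zero⟩
  · exact ⟨_, σ.powMap_wrap p⟩

lemma isQuotientMap_powMap : IsQuotientMap σ.powMap :=
  σ.continuous_powMap.isClosedMap.isQuotientMap σ.continuous_powMap σ.surjective_powMap

lemma rotSphere_zpow_wrap (k : ℤ) (p : ℂ) : (σ.rotSphere ^ k) (σ.wrap p) = σ.wrap (p + k) := by
  have h1 := zpow_semiconj (Homeomorph.addRight (1 : ℂ)) σ.rotSphere σ.wrap σ.rotSphere_wrap k p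
  have h2 := zpow_semiconj (Homeomorph.addRight (1 : ℤ)) (Homeomorph.addRight (1 : ℂ))
    (fun m : ℤ => p + m) (fun m => by simp [add_assoc]) k 0
  have h3 : ∀ k : ℤ, (Homeomorph.addRight (1 : ℤ) ^ k) 0 = k := by
    intro k
    induction k using Int.induction_on with
    | zero => rfl
    | succ k ih =>
      rw [add_comm, zpow_add, zpow_one]
      change (Homeomorph.addRight (1 : ℤ) ^ (k : ℤ)) 0 + 1 = _
      rw [ih, add_comm]
    | pred k ih =>
      rw [sub_eq_neg_add, zpow_add, zpow_neg_one]
      change (Homeomorph.addRight (1 : ℤ) ^ (-(k : ℤ))) 0 + -1 = _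
      rw [ih, add_comm]
  rw [h3] at h2
  simp only [Int.cast_zero, add_zero] at h2
  rw [h1, h2]

lemma rotSphere_infty : σ.rotSphere OnePoint.infty = OnePoint.infty := rfl

lemma rotSphere_zero : σ.rotSphere ((0 : ℂ) : Sphere) = ((0 : ℂ) : Sphere) := by
  change ((σ.zeta * 0 : ℂ) : Sphere) = _
  rw [mul_zero]

lemma powMap_rotSphere_zpow (k : ℤ) (x : Sphere) : σ.powMap ((σ.rotSphere ^ k) x) = σ.powMap x := by
  rcases σ.sphere_cases x with rfl | rfl | ⟨p, rfl⟩
  · rw [zpow_apply_of_fixed _ σ.rotSphere_infty]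
  · rw [zpow_apply_of_fixed _ σ.rotSphere_zero]
  · rw [rotSphere_zpow_wrap, powMap_wrap, powMap_wrap, wrap_add_int rfl]

lemma powMap_eq_iff (x y : Sphere) :
    σ.powMap x = σ.powMap y ↔ ∃ k : ℤ, (σ.rotSphere ^ k) x = y := by
  constructor
  · intro h
    rcases σ.sphere_cases x with rfl | rfl | ⟨p, rfl⟩ <;>
      rcases σ.sphere_cases y with rfl | rfl | ⟨q, rfl⟩ <;>
      simp only [powMap_infty, powMap_zero, powMap_wrap] at h
    · exact ⟨0, rfl⟩
    · exact absurd h (OnePoint.infty_ne_coe _)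
    · exact absurd h.symm (wrap_ne_infty q)
    · exact absurd h (OnePoint.coe_ne_infty _)
    · exact ⟨0, rfl⟩
    · exact absurd h.symm (wrap_ne_zero q)
    · exact absurd h (wrap_ne_infty p)
    · exact absurd h (wrap_ne_zero p)
    · obtain ⟨k, rfl⟩ := wrap_eq_wrap_iff.1 h.symm
      refine ⟨k, ?_⟩
      rw [rotSphere_zpow_wrap]
      simp [base]
  · rintro ⟨k, rfl⟩
    rw [powMap_rotSphere_zpow]

lemma powMap_mem_holed {x : Sphere} : σ.powMap x ∈ σ.base.holed ↔ x ∈ σ.holed := by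
  rcases σ.sphere_cases x with rfl | rfl | ⟨p, rfl⟩
  · exact iff_of_true infty_mem_holed infty_mem_holed
  · rw [powMap_zero]; exact iff_of_true zero_mem_holed zero_mem_holed
  · rw [powMap_wrap, wrap_mem_holed, wrap_mem_holed]

lemma base_upperPoint (i i' j : ℤ) (t : ℝ) :
    σ.base.upperPoint i j t = σ.base.upperPoint i' j t := by
  have h : upperPt σ.base.d i (σ.base.pos j) t =
      upperPt σ.base.d i' (σ.base.pos j) t + (i - i' : ℤ) := by
    unfold upperPt centre; push_cast; ring
  unfold upperPoint
  rw [h, wrap_add_int rfl]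

lemma base_lowerPoint (i i' j : ℤ) (t : ℝ) :
    σ.base.lowerPoint i j t = σ.base.lowerPoint i' j t := by
  have h : lowerPt σ.base.d i (σ.base.pos (j + σ.base.r)) t =
      lowerPt σ.base.d i' (σ.base.pos (j + σ.base.r)) t + (i - i' : ℤ) := by
    simp only [lowerPt, upperPt, centre, map_add, map_intCast]; push_cast; ring
  unfold lowerPoint
  rw [h, wrap_add_int rfl]

lemma powMap_upperPoint (i i' j : ℤ) (t : ℝ) :
    σ.powMap (σ.upperPoint i j t) = σ.base.upperPoint i' j t := by
  rw [σ.base_upperPoint i' i]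
  exact σ.powMap_wrap _

lemma powMap_lowerPoint (i i' j : ℤ) (t : ℝ) :
    σ.powMap (σ.lowerPoint i j t) = σ.base.lowerPoint i' j t := by
  rw [σ.base_lowerPoint i' i]
  exact σ.powMap_wrap _

/-! ### The quotient of the surface -/

/-- The map `z ↦ z ^ n` between the spheres with holes. -/
def powHoled (x : σ.holed) : σ.base.holed := ⟨σ.powMap x.1, σ.powMap_mem_holed.2 x.2⟩

lemma surjective_powHoled : Function.Surjective σ.powHoled := by
  rintro ⟨y, hy⟩
  obtain ⟨x, rfl⟩ := σ.surjective_powMap y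
  exact ⟨⟨x, σ.powMap_mem_holed.1 hy⟩, rfl⟩

/-- The sphere with holes is closed in the sphere, hence compact, so this continuous surjection onto
a Hausdorff space is closed. -/
lemma isQuotientMap_powHoled : IsQuotientMap σ.powHoled := by
  have hc : Continuous σ.powHoled := (σ.continuous_powMap.comp continuous_subtype_val).subtype_mk _
  have hclosed : IsClosed σ.holed := by
    rw [holed_eq, isClosed_compl_iff]
    refine isOpenMap_wrap _ (isOpen_iUnion fun i => isOpen_ball.union isOpen_ball)
  have : CompactSpace σ.holed := isCompact_iff_compactSpace.1 hclosed.isCompact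
  exact hc.isClosedMap.isQuotientMap hc σ.surjective_powHoled

lemma glue_powHoled {x y : σ.holed} (h : σ.Glue x y) :
    σ.base.Glue (σ.powHoled x) (σ.powHoled y) := by
  obtain ⟨i, j, t, ht, hx, hy⟩ := h
  refine ⟨i, j, t, ht, ?_, ?_⟩
  · change σ.powMap x.1 = _
    rw [hx, powMap_upperPoint]
  · change σ.powMap y.1 = _
    rw [hy, powMap_lowerPoint]

/-- The projection `T_n → T_1`. -/
def proj : σ.Surface → σ.base.Surface :=
  Quot.lift (fun x => σ.base.glueMap (σ.powHoled x)) fun _ _ h => Quot.sound (σ.glue_powHoled h)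

lemma isQuotientMap_proj : IsQuotientMap σ.proj :=
  IsQuotientMap.of_comp_isQuotientMap (f := σ.glueMap) isQuotientMap_quot_mk
    ((isQuotientMap_quot_mk (r := σ.base.Glue)).comp σ.isQuotientMap_powHoled)

lemma rot_zpow_glueMap (k : ℤ) (x : σ.holed) :
    (σ.rot ^ k) (σ.glueMap x) = σ.glueMap ((σ.rotHoled ^ k) x) :=
  zpow_semiconj σ.rotHoled σ.rot σ.glueMap (fun _ => rfl) k x

lemma coe_rotHoled_zpow (k : ℤ) (x : σ.holed) :
    ((σ.rotHoled ^ k) x).1 = (σ.rotSphere ^ k) x.1 :=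
  (zpow_semiconj σ.rotHoled σ.rotSphere (fun x => x.1) (fun _ => rfl) k x).symm

lemma proj_rot_zpow (k : ℤ) (q : σ.Surface) : σ.proj ((σ.rot ^ k) q) = σ.proj q := by
  obtain ⟨x, rfl⟩ := Quot.exists_rep q
  change σ.proj ((σ.rot ^ k) (σ.glueMap x)) = σ.proj (σ.glueMap x)
  rw [rot_zpow_glueMap]
  change σ.base.glueMap (σ.powHoled _) = σ.base.glueMap (σ.powHoled _)
  congr 1
  apply Subtype.ext
  change σ.powMap _ = σ.powMap _
  rw [coe_rotHoled_zpow, powMap_rotSphere_zpow]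

lemma exists_zpow_of_powHoled_eq {x y : σ.holed} (h : σ.powHoled x = σ.powHoled y) :
    ∃ k : ℤ, (σ.rot ^ k) (σ.glueMap x) = σ.glueMap y := by
  obtain ⟨k, hk⟩ := (σ.powMap_eq_iff x.1 y.1).1 (congrArg Subtype.val h)
  refine ⟨k, ?_⟩
  rw [rot_zpow_glueMap]
  congr 1
  exact Subtype.ext (by rw [coe_rotHoled_zpow, hk])

/-- An identification on T_1 is a finite chain of gluings. Each gluing lifts to one on T_n, say in
column 0, and the lifts fit together up to rotations. -/
lemma proj_eq_iff (q q' : σ.Surface) : σ.proj q = σ.proj q' ↔ ∃ k : ℤ, (σ.rot ^ k) q = q' := by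
  constructor
  · obtain ⟨x, rfl⟩ := Quot.exists_rep q
    obtain ⟨y, rfl⟩ := Quot.exists_rep q'
    intro h
    have h' : Relation.EqvGen σ.base.Glue (σ.powHoled x) (σ.powHoled y) := Quot.eqvGen_exact h
    have key : ∀ u v, Relation.EqvGen σ.base.Glue u v → ∀ x y, σ.powHoled x = u →
        σ.powHoled y = v → (orbitSetoid σ.rot) (σ.glueMap x) (σ.glueMap y) := by
      intro u v huv
      induction huv with
      | rel u v huv =>
        rintro x y rfl rfl
        obtain ⟨i, j, t, ht, hx, hy⟩ := huv
        have hx' : σ.powHoled x = σ.powHoled ⟨σ.upperPoint 0 j t, upperPoint_mem_holed _ _ _⟩ :=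
          Subtype.ext (hx.trans (σ.powMap_upperPoint 0 i j t).symm)
        have hy' : σ.powHoled ⟨σ.lowerPoint (0 - σ.s) j t, lowerPoint_mem_holed _ _ _⟩ =
            σ.powHoled y :=
          Subtype.ext ((σ.powMap_lowerPoint _ _ j t).trans hy.symm)
        have hg : σ.glueMap ⟨σ.upperPoint 0 j t, upperPoint_mem_holed _ _ _⟩ =
            σ.glueMap ⟨σ.lowerPoint (0 - σ.s) j t, lowerPoint_mem_holed _ _ _⟩ :=
          Quot.sound ⟨0, j, t, ht, rfl, rfl⟩
        refine (orbitSetoid σ.rot).trans (σ.exists_zpow_of_powHoled_eq hx') ?_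
        rw [hg]
        exact σ.exists_zpow_of_powHoled_eq hy'
      | refl u =>
        rintro x y rfl hy
        exact σ.exists_zpow_of_powHoled_eq hy.symm
      | symm u v _ ih => exact fun x y hx hy => (orbitSetoid σ.rot).symm (ih y x hy hx)
      | trans u v w _ _ ih₁ ih₂ =>
        intro x y hx hy
        obtain ⟨z, hz⟩ := σ.surjective_powHoled v
        exact (orbitSetoid σ.rot).trans (ih₁ x z hx hz) (ih₂ z y hz hy)
    exact key _ _ h' x y rfl rfl
  · rintro ⟨k, rfl⟩
    rw [proj_rot_zpow]

lemma proj_image_onSurface {A A' : Set Sphere} (h : σ.powMap '' A = A') :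
    σ.proj '' σ.onSurface A = σ.base.onSurface A' := by
  subst h
  ext q
  constructor
  · rintro ⟨_, ⟨x, hx, rfl⟩, rfl⟩
    exact ⟨σ.powHoled x, ⟨x.1, hx, rfl⟩, rfl⟩
  · rintro ⟨y, ⟨x, hx, hxy⟩, rfl⟩
    have hx' : x ∈ σ.holed := σ.powMap_mem_holed.1 (by rw [hxy]; exact y.2)
    exact ⟨σ.glueMap ⟨x, hx'⟩, ⟨_, hx, rfl⟩, congrArg σ.base.glueMap (Subtype.ext hxy)⟩

lemma powMap_image_arc (i i' : ℤ) (τ : ArcName σ.a σ.b σ.c) :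
    σ.powMap '' σ.arc i τ = σ.base.arc i' τ := by
  -- The arcs in the cover depend neither on `n` nor on `s`, and for the base all columns coincide.
  have h : σ.base.arc i' τ = σ.base.wrap '' σ.coverArc i τ :=
    (arc_eq_arc (σ := σ.base) rfl i' i τ).trans
      (congrArg (fun A : Set ℂ => σ.base.wrap '' A) (by cases τ <;> rfl))
  rw [h, arc, ← image_comp]
  exact image_congr fun p _ => σ.powMap_wrap p

lemma proj_image_curveC (i : ℤ) : σ.proj '' σ.curveC i = σ.base.curveC i := by
  refine σ.proj_image_onSurface ?_
  unfold upperCycle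
  rw [← image_comp]
  exact image_congr fun p _ => σ.powMap_wrap p

lemma proj_image_lam : σ.proj '' σ.lam = σ.base.lam := by
  refine σ.proj_image_onSurface ?_
  ext y
  constructor
  · rintro ⟨x, hx, rfl⟩
    obtain ⟨i, hi⟩ := mem_iUnion.1 hx
    obtain ⟨τ, hτ⟩ := mem_iUnion.1 hi
    exact mem_iUnion.2 ⟨i, mem_iUnion.2 ⟨τ, (σ.powMap_image_arc i i τ).subset ⟨x, hτ, rfl⟩⟩⟩
  · intro hy
    obtain ⟨i, hi⟩ := mem_iUnion.1 hy
    obtain ⟨τ, hτ⟩ := mem_iUnion.1 hi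
    obtain ⟨x, hx, rfl⟩ := (σ.powMap_image_arc i i τ).superset hτ
    exact ⟨x, mem_iUnion.2 ⟨i, mem_iUnion.2 ⟨τ, hx⟩⟩, rfl⟩

lemma rot_zpow_mem_lam {k : ℤ} {q : σ.Surface} (hq : q ∈ σ.lam) : (σ.rot ^ k) q ∈ σ.lam := by
  obtain ⟨i, τ, x, ⟨p, hp, hx⟩, rfl⟩ := mem_lam_iff.1 hq
  rw [rot_zpow_glueMap]
  refine mem_lam_iff.2 ⟨i + k, τ, _, ⟨p + k, add_int_mem_coverArc.2 hp, ?_⟩, rfl⟩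
  rw [coe_rotHoled_zpow, ← hx, rotSphere_zpow_wrap]

lemma proj_preimage_lam : σ.proj ⁻¹' σ.base.lam = σ.lam := by
  refine Subset.antisymm ?_ ?_
  · intro q hq
    rw [mem_preimage, ← proj_image_lam] at hq
    obtain ⟨q', hq', h⟩ := hq
    obtain ⟨k, rfl⟩ := (σ.proj_eq_iff q' q).1 h
    exact σ.rot_zpow_mem_lam hq'
  · intro q hq
    rw [mem_preimage, ← proj_image_lam]
    exact ⟨q, hq, rfl⟩

lemma lam_nonempty : σ.lam.Nonempty := by
  obtain ⟨i, τ, h, -⟩ := exists_upperVx_mem (σ := σ) 0 σ.d_pos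
  exact (isConnected_onSurface_arc i τ).nonempty.mono (onSurface_arc_subset_lam i τ)

/-! ### The action of the rotation group on the curves -/

lemma rot_pow_n : σ.rot ^ σ.n = 1 := by
  apply Homeomorph.ext
  intro q
  obtain ⟨x, rfl⟩ := Quot.exists_rep q
  rw [← zpow_natCast]
  change (σ.rot ^ (σ.n : ℤ)) (σ.glueMap x) = σ.glueMap x
  rw [rot_zpow_glueMap]
  congr 1
  apply Subtype.ext
  rw [coe_rotHoled_zpow]
  rcases σ.sphere_cases x.1 with h | h | ⟨p, h⟩
  · rw [h, zpow_apply_of_fixed _ σ.rotSphere_infty]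
  · rw [h, zpow_apply_of_fixed _ σ.rotSphere_zero]
  · rw [← h, rotSphere_zpow_wrap]
    exact wrap_eq_wrap_iff.2 ⟨1, by simp⟩

lemma exists_lt_zpow_eq (k : ℤ) : ∃ j < σ.n, σ.rot ^ k = σ.rot ^ j := by
  have hn : (0 : ℤ) < σ.n := by exact_mod_cast σ.n_pos
  have h1 := Int.emod_nonneg k hn.ne'
  have h2 := Int.emod_lt_of_pos k hn
  refine ⟨(k % σ.n).toNat, by omega, ?_⟩
  conv_lhs => rw [← Int.emod_add_mul_ediv k σ.n, zpow_add, zpow_mul, zpow_natCast, rot_pow_n,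
    one_zpow, mul_one]
  rw [← zpow_natCast, Int.toNat_of_nonneg h1]

lemma rot_zpow_image_lam (k : ℤ) : (σ.rot ^ k) '' σ.lam = σ.lam := by
  refine Subset.antisymm ?_ fun q hq => ⟨(σ.rot ^ (-k)) q, σ.rot_zpow_mem_lam hq, ?_⟩
  · rintro _ ⟨q, hq, rfl⟩; exact σ.rot_zpow_mem_lam hq
  · change (σ.rot ^ k * σ.rot ^ (-k)) q = q
    rw [← zpow_add, add_neg_cancel, zpow_zero]; rfl

lemma rot_zpow_image_mem_curvesD (k : ℤ) {D : Set σ.Surface} (hD : D ∈ σ.curvesD) :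
    (σ.rot ^ k) '' D ∈ σ.curvesD := by
  obtain ⟨q, hq, rfl⟩ := hD
  exact ⟨_, σ.rot_zpow_mem_lam hq,
    image_connectedComponentIn_of_image_eq _ (σ.rot_zpow_image_lam k) hq⟩

lemma isConnected_base_compl_lam (h : IsConnected σ.lamᶜ) : IsConnected σ.base.lamᶜ := by
  have : σ.proj '' σ.lamᶜ = σ.base.lamᶜ := by
    rw [← proj_preimage_lam, ← preimage_compl, image_preimage_eq _ σ.isQuotientMap_proj.surjective]
  rw [← this]
  exact h.image _ σ.isQuotientMap_proj.continuous.continuousOn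

lemma curvesD_eq_singleton (h : IsPreconnected σ.lam) : σ.curvesD = {σ.lam} := by
  ext D
  rw [mem_singleton_iff]
  constructor
  · rintro ⟨q, hq, rfl⟩
    exact h.connectedComponentIn hq
  · rintro rfl
    obtain ⟨q, hq⟩ := σ.lam_nonempty
    exact ⟨q, hq, (h.connectedComponentIn hq).symm⟩

lemma curvesD_nonempty : σ.curvesD.Nonempty := by
  obtain ⟨q, hq⟩ := σ.lam_nonempty
  exact ⟨_, q, hq, rfl⟩

section admissible

variable {σ} (hσ : σ.Admissible)
include hσ

lemma Admissible.isPreconnected_base_lam : IsPreconnected σ.base.lam :=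
  isPreconnected_lam rfl (σ.isConnected_base_compl_lam hσ.2).isPreconnected

lemma Admissible.base : σ.base.Admissible :=
  ⟨by rw [σ.base.curvesD_eq_singleton hσ.isPreconnected_base_lam, ncard_singleton]; rfl,
    σ.isConnected_base_compl_lam hσ.2⟩

/-- The rotation permutes the curves of `𝒟` transitively. -/
lemma Admissible.exists_zpow_image_eq {D D' : Set σ.Surface} (hD : D ∈ σ.curvesD)
    (hD' : D' ∈ σ.curvesD) : ∃ k : ℤ, (σ.rot ^ k) '' D = D' := by
  obtain ⟨q, hq, rfl⟩ := hD
  obtain ⟨q', hq', rfl⟩ := hD'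
  refine exists_zpow_image_component σ.isQuotientMap_proj σ.proj_eq_iff σ.proj_preimage_lam
    hσ.isPreconnected_base_lam (finite_of_ncard_pos ?_) hq hq'
  -- `ncard` is 0 on infinite sets, so the value `n > 0` implies finiteness.
  have h := hσ.1
  unfold curvesD at h
  rw [h]
  exact σ.n_pos

lemma Admissible.image_pow_eq_curvesD {D : Set σ.Surface} (hD : D ∈ σ.curvesD) :
    (fun j : ℕ => (σ.rot ^ j) '' D) '' (Finset.range σ.n) = σ.curvesD := by
  refine Subset.antisymm ?_ ?_
  · rintro _ ⟨j, -, rfl⟩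
    have := σ.rot_zpow_image_mem_curvesD j hD
    rwa [zpow_natCast] at this
  · intro D' hD'
    obtain ⟨k, rfl⟩ := hσ.exists_zpow_image_eq hD hD'
    obtain ⟨j, hj, h⟩ := σ.exists_lt_zpow_eq k
    exact ⟨j, by simpa using hj, by rw [h]⟩

/-- The `n` exponents are mapped onto the `n` curves, so no two have the same image. The exact
number of curves is used here. -/
lemma Admissible.injOn_pow {D : Set σ.Surface} (hD : D ∈ σ.curvesD) :
    InjOn (fun j : ℕ => (σ.rot ^ j) '' D) (Finset.range σ.n) := by
  refine injOn_of_ncard_image_eq ?_ (Finset.finite_toSet _)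
  rw [hσ.image_pow_eq_curvesD hD, hσ.1, ncard_coe_finset, Finset.card_range]

/-- By transitivity every point of Λ is a translate of a point of `D`, and translates have the same
projection. -/
lemma Admissible.proj_image_curve {D : Set σ.Surface} (hD : D ∈ σ.curvesD) :
    σ.proj '' D = σ.base.lam := by
  rw [← proj_image_lam]
  refine Subset.antisymm ?_ ?_
  · obtain ⟨q, -, rfl⟩ := hD
    exact image_mono (connectedComponentIn_subset _ _)
  · rintro _ ⟨q, hq, rfl⟩
    obtain ⟨k, hk⟩ := hσ.exists_zpow_image_eq hD ⟨q, hq, rfl⟩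
    have := mem_connectedComponentIn hq
    rw [← hk] at this
    obtain ⟨q', hq', rfl⟩ := this
    exact ⟨q', hq', (σ.proj_rot_zpow k q').symm⟩

/-- The diagram of the base is the quotient by the rotation group. -/
theorem Admissible.baseIsQuotient : σ.BaseIsQuotient := by
  obtain ⟨φ, hφ⟩ := exists_orbitHomeomorph σ.isQuotientMap_powMap σ.powMap_eq_iff
  obtain ⟨ψ, hψ⟩ := exists_orbitHomeomorph σ.isQuotientMap_proj σ.proj_eq_iff
  have hφi : ∀ A : Set Sphere, φ '' (orbitMap σ.rotSphere '' A) = σ.powMap '' A := fun A => by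
    rw [← image_comp]; exact image_congr fun x _ => hφ x
  have hψi : ∀ A : Set σ.Surface, ψ '' (orbitMap σ.rot '' A) = σ.proj '' A := fun A => by
    rw [← image_comp]; exact image_congr fun x _ => hψ x
  refine ⟨φ, ψ, fun i j t _ => ⟨?_, ?_⟩, fun i τ => ?_, ?_, fun x y hxy => ?_, ?_, ?_⟩
  · rw [hφ, powMap_upperPoint]
  · rw [hφ, powMap_lowerPoint]
  · rw [hφi, powMap_image_arc]
  · rw [hφi]
    ext y
    obtain ⟨x, rfl⟩ := σ.surjective_powMap y
    rw [powMap_mem_holed]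
    refine ⟨?_, fun hx => ⟨x, hx, rfl⟩⟩
    rintro ⟨x', hx', h⟩
    rw [← powMap_mem_holed, ← h, powMap_mem_holed]
    exact hx'
  · rw [hψ]
    rw [hφ] at hxy
    exact congrArg σ.base.glueMap (Subtype.ext hxy)
  · simp only [hψi]
    unfold curvesC
    rw [← range_comp]
    congr 1
    funext i
    exact σ.proj_image_curveC i
  · simp only [hψi]
    rw [σ.base.curvesD_eq_singleton hσ.isPreconnected_base_lam,
      image_congr (fun D hD => hσ.proj_image_curve hD), σ.curvesD_nonempty.image_const]

end admissible

end SixTuple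

end

end Dunwoody

theorem lemma1 (σ : Dunwoody.SixTuple) (hσ : σ.Admissible) :
    -- (a) the rotation permutes the curves of `𝒟`, cyclically and simply transitively
    (Set.BijOn (fun D => σ.rot '' D) σ.curvesD σ.curvesD ∧
      (∀ D ∈ σ.curvesD,
        σ.curvesD = {D' | ∃ k : ℕ, 1 ≤ k ∧ k ≤ σ.n ∧ D' = (σ.rot ^ (k - 1)) '' D}) ∧
      (∀ D ∈ σ.curvesD, ∀ D' ∈ σ.curvesD, ∃! g, g ∈ σ.rotGroup ∧ g '' D = D')) ∧
    -- (b) the 6-tuple `(a, b, c, 1, r, 0)` is admissible, and its diagram is the quotient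
    (σ.base.Admissible ∧ σ.BaseIsQuotient) := by
  refine ⟨⟨⟨?_, ?_, ?_⟩, ?_, ?_⟩, hσ.base, hσ.baseIsQuotient⟩
  · intro D hD
    have := σ.rot_zpow_image_mem_curvesD 1 hD
    rwa [zpow_one] at this
  · exact (Set.image_injective.2 σ.rot.injective).injOn
  · intro D hD
    refine ⟨(σ.rot ^ (-1 : ℤ)) '' D, σ.rot_zpow_image_mem_curvesD (-1) hD, ?_⟩
    simp only
    rw [← Set.image_comp, zpow_neg_one]
    change ((σ.rot * σ.rot⁻¹ : σ.Surface ≃ₜ σ.Surface) : σ.Surface → σ.Surface) '' D = D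
    rw [mul_inv_cancel]
    exact Set.image_id D
  · intro D hD
    refine (hσ.image_pow_eq_curvesD hD).symm.trans (Set.ext fun D' => ⟨?_, ?_⟩)
    · rintro ⟨j, hj, rfl⟩
      rw [Finset.coe_range, Set.mem_Iio] at hj
      exact ⟨j + 1, by omega, by omega, rfl⟩
    · rintro ⟨k, hk, hkn, rfl⟩
      exact ⟨k - 1, by rw [Finset.coe_range, Set.mem_Iio]; omega, rfl⟩
  · intro D hD D' hD'
    obtain ⟨k, hk⟩ := hσ.exists_zpow_image_eq hD hD'
    refine ⟨σ.rot ^ k, ⟨⟨k, rfl⟩, hk⟩, ?_⟩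
    rintro _ ⟨⟨l, rfl⟩, hl⟩
    simp only at hl ⊢
    -- For uniqueness both exponents are reduced modulo `n`, where distinct powers move `D` to
    -- distinct curves.
    obtain ⟨i, hi, ei⟩ := σ.exists_lt_zpow_eq k
    obtain ⟨j, hj, ej⟩ := σ.exists_lt_zpow_eq l
    rw [ei] at hk ⊢
    rw [ej] at hl ⊢
    rw [hσ.injOn_pow hD (by simpa using hj) (by simpa using hi) (hl.trans hk.symm)]
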